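/- A \emph{partial linear space} is a point-line geometry $(\mathcal P,\mathcal L,\mathrm I)$ in which every line is incident with at least two points and two distinct points are incident with at most one common line. It has \emph{order} $(s,t)$ if every line is incident with precisely $s+1$ points and every point is incident with precisely $t+1$ lines. Distances are measured in the collinearity graph, in which two distinct points are adjacent if and only if they are incident with a common line. A \emph{near hexagon} is a partial linear space whose collinearity graph is connected of diameter $3$ and in which, for every point $x$ and every line $L$, there is a unique point incident with $L$ that is nearest to $x$. Let $\mathrm H(2)$ be the split Cayley hexagon of order $(2,2)$: its points are the points of the quadric $Q(6,2)$ with equation $X_0X_4+X_1X_5+X_2X_6=X_3^2$ in $\mathrm{PG}(6,2)$; its lines are the lines of $\mathrm{PG}(6,2)$ contained in $Q(6,2)$ whose Grassmann coordinates $p_{ij}=x_iy_j-x_jy_i$ satisfy $p_{12}=p_{34}$, $p_{54}=p_{32}$, $p_{20}=p_{35}$, $p_{65}=p_{30}$, $p_{01}=p_{36}$, $p_{46}=p_{31}$; incidence is containment. Let $\mathrm H(2)^D$ be its point-line dual. Let $\mathbb L_3$ be the geometry consisting of a single line with three points, and let $\mathbb L_3\times\mathbb L_3\times\mathbb L_3$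 be the direct product of three copies of it: its $27$ points are the triples of points of $\mathbb L_3$, and its lines are the $27$ sets of three triples obtained by fixing two of the coordinates and letting the third one vary. \textbf{Corollary.} Every near hexagon of order $(2,2)$ is isomorphic to $\mathrm H(2)$, to $\mathrm H(2)^D$, or to $\mathbb L_3\times\mathbb L_3\times\mathbb L_3$. -/

import Mathlib

universe u v u' v'

/-- A point-line geometry with point set `P`, line set `L` and incidence relation `Inc`. -/
structure PointLineGeometry (P : Type u) (L : Type v) where
  /-- `Inc p l`: the point `p` is incident with the line `l`. -/
  Inc : P → L → Prop

namespace PointLineGeometry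

variable {P : Type u} {L : Type v} {P' : Type u'} {L' : Type v'}

/-- A partial linear space: every line is incident with at least two points, and two distinct
points are together incident with at most one line. -/
def IsPartialLinearSpace (S : PointLineGeometry P L) : Prop :=
  (∀ l : L, ∃ p q : P, p ≠ q ∧ S.Inc p l ∧ S.Inc q l) ∧
  ∀ (p q : P) (l m : L), p ≠ q → S.Inc p l → S.Inc q l → S.Inc p m → S.Inc q m → l = m

/-- The geometry has order `(s, t)`: every line is incident with precisely `s + 1` points and
every point is incident with precisely `t + 1` lines. -/
def HasOrder (S : PointLineGeometry P L) (s t : ℕ) : Prop :=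
  (∀ l : L, {p : P | S.Inc p l}.ncard = s + 1) ∧ ∀ p : P, {l : L | S.Inc p l}.ncard = t + 1

/-- The collinearity graph: distinct points are adjacent when some line is incident with both. -/
def collinearityGraph (S : PointLineGeometry P L) : SimpleGraph P where
  Adj p q := p ≠ q ∧ ∃ l : L, S.Inc p l ∧ S.Inc q l
  symm := ⟨fun _ _ h => ⟨h.1.symm, h.2.imp fun _ hl => hl.symm⟩⟩
  loopless := ⟨fun _ h => h.1 rfl⟩

/-- `p` is a point of the line `l` that is nearest to `x` (in the collinearity graph). -/
def IsNearest (S : PointLineGeometry P L) (x : P) (l : L) (p : P) : Prop :=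
  S.Inc p l ∧ ∀ q : P, S.Inc q l → S.collinearityGraph.dist x p ≤ S.collinearityGraph.dist x q

/-- A near `2d`-gon: a partial linear space whose collinearity graph is connected of diameter `d`
and in which every line has a unique point nearest to any given point. -/
structure IsNearPolygon (S : PointLineGeometry P L) (d : ℕ) : Prop where
  partialLinear : S.IsPartialLinearSpace
  connected : S.collinearityGraph.Connected
  diameter : S.collinearityGraph.ediam = (d : ℕ∞)
  nearest : ∀ (x : P) (l : L), ∃! p : P, S.IsNearest x l p

/-- A near hexagon is a near `2d`-gon with `d = 3`. -/
def IsNearHexagon (S : PointLineGeometry P L) : Prop := S.IsNearPolygon 3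

/-- Isomorphism of geometries: bijections between the points and between the lines that preserve
incidence in both directions. -/
def IsIsomorphic (S : PointLineGeometry P L) (S' : PointLineGeometry P' L') : Prop :=
  ∃ (e : P ≃ P') (f : L ≃ L'), ∀ (p : P) (l : L), S.Inc p l ↔ S'.Inc (e p) (f l)

/-- The point-line dual. -/
def dual (S : PointLineGeometry P L) : PointLineGeometry L P where
  Inc l p := S.Inc p l

/-- The direct product: the points are the pairs of points, and the lines are the sets
`{p} × l'` and `l × {p'}`. -/
def prod (S : PointLineGeometry P L) (S' : PointLineGeometry P' L') :
    PointLineGeometry (P × P') ((P × L') ⊕ (L × P')) where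
  Inc x k := match k with
    | Sum.inl (p, l') => x.1 = p ∧ S'.Inc x.2 l'
    | Sum.inr (l, p') => S.Inc x.1 l ∧ x.2 = p'

/-- `L₃`: a single line with three points. -/
def lineThree : PointLineGeometry (Fin 3) Unit where
  Inc _ _ := True

end PointLineGeometry

namespace SplitCayley

/-- The 7-dimensional vector space over the field with two elements. The points of the projective
space PG(6,2) are its nonzero vectors, and the lines of PG(6,2) are the triples `{x, y, x + y}`
with `x`, `y` nonzero and distinct. -/
abbrev Vec : Type := Fin 7 → ZMod 2

/-- The quadratic form `X₀X₄ + X₁X₅ + X₂X₆ - X₃²`, whose zeros form the parabolic quadric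
Q(6,2). -/
def form (x : Vec) : ZMod 2 := x 0 * x 4 + x 1 * x 5 + x 2 * x 6 - x 3 ^ 2

/-- The Grassmann coordinate `p_{ij}` of the line through `x` and `y`. -/
def grassmann (x y : Vec) (i j : Fin 7) : ZMod 2 := x i * y j - x j * y i

/-- Tits' equations for the Grassmann coordinates of the lines of the split Cayley hexagon. -/
def TitsEquations (x y : Vec) : Prop :=
  grassmann x y 1 2 = grassmann x y 3 4 ∧ grassmann x y 5 4 = grassmann x y 3 2 ∧
  grassmann x y 2 0 = grassmann x y 3 5 ∧ grassmann x y 6 5 = grassmann x y 3 0 ∧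
  grassmann x y 0 1 = grassmann x y 3 6 ∧ grassmann x y 4 6 = grassmann x y 3 1

/-- The vector `x` represents a point of Q(6,2). -/
def IsPoint (x : Vec) : Prop := x ≠ 0 ∧ form x = 0

/-- The set `l` of nonzero vectors is a line of PG(6,2) that is contained in Q(6,2) and whose
Grassmann coordinates satisfy Tits' equations. -/
def IsLine (l : Finset Vec) : Prop :=
  ∃ x y : Vec, x ≠ y ∧ IsPoint x ∧ IsPoint y ∧ IsPoint (x + y) ∧ TitsEquations x y ∧
    l = {x, y, x + y}

end SplitCayley

/-- The split Cayley hexagon `H(2)`: its points are all points of Q(6,2), its lines are the lines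
of Q(6,2) whose Grassmann coordinates satisfy Tits' equations, and incidence is containment. -/
def splitCayleyHexagon :
    PointLineGeometry {x : SplitCayley.Vec // SplitCayley.IsPoint x}
      {l : Finset SplitCayley.Vec // SplitCayley.IsLine l} where
  Inc x l := x.1 ∈ l.1

/-! In a near hexagon of order (2,2) the distances from a point to the three points of a line are k,
k+1, k+1. Two points at distance two have at most two common neighbours. Indeed, if x and y have
three, the property spreads to the neighbours of y that are not neighbours of x. Hence nothing is at
distance three from x. The property also passes to the neighbours of x, so by connectivity it holds
at every point, and the diameter would be two (`Full.false`).

Two points at distance two with two common neighbours (`Cross`) lie in a unique 3 × 3 grid. Counting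
by distance from a point that lies in q grids gives 63 - 12q points, so q does not depend on the
point, and q ≤ 3. A second count, of pairs of a point and a grid containing it, shows that 9 divides
(63 - 12q)q, which leaves q = 0 or q = 3 (`cross_dichotomy`).

If q = 3, there are 27 points and any two points at distance two have exactly two common neighbours.
Fix a point x. Every line is mapped bijectively by nearest-point projection to exactly one of the
three lines on x, and to a single point on each of the other two. The three projections are
coordinates that identify the geometry with the product of three lines (`exists_coordinates`,
`isIsomorphic_prod_of_hasDirection`).

If q = 0, the incidence graph is cubic and bipartite, has girth twelve, and any two vertices of
different kinds are at distance at most five (`isHexagonGraph`): the geometry is a generalized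
hexagon. Its 126 vertices form two binary trees of depth five whose roots are joined by an edge.
Only the edges between the two sets of 32 leaves are unknown. The order of the children is
normalized by means of a circuit of length twelve through the root edge (`IsSpine.labelling`). A
depth first search, evaluated by the kernel, then shows that only two completions exist
(`search_eq_true`, `Labelling.realizes`). Explicit vectors over the field with two elements identify
one with `H(2)` and the other with its dual (`isCoding_split`, `isCoding_dual`). -/

namespace HexagonSearch

/-! ### Bit set tables, bipartite graphs and the exhaustive search -/

/-- Function application whose argument is evaluated first. -/
def force {α : Type} (n : ℕ) (f : ℕ → α) : α := Nat.rec (f 0) (fun m _ => f m.succ) n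

/-- Binary trees with natural numbers at the leaves, used as tables. -/
inductive Table where
  | tip (n : ℕ) : Table
  | fork (l r : Table) : Table

namespace Table

/-- Function application whose argument is evaluated first. -/
def force {α : Type} : Table → (Table → α) → α
  | tip n, f => HexagonSearch.force n fun m => f (tip m)
  | fork l r, f => l.force fun l₁ => r.force fun r₁ => f (fork l₁ r₁)

/-- The entry at position `i`, whose lowest binary digit is read first. -/
def get : Table → ℕ → ℕ
  | tip n, _ => n
  | fork l r, i => bif Nat.beq (Nat.mod i 2) 0 then l.get (Nat.div i 2) else r.get (Nat.div i 2)

/-- Change the entry at position `i` to its union with `m`. -/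
def join : Table → ℕ → ℕ → Table
  | tip n, _, m => tip (Nat.lor n m)
  | fork l r, i, m =>
    bif Nat.beq (Nat.mod i 2) 0 then fork (l.join (Nat.div i 2) m) r
    else fork l (r.join (Nat.div i 2) m)

/-- Apply a function to `T.join i m` after the evaluation of the new entry. -/
def withJoin {α : Type} : Table → ℕ → ℕ → (Table → α) → α
  | tip n, _, m, f => HexagonSearch.force (Nat.lor n m) fun k => f (tip k)
  | fork l r, i, m, f =>
    bif Nat.beq (Nat.mod i 2) 0 then l.withJoin (Nat.div i 2) m fun l₁ => f (fork l₁ r)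
    else r.withJoin (Nat.div i 2) m fun r₁ => f (fork l r₁)

/-- The table with `2 ^ n` entries zero. -/
def zero : ℕ → Table
  | 0 => tip 0
  | n + 1 => fork (zero n) (zero n)

/-- Equality of tables. -/
def same : Table → Table → Bool
  | tip n, tip m => Nat.beq n m
  | fork l r, fork l' r' => l.same l' && r.same r'
  | _, _ => false

end Table

/-- A bipartite graph on two copies of `{0, …, 62}`, given by the sets of neighbours of the
vertices of the first and of the second kind. -/
structure Graph where
  fst : Table
  snd : Table

namespace Graph

/-- Function application whose argument is evaluated first. -/
def force {α : Type} (T : Graph) (f : Graph → α) : α :=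
  T.fst.force fun T₁ => T.snd.force fun T₂ => f ⟨T₁, T₂⟩

/-- Exchange the two kinds of vertices. -/
def swap (T : Graph) : Graph := ⟨T.snd, T.fst⟩

/-- Insert the edge between the vertex `i` of the first kind and `j` of the second kind. -/
def add (T : Graph) (i j : ℕ) : Graph :=
  ⟨T.fst.join i (Nat.shiftLeft 1 j), T.snd.join j (Nat.shiftLeft 1 i)⟩

/-- Apply a function to `T.add i j` after its evaluation. -/
def withAdd {α : Type} (T : Graph) (i j : ℕ) (f : Graph → α) : α :=
  T.fst.withJoin i (Nat.shiftLeft 1 j) fun T₁ =>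
    T.snd.withJoin j (Nat.shiftLeft 1 i) fun T₂ => f ⟨T₁, T₂⟩

/-- Insert a list of edges. -/
def addList (T : Graph) (l : List (ℕ × ℕ)) : Graph := l.foldl (fun T e => T.add e.1 e.2) T

/-- Equality of graphs. -/
def same (T S : Graph) : Bool := T.fst.same S.fst && T.snd.same S.snd

end Graph

/-- The union of `acc` with the entries at (at most `n`) members of the set `F`. -/
def spread (T : Table) : ℕ → ℕ → ℕ → ℕ
  | 0, _, acc => acc
  | n + 1, F, acc =>
    bif Nat.beq F 0 then acc
    else force (Nat.log2 F) fun i => force (Nat.xor F (Nat.shiftLeft 1 i)) fun F' =>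
      force (Nat.lor acc (T.get i)) fun acc' => spread T n F' acc'

/-- The vertices reached in at most `k` more steps, where `front` are those reached in the last
step, and `seen` and `seen'` those of the same and of the other kind that were reached so far. -/
def ball (T T' : Table) : ℕ → ℕ → ℕ → ℕ → ℕ
  | 0, seen, _, _ => seen
  | k + 1, seen, seen', front =>
    -- The fuel 64 exceeds the number of vertices of one kind. Too little fuel could only make the
    -- ball smaller and leave more candidates.
    force (spread T 64 front 0) fun N => force (Nat.lor seen' N) fun both =>
      force (Nat.xor N (Nat.land N seen')) fun new => ball T' T k both seen new

/-- The binary digit of `m` at position `i`. -/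
def bit (m i : ℕ) : Bool := !(Nat.beq (Nat.land 1 (Nat.shiftRight m i)) 0)

/-- The leaves `31 + w` and `31 + v` of different kinds cannot be adjacent in a normalized
labelling. -/
def excluded (w v : ℕ) : Bool :=
  -- Digit `4 - k` of `w` tells whether the path from the root to the leaf takes the second child at
  -- depth `k`. The condition on `v` says that the other leaf lies below the vertex at depth `6 - k`
  -- that is reached by first children only.
  [1, 2, 3, 4].any fun k =>
    (bit w (4 - k) && v >>> (k - 1) == 0) || (bit v (4 - k) && w >>> (k - 1) == 0)

/-- For each `w` the set of all `31 + v` with `excluded w v`. -/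
def excludedTable : List ℕ :=
  [9223231295071453184, 9187201950444158976, 8608480567874289664, 8608480602234028032,
   6148914691952345088, 6148914872340971520, 6148914700542279680, 6148914872340971520, 2147483648,
   547608330240, 32212254720, 547608330240, 6442450944, 547608330240, 32212254720, 547608330240,
   0, 547608330240, 32212254720, 547608330240, 6442450944, 547608330240, 32212254720,
   547608330240, 2147483648, 547608330240, 32212254720, 547608330240, 6442450944, 547608330240,
   32212254720, 547608330240]

/-- The possible neighbours of the leaf `31 + w` of the first kind in the half `b` of the leaves of
the second kind, where `B` are the vertices that cannot become new neighbours. -/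
def select (r B b : ℕ) : List ℕ :=
  ((List.range 16).map fun v => Nat.add (Nat.mul 16 b) v).filter fun v =>
    -- A leaf that is already a neighbour is in the ball as well, but has to remain a candidate.
    bit r (Nat.add 31 v) || !(bit B (Nat.add 31 v))

/-- The possible neighbours of the leaf `31 + w` of the first kind in the half `b` of the leaves of
the second kind. -/
def candidates (T : Graph) (w b : ℕ) : List ℕ :=
  select (T.fst.get (31 + w))
    -- The new edge would close a walk of at most nine steps to a circuit of length at most ten,
    -- whereas the girth is twelve.
    (Nat.lor (ball T.fst T.snd 9 (Nat.shiftLeft 1 (31 + w)) 0 (Nat.shiftLeft 1 (31 + w)))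
      (excludedTable.getD w 0)) b

/-- The edges that may join the leaf number `c / 2 % 32` to a leaf in the half `c % 2`; the kind of
the leaf is determined by `c / 64`. -/
def newEdges (T : Graph) (c : ℕ) : List (ℕ × ℕ) :=
  bif Nat.beq (c / 64) 1 then
    (candidates T (c / 2 % 32) (c % 2)).map fun v => (31 + c / 2 % 32, 31 + v)
  else (candidates T.swap (c / 2 % 32) (c % 2)).map fun v => (31 + v, 31 + c / 2 % 32)

/-- Depth first search guided by a list of blocks; the code `0` announces a solution. A graph and a
new edge represent the graph with this edge added. -/
def search (sol : List Graph) : List ℕ → List (Graph × ℕ × ℕ) → Bool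
  -- The test succeeds only if no branch is left open when the codes are used up; superfluous codes
  -- do no harm.
  | [], st => st.isEmpty
  | _ :: _, [] => true
  | c :: cs, (T, i, j) :: st => T.withAdd i j fun T' =>
    bif Nat.beq c 0 then sol.any T'.same && search sol cs st
    -- The branch is replaced by one branch for each possible edge, so it is closed when no edge is
    -- possible.
    else search sol cs ((newEdges T' c).map (T', ·) ++ st)

/-- The edges of the two rooted trees and the edge joining their roots. -/
def treeEdges : List (ℕ × ℕ) :=
  (0, 0) :: (List.range 62).map (fun i => (i + 1, i / 2)) ++
    (List.range 62).map fun i => (i / 2, i + 1)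

/-- The graph formed by the two trees. -/
def treeGraph : Graph := Graph.addList ⟨Table.zero 6, Table.zero 6⟩ treeEdges

/-- The edges between the leaves in one of the two solutions. -/
def dualEdges : List (ℕ × ℕ) :=
  [(31, 31), (31, 47), (32, 39), (32, 55), (33, 35), (33, 59), (34, 43), (34, 51), (35, 33),
   (35, 49), (36, 41), (36, 57), (37, 37), (37, 61), (38, 45), (38, 53), (39, 32), (39, 58),
   (40, 40), (40, 50), (41, 38), (41, 52), (42, 46), (42, 60), (43, 34), (43, 56), (44, 42),
   (44, 48), (45, 36), (45, 54), (46, 44), (46, 62), (47, 31), (47, 62), (48, 41), (48, 52),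
   (49, 35), (49, 50), (50, 45), (50, 56), (51, 33), (51, 60), (52, 39), (52, 54), (53, 37),
   (53, 48), (54, 43), (54, 58), (55, 32), (55, 53), (56, 42), (56, 59), (57, 38), (57, 55),
   (58, 44), (58, 49), (59, 34), (59, 51), (60, 40), (60, 61), (61, 36), (61, 57), (62, 46),
   (62, 47)]

/-- The edges between the leaves in one of the two solutions. -/
def splitEdges : List (ℕ × ℕ) :=
  [(31, 31), (31, 47), (32, 39), (32, 55), (33, 35), (33, 51), (34, 43), (34, 59), (35, 33),
   (35, 49), (36, 45), (36, 61), (37, 37), (37, 53), (38, 41), (38, 57), (39, 32), (39, 52),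
   (40, 40), (40, 60), (41, 36), (41, 48), (42, 44), (42, 56), (43, 34), (43, 54), (44, 46),
   (44, 58), (45, 38), (45, 50), (46, 42), (46, 62), (47, 31), (47, 62), (48, 44), (48, 53),
   (49, 35), (49, 58), (50, 40), (50, 49), (51, 34), (51, 59), (52, 41), (52, 48), (53, 38),
   (53, 55), (54, 45), (54, 52), (55, 32), (55, 57), (56, 43), (56, 50), (57, 36), (57, 61),
   (58, 39), (58, 54), (59, 33), (59, 56), (60, 42), (60, 51), (61, 37), (61, 60), (62, 46),
   (62, 47)]

/-- The order in which the blocks are examined. -/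
def searchOrder : List ℕ :=
  -- The list is a mere certificate: the soundness of the search does not depend on it. The half `c`
  -- of leaf number `w` has code `64 + 2w + c` for the first kind and `128 + 2w + c` for the second.
  [128, 129, 130, 131, 134, 132, 65, 66, 67, 70, 68, 133, 135, 138, 142, 140, 161, 69, 71, 74, 78,
   124, 126, 78, 124, 126, 71, 74, 78, 124, 126, 78, 124, 126, 69, 71, 74, 78, 126, 158, 124, 162,
   154, 146, 150, 166, 170, 124, 162, 78, 126, 157, 102, 158, 139, 137, 141, 143, 169, 137, 169,
   122, 150, 170, 174, 141, 143, 153, 185, 124, 162, 71, 74, 78, 126, 158, 124, 162, 154, 146,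
   150, 166, 170, 124, 162, 78, 126, 157, 102, 158, 139, 137, 141, 143, 185, 137, 185, 122, 150,
   186, 94, 141, 143, 153, 169, 124, 162, 142, 140, 161, 69, 71, 74, 78, 124, 126, 78, 124, 126,
   71, 74, 78, 124, 126, 78, 124, 126, 69, 71, 74, 78, 126, 158, 124, 162, 154, 146, 150, 166,
   170, 124, 162, 78, 126, 157, 102, 158, 124, 162, 154, 146, 150, 166, 170, 139, 137, 141, 143,
   169, 137, 169, 122, 90, 98, 141, 143, 162, 143, 162, 163, 141, 143, 153, 185, 71, 74, 78, 126,
   158, 124, 162, 154, 146, 150, 166, 170, 174, 122, 137, 141, 143, 157, 171, 169, 153, 145, 163,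
   151, 149, 155, 164, 165, 167, 172, 173, 175, 177, 178, 179, 182, 180, 181, 183, 185, 186, 187,
   190, 188, 189, 191, 0, 143, 171, 145, 163, 109, 124, 162, 78, 126, 157, 102, 158, 124, 162,
   154, 146, 150, 166, 170, 174, 98, 100, 122, 141, 143, 171, 143, 171, 139, 137, 141, 143, 185,
   137, 185, 122, 90, 98, 141, 143, 162, 143, 162, 163, 141, 143, 153, 169, 135, 138, 142, 140,
   161, 69, 71, 74, 78, 124, 126, 78, 124, 126, 71, 74, 78, 124, 126, 78, 124, 126, 69, 71, 74,
   78, 126, 122, 97, 188, 190, 190, 94, 188, 98, 102, 78, 126, 97, 188, 190, 190, 94, 188, 98,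
   154, 146, 158, 162, 166, 164, 186, 102, 106, 110, 163, 139, 137, 141, 143, 145, 151, 153, 165,
   167, 169, 170, 171, 174, 172, 173, 175, 177, 178, 179, 182, 180, 181, 183, 185, 187, 189, 0,
   71, 74, 78, 126, 122, 97, 188, 190, 190, 186, 146, 150, 158, 154, 162, 163, 188, 98, 99, 82,
   78, 126, 97, 188, 190, 190, 186, 158, 162, 163, 154, 146, 150, 162, 166, 164, 188, 98, 99, 142,
   140, 161, 69, 71, 74, 78, 124, 126, 78, 124, 126, 71, 74, 78, 124, 126, 78, 124, 126, 69, 71,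
   74, 78, 126, 122, 97, 188, 190, 190, 94, 98, 102, 78, 126, 97, 188, 190, 190, 94, 188, 98, 154,
   146, 158, 162, 124, 71, 74, 78, 126, 122, 97, 188, 190, 190, 146, 150, 158, 154, 162, 163, 98,
   99, 158, 124, 78, 126, 97, 188, 190, 190, 158, 162, 163, 94, 188, 98, 99]

/-- The incidence graph of the dual of the split Cayley hexagon. -/
def dualGraph : Graph := treeGraph.addList dualEdges

/-- The incidence graph of the split Cayley hexagon. -/
def splitGraph : Graph := treeGraph.addList splitEdges

-- This evaluation is the whole case distinction for generalized hexagons. The initial edge `(0, 0)`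
-- already belongs to the tree, so that inserting it again changes nothing.
set_option maxRecDepth 100000 in
theorem search_eq_true :
    (treeGraph.force fun T => search [dualGraph, splitGraph] searchOrder [(T, 0, 0)]) = true := by
  decide +kernel

end HexagonSearch

/-! ### Soundness of the search -/

namespace HexagonSearch

theorem force_eq {α : Type} (n : ℕ) (f : ℕ → α) : force n f = f n := by
  cases n <;> rfl

theorem bit_eq_testBit (m i : ℕ) : bit m i = m.testBit i := by
  have h : bit m i = !(Nat.beq (1 &&& m >>> i) 0) := rfl
  rw [h, Nat.testBit, Bool.eq_iff_iff]
  simp [← Bool.not_eq_true, Nat.beq_eq]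

namespace Table

theorem force_eq {α : Type} (T : Table) (f : Table → α) : T.force f = f T := by
  induction T generalizing f with
  | tip n => simp [Table.force, HexagonSearch.force_eq]
  | fork l r hl hr => simp [Table.force, hl, hr]

theorem withJoin_eq {α : Type} (T : Table) (i m : ℕ) (f : Table → α) :
    T.withJoin i m f = f (T.join i m) := by
  induction T generalizing i f with
  | tip n => simp [withJoin, join, HexagonSearch.force_eq]
  | fork l r hl hr =>
    simp only [withJoin, join, hl, hr]
    cases Nat.beq (Nat.mod i 2) 0 <;> rfl

theorem same_iff (T S : Table) : T.same S = true ↔ T = S := by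
  induction T generalizing S with
  | tip n => cases S <;> simp [same]
  | fork l r hl hr => cases S <;> simp [same, hl, hr]

/-- The table has `2 ^ n` entries. -/
def Full : ℕ → Table → Prop
  | 0, tip _ => True
  | n + 1, fork l r => Full n l ∧ Full n r
  | _, _ => False

theorem full_zero (n : ℕ) : Full n (zero n) := by
  induction n with
  | zero => trivial
  | succ n ih => exact ⟨ih, ih⟩

theorem get_zero (n i : ℕ) : (zero n).get i = 0 := by
  induction n generalizing i with
  | zero => rfl
  | succ n ih => simp [zero, get, ih]

theorem Full.join {n : ℕ} {T : Table} (h : Full n T) (i m : ℕ) : Full n (T.join i m) := by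
  induction T generalizing n i with
  | tip k => cases n <;> simp_all [Full, Table.join]
  | fork l r hl hr =>
    cases n with
    | zero => simp [Full] at h
    | succ n =>
      simp only [Table.join]
      cases Nat.beq (Nat.mod i 2) 0
      · exact ⟨h.1, hr h.2 _⟩
      · exact ⟨hl h.1 _, h.2⟩

theorem get_join {n : ℕ} {T : Table} (h : Full n T) {i k : ℕ} (hi : i < 2 ^ n) (hk : k < 2 ^ n)
    (m : ℕ) : (T.join i m).get k = if k = i then T.get k ||| m else T.get k := by
  induction T generalizing n i k with
  | tip a =>
    cases n with
    | zero =>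
      have : k = i := by simp at hi hk; omega
      simp only [Table.join, get, if_pos this]
      rfl
    | succ n => simp [Full] at h
  | fork l r hl hr =>
    cases n with
    | zero => simp [Full] at h
    | succ n =>
      have hi' : i / 2 < 2 ^ n := by rw [pow_succ] at hi; omega
      have hk' : k / 2 < 2 ^ n := by rw [pow_succ] at hk; omega
      have e1 : ∀ x, Nat.mod x 2 = x % 2 := fun _ => rfl
      have e2 : ∀ x, Nat.div x 2 = x / 2 := fun _ => rfl
      have e3 : ∀ x, Nat.beq (x % 2) 0 = decide (x % 2 = 0) := fun x => by
        rw [Bool.eq_iff_iff]; simp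
      simp only [Table.join, e1, e2, e3]
      by_cases h1 : i % 2 = 0 <;> by_cases h2 : k % 2 = 0 <;>
        simp only [h1, h2, get, e1, e2, e3, decide_true, decide_false, cond_true, cond_false,
          hl h.1 hi' hk', hr h.2 hi' hk'] <;>
        split_ifs <;> first | rfl | omega

end Table

namespace Graph

theorem force_eq {α : Type} (T : Graph) (f : Graph → α) : T.force f = f T := by
  simp [Graph.force, Table.force_eq]

theorem withAdd_eq {α : Type} (T : Graph) (i j : ℕ) (f : Graph → α) :
    T.withAdd i j f = f (T.add i j) := by
  simp [withAdd, add, Table.withJoin_eq]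

theorem same_iff (T S : Graph) : T.same S = true ↔ T = S := by
  cases T; cases S
  simp [same, Table.same_iff]

end Graph

/-- One inclusion suffices: the ball serves to rule out edges, so all its members must really be
reachable, while missing members are harmless. -/
theorem testBit_spread {T : Table} {n F acc j : ℕ} (h : (spread T n F acc).testBit j) :
    acc.testBit j ∨ ∃ i, F.testBit i ∧ (T.get i).testBit j := by
  induction n generalizing F acc with
  | zero => exact Or.inl h
  | succ n ih =>
    simp only [spread, force_eq] at h
    by_cases hF : F = 0
    · subst hF
      exact Or.inl h
    · have hF' : Nat.beq F 0 = false := by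
        rw [Bool.eq_false_iff]; simpa using hF
      rw [hF', cond_false] at h
      have hlog : F.testBit F.log2 := by
        exact Nat.testBit_log2 hF
      rcases ih h with h | ⟨i, hi, hj⟩
      · have h : (acc ||| T.get F.log2).testBit j = true := h
        rw [Nat.testBit_or, Bool.or_eq_true] at h
        exact h.imp id fun h => ⟨_, hlog, h⟩
      · have hi : (F ^^^ 1 <<< F.log2).testBit i = true := hi
        by_cases e : i = F.log2
        · subst e
          exact Or.inr ⟨_, hlog, hj⟩
        · refine Or.inr ⟨i, ?_, hj⟩
          rw [Nat.testBit_xor, Nat.one_shiftLeft, Nat.testBit_two_pow_of_ne (Ne.symm e)] at hi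
          simpa using hi

section Ball

variable {V : Type*} {G : SimpleGraph V}

/-- All members of the set `m` name vertices that are joined to `x` by a walk of length at most
`n`. -/
def Within (G : SimpleGraph V) (x : V) (n : ℕ) (f : ℕ → V) (m : ℕ) : Prop :=
  ∀ i, m.testBit i → i < 63 ∧ ∃ p : G.Walk x (f i), p.length ≤ n

theorem Within.mono {x : V} {n n' : ℕ} {f : ℕ → V} {m : ℕ} (h : Within G x n f m) (hn : n ≤ n') :
    Within G x n' f m := fun i hi =>
  let ⟨h1, p, hp⟩ := h i hi
  ⟨h1, p, hp.trans hn⟩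

theorem Within.spread {x : V} {n : ℕ} {f g : ℕ → V} {m : ℕ} {T : Table}
    (hT : ∀ i j, i < 63 → (T.get i).testBit j → j < 63 ∧ G.Adj (f i) (g j))
    (h : Within G x n f m) (k : ℕ) : Within G x (n + 1) g (spread T k m 0) := by
  intro j hj
  rcases testBit_spread hj with h0 | ⟨i, hi, hij⟩
  · simp at h0
  · obtain ⟨h1, p, hp⟩ := h i hi
    obtain ⟨h2, ha⟩ := hT i j h1 hij
    exact ⟨h2, p.concat ha, by simpa using hp⟩

/-- Since the graph is bipartite, every step exchanges the two tables and the two labellings; this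
accounts for the parity of `k`. -/
theorem within_ball {x : V} {f g : ℕ → V} {T T' : Table}
    (hT : ∀ i j, i < 63 → (T.get i).testBit j → j < 63 ∧ G.Adj (f i) (g j))
    (hT' : ∀ i j, i < 63 → (T'.get i).testBit j → j < 63 ∧ G.Adj (g i) (f j)) (k : ℕ) :
    ∀ {n seen seen' front : ℕ}, Within G x n f seen → Within G x n g seen' →
      Within G x n f front →
      Within G x (n + k) (if Even k then f else g) (ball T T' k seen seen' front) := by
  induction k generalizing f g T T' with
  | zero => intro n seen seen' front h _ _; simpa [ball] using h
  | succ k ih =>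
    intro n seen seen' front h h' hf
    have hN := hf.spread hT 64
    simp only [ball, force_eq]
    have := ih hT' hT (n := n + 1) (seen := Nat.lor seen' (HexagonSearch.spread T 64 front 0))
      (seen' := seen)
      (front := Nat.xor (HexagonSearch.spread T 64 front 0)
        (Nat.land (HexagonSearch.spread T 64 front 0) seen')) ?_ (h.mono n.le_succ) ?_
    · rw [show n + (k + 1) = n + 1 + k by ring]
      convert this using 1
      simp only [Nat.even_add_one]
      split_ifs <;> rfl
    · intro i hi
      have hi : (seen' ||| HexagonSearch.spread T 64 front 0).testBit i = true := hi
      rw [Nat.testBit_or, Bool.or_eq_true] at hi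
      exact hi.elim (h'.mono n.le_succ i) (hN i)
    · intro i hi
      have hi : ((HexagonSearch.spread T 64 front 0) ^^^
        ((HexagonSearch.spread T 64 front 0) &&& seen')).testBit i = true := hi
      rw [Nat.testBit_xor, Nat.testBit_and] at hi
      refine hN i ?_
      revert hi
      cases (HexagonSearch.spread T 64 front 0).testBit i <;> simp

end Ball

section Soundness

variable {V : Type*} {H : SimpleGraph V} {a b : ℕ → V}

/-- The vertices `a i` and `b i` for `i < 63` form two binary trees joined by an edge, in a graph
without short cycles, and the leaves are labelled in a normalized way. -/
structure Labelling (H : SimpleGraph V) (a b : ℕ → V) : Prop where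
  -- In a bipartite graph this says that there are no circuits of length less than twelve.
  no_short : ∀ u v, H.Adj u v → ∀ p : (H.deleteEdges {s(u, v)}).Walk u v, 9 < p.length
  inj_fst : ∀ i j, i < 63 → j < 63 → a i = a j → i = j
  inj_snd : ∀ i j, i < 63 → j < 63 → b i = b j → i = j
  ne : ∀ i j, i < 63 → j < 63 → a i ≠ b j
  root : H.Adj (a 0) (b 0)
  parent_fst : ∀ i, i < 62 → H.Adj (a (i + 1)) (b (i / 2))
  parent_snd : ∀ i, i < 62 → H.Adj (b (i + 1)) (a (i / 2))
  -- A half consists of the leaves below one of the two children of a root.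
  block_fst : ∀ w c, w < 32 → c < 2 → ∃ v < 16, H.Adj (a (31 + w)) (b (31 + (16 * c + v)))
  block_snd : ∀ w c, w < 32 → c < 2 → ∃ v < 16, H.Adj (b (31 + w)) (a (31 + (16 * c + v)))
  normal : ∀ w v, w < 32 → v < 32 → H.Adj (a (31 + w)) (b (31 + v)) → excluded w v = false

theorem excluded_comm (w v : ℕ) : excluded w v = excluded v w := by
  simp only [excluded, Bool.or_comm]

theorem Labelling.swap (h : Labelling H a b) : Labelling H b a where
  no_short := h.no_short
  inj_fst := h.inj_snd
  inj_snd := h.inj_fst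
  ne i j hi hj := (h.ne j i hj hi).symm
  root := h.root.symm
  parent_fst := h.parent_snd
  parent_snd := h.parent_fst
  block_fst := h.block_snd
  block_snd := h.block_fst
  normal w v hw hv hwv := by
    rw [excluded_comm]
    exact h.normal v w hv hw hwv.symm

/-- The edges of the graph `T` are edges of `H`. -/
structure Realizes (H : SimpleGraph V) (a b : ℕ → V) (T : Graph) : Prop where
  full_fst : T.fst.Full 6
  full_snd : T.snd.Full 6
  symm : ∀ i j, i < 64 → j < 64 → (T.fst.get i).testBit j = (T.snd.get j).testBit i
  fst : ∀ i j, i < 64 → (T.fst.get i).testBit j → i < 63 ∧ j < 63 ∧ H.Adj (a i) (b j)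
  snd : ∀ i j, i < 64 → (T.snd.get i).testBit j → i < 63 ∧ j < 63 ∧ H.Adj (b i) (a j)

theorem Realizes.swap {T : Graph} (h : Realizes H a b T) : Realizes H b a T.swap where
  full_fst := h.full_snd
  full_snd := h.full_fst
  symm i j hi hj := (h.symm j i hj hi).symm
  fst := h.snd
  snd := h.fst

theorem Realizes.add {T : Graph} (h : Realizes H a b T) {i j : ℕ} (hi : i < 63) (hj : j < 63)
    (hij : H.Adj (a i) (b j)) : Realizes H a b (T.add i j) := by
  have e : ∀ x y : ℕ, (Nat.shiftLeft 1 x).testBit y = decide (x = y) := fun x y => by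
    have : (Nat.shiftLeft 1 x) = 2 ^ x := Nat.one_shiftLeft x
    rw [this, Nat.testBit_two_pow]
  have g1 : ∀ k < 64, (T.add i j).fst.get k =
      if k = i then T.fst.get k ||| Nat.shiftLeft 1 j else T.fst.get k := fun k hk =>
    Table.get_join h.full_fst (by omega) hk _
  have g2 : ∀ k < 64, (T.add i j).snd.get k =
      if k = j then T.snd.get k ||| Nat.shiftLeft 1 i else T.snd.get k := fun k hk =>
    Table.get_join h.full_snd (by omega) hk _
  refine ⟨h.full_fst.join _ _, h.full_snd.join _ _, fun k l hk hl => ?_, fun k l hk hl => ?_,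
    fun k l hk hl => ?_⟩
  · rw [g1 k hk, g2 l hl]
    have := h.symm k l hk hl
    split_ifs with h1 h2 h2 <;> simp only [Nat.testBit_or, e, this]
    · simp [h1, h2]
    · simp [Ne.symm h2]
    · simp [Ne.symm h1]
  · rw [g1 k hk] at hl
    split_ifs at hl with h1
    · rw [Nat.testBit_or, e, Bool.or_eq_true, decide_eq_true_eq] at hl
      rcases hl with hl | rfl
      · exact h.fst k l hk hl
      · subst h1
        exact ⟨hi, hj, hij⟩
    · exact h.fst k l hk hl
  · rw [g2 k hk] at hl
    split_ifs at hl with h1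
    · rw [Nat.testBit_or, e, Bool.or_eq_true, decide_eq_true_eq] at hl
      rcases hl with hl | rfl
      · exact h.snd k l hk hl
      · subst h1
        exact ⟨hj, hi, hij.symm⟩
    · exact h.snd k l hk hl

theorem Realizes.addList {T : Graph} (h : Realizes H a b T) {l : List (ℕ × ℕ)}
    (hl : ∀ e ∈ l, e.1 < 63 ∧ e.2 < 63 ∧ H.Adj (a e.1) (b e.2)) : Realizes H a b (T.addList l) := by
  induction l generalizing T with
  | nil => exact h
  | cons e l ih =>
    have he := hl e (by simp)
    exact ih (h.add he.1 he.2.1 he.2.2) fun e' he' => hl e' (by simp [he'])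

theorem Labelling.realizes_treeGraph (h : Labelling H a b) : Realizes H a b treeGraph := by
  refine Realizes.addList ⟨Table.full_zero 6, Table.full_zero 6, ?_, ?_, ?_⟩ ?_
  · simp [Table.get_zero]
  · simp [Table.get_zero]
  · simp [Table.get_zero]
  · intro e he
    simp only [treeEdges, List.cons_append, List.mem_cons, List.mem_append, List.mem_map,
      List.mem_range] at he
    rcases he with rfl | ⟨i, hi, rfl⟩ | ⟨i, hi, rfl⟩
    · exact ⟨by norm_num, by norm_num, h.root⟩
    · exact ⟨by simp; omega, by simp; omega, h.parent_fst i hi⟩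
    · exact ⟨by simp; omega, by simp; omega, (h.parent_snd i hi).symm⟩

set_option maxRecDepth 10000 in
theorem excluded_of_testBit_excludedTable : ∀ w < 32, ∀ v < 32,
    bit (excludedTable.getD w 0) (31 + v) = true → excluded w v = true := by
  decide +kernel

/-- The neighbour of a leaf in a given half is among the candidates. -/
theorem Labelling.mem_candidates (h : Labelling H a b) {T : Graph} (hT : Realizes H a b T)
    {w v c : ℕ} (hw : w < 32) (hc : c < 2) (hv : v < 16)
    (hwv : H.Adj (a (31 + w)) (b (31 + (16 * c + v)))) : 16 * c + v ∈ candidates T w c := by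
  have hcv : 16 * c + v < 32 := by omega
  set y := 16 * c + v with hy
  simp only [candidates, select, List.mem_filter, List.mem_map, List.mem_range]
  refine ⟨⟨v, hv, rfl⟩, ?_⟩
  rw [bit_eq_testBit, bit_eq_testBit, Bool.or_eq_true]
  by_contra! hcon
  obtain ⟨h1, h2⟩ := hcon
  have h1 : (T.fst.get (31 + w)).testBit (31 + y) = false := by simpa using h1
  have h2 : ((ball T.fst T.snd 9 (Nat.shiftLeft 1 (31 + w)) 0 (Nat.shiftLeft 1 (31 + w))) |||
      (excludedTable.getD w 0)).testBit (31 + y) = true := by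
    by_contra h3
    exact h2 (by rw [Bool.not_eq_true] at h3; rw [Bool.not_eq_true']; exact h3)
  rw [Nat.testBit_or, Bool.or_eq_true] at h2
  rcases h2 with h2 | h2
  -- The edge under consideration is not in `T`, so the edges of `T` survive its deletion, and a
  -- short walk in `T` contradicts the girth condition.
  · have key : ∀ i j, i < 63 → j < 63 → (T.fst.get i).testBit j →
        (H.deleteEdges {s(a (31 + w), b (31 + y))}).Adj (a i) (b j) := by
      intro i j hi hj hij
      rw [SimpleGraph.deleteEdges_adj]
      refine ⟨(hT.fst i j (by omega) hij).2.2, fun he => ?_⟩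
      rw [Set.mem_singleton_iff, Sym2.eq_iff] at he
      rcases he with ⟨e1, e2⟩ | ⟨e1, e2⟩
      · have e1 := h.inj_fst _ _ hi (by omega) e1
        have e2 := h.inj_snd _ _ hj (by omega) e2
        rw [e1, e2, h1] at hij
        exact Bool.false_ne_true hij
      · exact h.ne _ _ hi (by omega) e1
    have W0 : Within (H.deleteEdges {s(a (31 + w), b (31 + y))}) (a (31 + w)) 0 a
        (Nat.shiftLeft 1 (31 + w)) := by
      intro i hi
      have : (Nat.shiftLeft 1 (31 + w)) = 2 ^ (31 + w) := Nat.one_shiftLeft _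
      rw [this, Nat.testBit_two_pow, decide_eq_true_eq] at hi
      subst hi
      exact ⟨by omega, SimpleGraph.Walk.nil, by simp⟩
    have hb := within_ball (x := a (31 + w)) (T := T.fst) (T' := T.snd) (f := a) (g := b)
      (G := H.deleteEdges {s(a (31 + w), b (31 + y))})
      (fun i j hi hij => ⟨(hT.fst i j (by omega) hij).2.1,
        key i j hi (hT.fst i j (by omega) hij).2.1 hij⟩)
      (fun i j hi hij => ⟨(hT.snd i j (by omega) hij).2.1,
        (key j i (hT.snd i j (by omega) hij).2.1 hi (by
          rw [hT.symm j i (by have := (hT.snd i j (by omega) hij).2.1; omega) (by omega)]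
          exact hij)).symm⟩)
      9 W0 (seen' := 0) (fun i hi => by simp at hi) W0
    rw [if_neg (by decide)] at hb
    obtain ⟨-, p, hp⟩ := hb _ h2
    exact absurd (h.no_short _ _ hwv p) (by omega)
  · rw [← bit_eq_testBit] at h2
    have := excluded_of_testBit_excludedTable w hw y hcv h2
    rw [h.normal w y hw hcv hwv] at this
    exact Bool.false_ne_true this

/-- A leaf has a neighbour in the chosen half, so at least one of the new branches is again realized
in `H`. -/
theorem Labelling.exists_mem_newEdges (h : Labelling H a b) {T : Graph} (hT : Realizes H a b T)
    (c : ℕ) : ∃ e ∈ newEdges T c, Realizes H a b (T.add e.1 e.2) := by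
  have hw : c / 2 % 32 < 32 := Nat.mod_lt _ (by norm_num)
  have hc : c % 2 < 2 := Nat.mod_lt _ (by norm_num)
  unfold newEdges
  cases Nat.beq (c / 64) 1
  · obtain ⟨v, hv, hadj⟩ := h.block_snd _ _ hw hc
    refine ⟨_, List.mem_map_of_mem (h.swap.mem_candidates hT.swap hw hc hv hadj), ?_⟩
    exact hT.add (by simp; omega) (by simp; omega) hadj.symm
  · obtain ⟨v, hv, hadj⟩ := h.block_fst _ _ hw hc
    refine ⟨_, List.mem_map_of_mem (h.mem_candidates hT hw hc hv hadj), ?_⟩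
    exact hT.add (by simp; omega) (by simp; omega) hadj

/-- Invariant of the search: a realized member of the stack has a realized descendant until it is
found equal to a solution. A stack that contains a realized member can therefore not become empty
before that. -/
theorem Labelling.exists_of_search (h : Labelling H a b) {sol : List Graph} {cs : List ℕ}
    {st : List (Graph × ℕ × ℕ)} (hs : search sol cs st = true) :
    ∀ e ∈ st, Realizes H a b (e.1.add e.2.1 e.2.2) → ∃ S ∈ sol, Realizes H a b S := by
  induction cs generalizing st with
  | nil =>
    cases st with
    | nil => simp
    | cons e st => simp [search] at hs
  | cons c cs ih =>
    cases st with
    | nil => simp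
    | cons e st =>
      obtain ⟨T, i, j⟩ := e
      simp only [search, Graph.withAdd_eq] at hs
      intro e he hr
      cases hc : Nat.beq c 0
      · rw [hc, cond_false] at hs
        rcases List.mem_cons.1 he with rfl | he
        · obtain ⟨e', he', hr'⟩ := h.exists_mem_newEdges hr c
          exact ih hs (T.add i j, e') (by simp [he']) hr'
        · exact ih hs e (by simp [he]) hr
      · rw [hc, cond_true, Bool.and_eq_true] at hs
        rcases List.mem_cons.1 he with rfl | he
        · obtain ⟨S, hS, hTS⟩ := List.any_eq_true.1 hs.1
          rw [Graph.same_iff] at hTS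
          exact ⟨S, hS, hTS ▸ hr⟩
        · exact ih hs.2 e he hr

/-- There are at most two normalized labellings up to isomorphism. -/
theorem Labelling.realizes (h : Labelling H a b) :
    Realizes H a b dualGraph ∨ Realizes H a b splitGraph := by
  have hs := search_eq_true
  rw [Graph.force_eq] at hs
  obtain ⟨S, hS, hr⟩ := h.exists_of_search hs (treeGraph, 0, 0) (by simp)
    (h.realizes_treeGraph.add (by norm_num) (by norm_num) h.root)
  simp only [List.mem_cons, List.not_mem_nil, or_false] at hS
  rcases hS with rfl | rfl
  · exact Or.inl hr
  · exact Or.inr hr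

end Soundness

end HexagonSearch

/-! ### Distances in the incidence graph of a generalized hexagon -/

open SimpleGraph

/-- The incidence graph of a generalized hexagon of order `(2, 2)`, with its two kinds of vertices
distinguished by `col`. -/
structure IsHexagonGraph {V : Type*} (H : SimpleGraph V) (col : V → Bool) : Prop where
  col_ne : ∀ u v, H.Adj u v → col u ≠ col v
  three : ∀ u, (H.neighborSet u).ncard = 3
  near : ∀ u v, col u ≠ col v → ∃ p : H.Walk u v, p.length ≤ 5
  no_short : ∀ u v, H.Adj u v → ∀ p : (H.deleteEdges {s(u, v)}).Walk u v, 9 < p.length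

namespace IsHexagonGraph

variable {V : Type*} {H : SimpleGraph V} {col : V → Bool} (h : IsHexagonGraph H col)
include h

theorem exists_adj (u : V) : ∃ v, H.Adj u v := by
  have h3 := h.three u
  obtain ⟨v, hv⟩ := Set.nonempty_of_ncard_ne_zero (s := H.neighborSet u) (by omega)
  exact ⟨v, hv⟩

theorem reachable (u v : V) : H.Reachable u v := by
  by_cases huv : col u = col v
  · obtain ⟨w, hw⟩ := h.exists_adj u
    obtain ⟨p, -⟩ := h.near w v (fun e => h.col_ne u w hw (huv.trans e.symm))
    exact hw.reachable.trans ⟨p⟩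
  · obtain ⟨p, -⟩ := h.near u v huv
    exact ⟨p⟩

theorem dist_triangle (u v w : V) : H.dist u w ≤ H.dist u v + H.dist v w := by
  obtain ⟨p, hp⟩ := (h.reachable u v).exists_walk_length_eq_dist
  obtain ⟨q, hq⟩ := (h.reachable v w).exists_walk_length_eq_dist
  rw [← hp, ← hq, ← Walk.length_append]
  exact dist_le _

theorem dist_le_five {u v : V} (huv : col u ≠ col v) : H.dist u v ≤ 5 := by
  obtain ⟨p, hp⟩ := h.near u v huv
  exact (dist_le p).trans hp

theorem even_length_iff {u v : V} (p : H.Walk u v) : Even p.length ↔ col u = col v := by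
  induction p with
  | nil => simp
  | cons ha p ih =>
    have := h.col_ne _ _ ha
    rw [Walk.length_cons, Nat.even_add_one, ih]
    revert this
    cases col _ <;> cases col _ <;> cases col _ <;> simp

theorem even_dist_iff (u v : V) : Even (H.dist u v) ↔ col u = col v := by
  obtain ⟨p, hp⟩ := (h.reachable u v).exists_walk_length_eq_dist
  rw [← hp, h.even_length_iff]

/-- The distances differ by at most one, and their parities differ because the graph is bipartite.
-/
theorem dist_of_adj (x : V) {u v : V} (huv : H.Adj u v) :
    H.dist x v = H.dist x u + 1 ∨ H.dist x u = H.dist x v + 1 := by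
  have h1 := h.dist_triangle x u v
  have h2 := h.dist_triangle x v u
  rw [dist_eq_one_iff_adj.2 huv] at h1
  rw [dist_eq_one_iff_adj.2 huv.symm] at h2
  have h3 : H.dist x u ≠ H.dist x v := by
    intro e
    have e1 := h.even_dist_iff x u
    rw [e, h.even_dist_iff] at e1
    have := h.col_ne _ _ huv
    revert e1 this
    cases col x <;> cases col u <;> cases col v <;> simp
  omega

theorem dist_le_six (u v : V) : H.dist u v ≤ 6 := by
  by_cases huv : col u = col v
  · obtain ⟨w, hw⟩ := h.exists_adj v
    have h1 := h.dist_le_five (u := u) (v := w) (fun e => h.col_ne _ _ hw (huv.symm.trans e))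
    rcases h.dist_of_adj u hw with h2 | h2 <;> omega
  · exact (h.dist_le_five huv).trans (by norm_num)

theorem exists_gate {x u : V} {n : ℕ} (hn : H.dist x u = n + 1) :
    ∃ v, H.Adj u v ∧ H.dist x v = n := by
  obtain ⟨p, hp⟩ := (h.reachable u x).exists_walk_length_eq_dist
  rw [H.dist_comm, hn] at hp
  cases p with
  | nil => simp at hp
  | @cons _ v _ ha p =>
    refine ⟨v, ha, ?_⟩
    rw [Walk.length_cons] at hp
    have h1 := dist_le p
    rw [H.dist_comm] at h1
    rcases h.dist_of_adj x ha with h2 | h2 <;> omega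

/-- Shortest paths from `v` and `w` to `x` avoid `u`. Together with the edge from `w` to `u` they
form a walk from `v` to `u` of length `2n + 1 ≤ 9` that does not use the edge between `v` and `u`.
-/
theorem gate_unique {x u v w : V} {n : ℕ} (hn : H.dist x u = n + 1) (hn' : n ≤ 4)
    (hv : H.Adj u v) (hw : H.Adj u w) (hxv : H.dist x v = n) (hxw : H.dist x w = n) : v = w := by
  classical
  by_contra hvw
  have key : ∀ {y} (p : H.Walk y x), p.length = n → u ∉ p.support := by
    intro y p hp hu
    have h1 := dist_le (p.dropUntil u hu)
    have h2 := p.length_dropUntil_le_length hu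
    rw [H.dist_comm] at h1
    omega
  obtain ⟨p, hp⟩ := (h.reachable v x).exists_walk_length_eq_dist
  obtain ⟨q, hq⟩ := (h.reachable w x).exists_walk_length_eq_dist
  rw [H.dist_comm, hxv] at hp
  rw [H.dist_comm, hxw] at hq
  set r := p.append q.reverse with hr
  have hur : u ∉ r.support := by
    rw [hr, Walk.mem_support_append_iff, Walk.support_reverse, List.mem_reverse]
    exact fun h => h.elim (key p hp) (key q hq)
  have hr1 : s(v, u) ∉ r.edges := fun he => hur (r.snd_mem_support_of_mem_edges he)
  have ha : (H.deleteEdges {s(v, u)}).Adj w u := by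
    rw [deleteEdges_adj]
    refine ⟨hw.symm, fun he => ?_⟩
    rw [Set.mem_singleton_iff, Sym2.eq_iff] at he
    rcases he with ⟨e, -⟩ | ⟨e, -⟩
    · exact hvw e.symm
    · exact hw.ne e.symm
  have := h.no_short v u hv.symm ((r.toDeleteEdge _ hr1).concat ha)
  simp [hr, Walk.toDeleteEdge] at this
  omega

theorem farther {x u v w : V} {n : ℕ} (hn : H.dist x u = n + 1) (hn' : n ≤ 4)
    (hv : H.Adj u v) (hxv : H.dist x v = n) (hw : H.Adj u w) (hwv : w ≠ v) :
    H.dist x w = n + 2 := by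
  rcases h.dist_of_adj x hw with h1 | h1
  · omega
  · exact absurd (h.gate_unique hn hn' hw hv (by omega) hxv) hwv

theorem exists_third {u v w : V} : ∃ x, H.Adj u x ∧ x ≠ v ∧ x ≠ w := by
  by_contra! hcon
  have h1 : H.neighborSet u ⊆ {v, w} := fun x hx => by
    by_cases hxv : x = v
    · exact Or.inl hxv
    · exact Or.inr (hcon x hx hxv)
  have h2 := Set.ncard_le_ncard h1 (Set.toFinite _)
  rw [h.three] at h2
  have h3 := Set.ncard_insert_le v {w}
  rw [Set.ncard_singleton] at h3
  omega

theorem eq_of_adj {u v w x y : V} (hv : H.Adj u v) (hw : H.Adj u w) (hx : H.Adj u x)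
    (hvw : v ≠ w) (hvx : v ≠ x) (hwx : w ≠ x) (hy : H.Adj u y) : y = v ∨ y = w ∨ y = x := by
  have h1 : ({v, w, x} : Set V) ⊆ H.neighborSet u := by
    rintro z (rfl | rfl | rfl) <;> assumption
  have h2 : ({v, w, x} : Set V).ncard = 3 := by
    rw [Set.ncard_eq_three]
    exact ⟨v, w, x, hvw, hvx, hwx, rfl⟩
  have h3 : (H.neighborSet u).Finite := Set.finite_of_ncard_ne_zero (by rw [h.three]; norm_num)
  have h4 := Set.eq_of_subset_of_ncard_le h1 (by rw [h.three, h2]) h3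
  have : y ∈ ({v, w, x} : Set V) := by
    rw [h4]
    exact hy
  simpa using this

end IsHexagonGraph

/-! ### Circuits of length twelve -/

/-- The vertices of a circuit of length twelve, divided into two paths with origins `p 0` and
`l 0`. -/
structure IsSpine {V : Type*} (H : SimpleGraph V) (p l : ℕ → V) : Prop where
  root : H.Adj (p 0) (l 0)
  top : H.Adj (p 5) (l 5)
  adj_fst : ∀ k < 5, H.Adj (p k) (p (k + 1))
  adj_snd : ∀ k < 5, H.Adj (l k) (l (k + 1))
  fst_fst : ∀ k ≤ 5, H.dist (p k) (p 0) = k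
  fst_snd : ∀ k ≤ 5, H.dist (p k) (l 0) = k + 1
  snd_snd : ∀ k ≤ 5, H.dist (l k) (l 0) = k
  snd_fst : ∀ k ≤ 5, H.dist (l k) (p 0) = k + 1

theorem IsSpine.swap {V : Type*} {H : SimpleGraph V} {p l : ℕ → V} (S : IsSpine H p l) :
    IsSpine H l p where
  root := S.root.symm
  top := S.top.symm
  adj_fst := S.adj_snd
  adj_snd := S.adj_fst
  fst_fst := S.snd_snd
  fst_snd := S.snd_fst
  snd_snd := S.fst_fst
  snd_fst := S.fst_snd

namespace IsHexagonGraph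

variable {V : Type*} {H : SimpleGraph V} {col : V → Bool} {p l : ℕ → V}

/-- A path of length `n` away from `x`, continuing an edge. -/
theorem exists_path_away (h : IsHexagonGraph H col) {x u : V} (hu : H.dist x u = 1) :
    ∃ p : ℕ → V, p 0 = u ∧ ∀ k < 5, H.Adj (p k) (p (k + 1)) ∧ H.dist x (p (k + 1)) = k + 2 := by
  -- The step is made total so that it can be iterated; its values outside the range of distances
  -- are irrelevant.
  have step : ∀ y : V, ∃ z, 1 ≤ H.dist x y → H.dist x y ≤ 5 →
      H.Adj y z ∧ H.dist x z = H.dist x y + 1 := by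
    intro y
    by_cases hy : 1 ≤ H.dist x y ∧ H.dist x y ≤ 5
    · obtain ⟨n, hn⟩ : ∃ n, H.dist x y = n + 1 := ⟨H.dist x y - 1, by omega⟩
      obtain ⟨v, hv, hxv⟩ := h.exists_gate hn
      obtain ⟨z, hz, hzv, -⟩ := h.exists_third (u := y) (v := v) (w := v)
      refine ⟨z, fun _ _ => ⟨hz, ?_⟩⟩
      rw [h.farther hn (by omega) hv hxv hz hzv, hn]
    · exact ⟨y, fun h1 h2 => absurd ⟨h1, h2⟩ hy⟩
  choose f hf using step
  have key : ∀ k ≤ 5, H.dist x (f^[k] u) = k + 1 := by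
    intro k
    induction k with
    | zero => exact fun _ => hu
    | succ k ih =>
      intro hk
      have := ih (by omega)
      rw [Function.iterate_succ_apply', (hf _ (by omega) (by omega)).2, this]
  refine ⟨fun k => f^[k] u, rfl, fun k hk => ⟨?_, key (k + 1) (by omega)⟩⟩
  have := key k (by omega)
  simp only [Function.iterate_succ_apply']
  exact (hf _ (by omega) (by omega)).1

/-- A shortest path towards `x`. -/
theorem exists_path_towards (h : IsHexagonGraph H col) {x u : V} {n : ℕ} (hu : H.dist x u = n) :
    ∃ p : ℕ → V, p n = u ∧ p 0 = x ∧ (∀ k < n, H.Adj (p k) (p (k + 1))) ∧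
      ∀ k ≤ n, H.dist x (p k) = k := by
  induction n generalizing u with
  | zero =>
    have : x = u := ((h.reachable x u).dist_eq_zero_iff).1 hu
    subst this
    exact ⟨fun _ => x, rfl, rfl, by simp, by simp⟩
  | succ n ih =>
    obtain ⟨v, hv, hxv⟩ := h.exists_gate hu
    obtain ⟨p, hp, hp0, hadj, hd⟩ := ih hxv
    refine ⟨fun k => if k ≤ n then p k else u, by simp, by simp [hp0], fun k hk => ?_, fun k hk => ?_⟩
    · rcases Nat.lt_succ_iff_lt_or_eq.1 hk with hk | rfl
      · simpa [hk.le, Nat.succ_le_of_lt hk] using hadj k hk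
      · simpa [hp] using hv.symm
    · rcases Nat.le_succ_iff.1 hk with hk | rfl
      · simpa [hk] using hd k hk
      · simpa using hu

/-- A path of length five from `u` away from a neighbour `x` ends at distance six from `x`. A
further neighbour `y` of its end is at distance five from `x` and six from `u`, and a shortest path
from `x` to `y` closes the circuit. -/
theorem exists_spine (h : IsHexagonGraph H col) (u : V) : ∃ p l, IsSpine H p l ∧ p 0 = u := by
  obtain ⟨x, hx⟩ := h.exists_adj u
  obtain ⟨p, hp0, hp⟩ := h.exists_path_away (x := x) (u := u) (dist_eq_one_iff_adj.2 hx.symm)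
  have hpd : ∀ k ≤ 5, H.dist x (p k) = k + 1 := by
    intro k hk
    cases k with
    | zero => rw [hp0]; exact dist_eq_one_iff_adj.2 hx.symm
    | succ k => exact (hp k (by omega)).2
  have hpu : ∀ k ≤ 5, H.dist u (p k) = k := by
    intro k
    induction k with
    | zero => intro _; simp [hp0]
    | succ k ih =>
      intro hk
      have h1 := ih (by omega)
      have h2 := h.dist_triangle x u (p (k + 1))
      rw [hpd _ hk, dist_eq_one_iff_adj.2 hx.symm] at h2
      rcases h.dist_of_adj u (hp k (by omega)).1 with h3 | h3 <;> omega
  obtain ⟨y, hy, hy4, -⟩ := h.exists_third (u := p 5) (v := p 4) (w := p 4)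
  have hxy : H.dist x y = 5 := by
    rcases h.dist_of_adj x hy with h3 | h3 <;>
    · have := h.dist_le_six x y
      rw [hpd 5 le_rfl] at h3
      omega
  have huy : H.dist u y = 6 :=
    h.farther (n := 4) (hpu 5 le_rfl) le_rfl (hp 4 (by norm_num)).1.symm (hpu 4 (by norm_num)) hy hy4
  obtain ⟨l, hl5, hl0, hl, hld⟩ := h.exists_path_towards hxy
  have hlu : ∀ j ≤ 5, H.dist u (l (5 - j)) = 6 - j := by
    intro j
    induction j with
    | zero => intro _; simpa [hl5] using huy
    | succ j ih =>
      intro hj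
      have h1 := ih (by omega)
      have h2 := hl (5 - (j + 1)) (by omega)
      rw [show 5 - (j + 1) + 1 = 5 - j by omega] at h2
      have h3 := h.dist_triangle u x (l (5 - (j + 1)))
      rw [dist_eq_one_iff_adj.2 hx, hld _ (by omega)] at h3
      rcases h.dist_of_adj u h2 with h4 | h4 <;> omega
  refine ⟨p, l, ⟨?_, ?_, fun k hk => (hp k hk).1, hl, ?_, ?_, ?_, ?_⟩, hp0⟩
  · rwa [hp0, hl0]
  · rwa [hl5]
  · intro k hk; rw [H.dist_comm, hp0, hpu k hk]
  · intro k hk; rw [H.dist_comm, hl0, hpd k hk]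
  · intro k hk; rw [H.dist_comm, hl0, hld k hk]
  · intro k hk
    have := hlu (5 - k) (by omega)
    rw [show 5 - (5 - k) = k by omega] at this
    rw [H.dist_comm, hp0, this]
    omega

end IsHexagonGraph

/-! ### Two binary trees normalized by a circuit -/

section Tree

variable {V : Type*}

open Classical in
/-- A neighbour of `x` that is closer to `y`. -/
noncomputable def gate (H : SimpleGraph V) (x y : V) : V :=
  if hv : ∃ v, H.Adj x v ∧ H.dist y x = H.dist y v + 1 then hv.choose else x

open Classical in
/-- A neighbour of `x` other than `u` and `v`. -/
noncomputable def third (H : SimpleGraph V) (x u v : V) : V :=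
  if hv : ∃ w, H.Adj x w ∧ w ≠ u ∧ w ≠ v then hv.choose else x

/-- The vertex that determines the first children of the vertices of depth `k`. -/
def target (p l : ℕ → V) (k : ℕ) : V := if k = 0 then p 5 else l (6 - k)

/-- The vertices with their parents of the binary tree with root `p 0` and parent `l 0` of the root;
the sequences of choices are written from right to left. -/
noncomputable def tree (H : SimpleGraph V) (p l : ℕ → V) : List Bool → V × V
  | [] => (p 0, l 0)
  | b :: w =>
    let g := gate H (tree H p l w).1 (target p l w.length)
    (bif b then third H (tree H p l w).1 (tree H p l w).2 g else g, (tree H p l w).1)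

variable {H : SimpleGraph V} {col : V → Bool} {p l : ℕ → V}

theorem tree_cons_snd (b : Bool) (w : List Bool) :
    (tree H p l (b :: w)).2 = (tree H p l w).1 := rfl

theorem gate_spec (h : IsHexagonGraph H col) {x y : V} {n : ℕ} (hn : H.dist y x = n + 1) :
    H.Adj x (gate H x y) ∧ H.dist y (gate H x y) = n := by
  obtain ⟨v, hv, hv'⟩ := h.exists_gate hn
  have he : ∃ v, H.Adj x v ∧ H.dist y x = H.dist y v + 1 := ⟨v, hv, by omega⟩
  rw [gate, dif_pos he]
  have := he.choose_spec
  exact ⟨this.1, by omega⟩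

theorem third_spec (h : IsHexagonGraph H col) (x u v : V) :
    H.Adj x (third H x u v) ∧ third H x u v ≠ u ∧ third H x u v ≠ v := by
  have he := h.exists_third (u := x) (v := u) (w := v)
  rw [third, dif_pos he]
  exact he.choose_spec

/-- If the parent is at the maximal distance six from the target, the vertex itself is at distance
five. Its unique neighbour at distance four is then a child, namely the first one. -/
theorem child_spec_of_dist (h : IsHexagonGraph H col) {w : List Bool}
    (hadj : H.Adj (tree H p l w).1 (tree H p l w).2)
    (ht : H.dist (target p l w.length) (tree H p l w).2 = 6) :
    H.dist (target p l w.length) (tree H p l w).1 = 5 ∧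
      H.dist (target p l w.length) (tree H p l (false :: w)).1 = 4 ∧
      (tree H p l (false :: w)).1 ≠ (tree H p l (true :: w)).1 ∧
      ∀ b, H.Adj (tree H p l w).1 (tree H p l (b :: w)).1 ∧
        (tree H p l (b :: w)).1 ≠ (tree H p l w).2 := by
  have h5 : H.dist (target p l w.length) (tree H p l w).1 = 5 := by
    have := h.dist_le_six (target p l w.length) (tree H p l w).1
    rcases h.dist_of_adj (target p l w.length) hadj with h1 | h1 <;> omega
  obtain ⟨g1, g2⟩ := gate_spec h (n := 4) h5
  obtain ⟨o1, o2, o3⟩ := third_spec h (tree H p l w).1 (tree H p l w).2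
    (gate H (tree H p l w).1 (target p l w.length))
  refine ⟨h5, g2, o3.symm, fun b => ?_⟩
  cases b
  · refine ⟨g1, fun e => ?_⟩
    rw [← e] at ht
    have : H.dist (target p l w.length) (tree H p l (false :: w)).1 = 4 := g2
    omega
  · exact ⟨o1, o2⟩

namespace IsSpine

/-- At each vertex of the tree the parent is the unique neighbour closer to `s`, so the distance
from `s` grows by one per step down to the bound six. Applied to `s = l (6 - k)`, this puts the
parent of a vertex of depth `k ≥ 1` at distance six from its target, which makes the next level well
defined. -/
theorem tree_spec (S : IsSpine H p l) (h : IsHexagonGraph H col) (w : List Bool) :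
    w.length ≤ 5 → H.Adj (tree H p l w).1 (tree H p l w).2 ∧
      ∀ s m, H.dist s (l 0) = m → H.dist s (p 0) = m + 1 →
        (m + w.length ≤ 5 → H.dist s (tree H p l w).1 = m + 1 + w.length) ∧
        (m + w.length ≤ 6 → H.dist s (tree H p l w).2 = m + w.length) := by
  induction w with
  | nil => exact fun _ => ⟨S.root, fun s m h1 h2 => ⟨fun _ => h2, fun _ => h1⟩⟩
  | cons b w ih =>
    intro hw
    rw [List.length_cons] at hw
    obtain ⟨hadj, hd⟩ := ih (by omega)
    have ht : H.dist (target p l w.length) (tree H p l w).2 = 6 := by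
      rcases Nat.eq_zero_or_pos w.length with h0 | h0
      · rw [List.length_eq_zero_iff] at h0
        subst h0
        exact S.fst_snd 5 le_rfl
      · rw [target, if_neg h0.ne', (hd _ (6 - w.length) (S.snd_snd _ (by omega))
          (S.snd_fst _ (by omega))).2 (by omega)]
        omega
    obtain ⟨-, -, -, hc⟩ := child_spec_of_dist h hadj ht
    refine ⟨(hc b).1.symm, fun s m h1 h2 => ?_⟩
    rw [tree_cons_snd, List.length_cons]
    refine ⟨fun hm => ?_, fun hm => ?_⟩
    · rw [h.farther (n := m + w.length)
        (by rw [(hd s m h1 h2).1 (by omega)]; ring) (by omega) hadj ((hd s m h1 h2).2 (by omega))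
        (hc b).1 (hc b).2]
      ring
    · rw [(hd s m h1 h2).1 (by omega)]
      ring

theorem child_spec (S : IsSpine H p l) (h : IsHexagonGraph H col) {w : List Bool}
    (hw : w.length ≤ 4) :
    H.dist (target p l w.length) (tree H p l w).1 = 5 ∧
      H.dist (target p l w.length) (tree H p l (false :: w)).1 = 4 ∧
      (tree H p l (false :: w)).1 ≠ (tree H p l (true :: w)).1 ∧
      ∀ b, H.Adj (tree H p l w).1 (tree H p l (b :: w)).1 ∧
        (tree H p l (b :: w)).1 ≠ (tree H p l w).2 := by
  obtain ⟨hadj, hd⟩ := S.tree_spec h w (by omega)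
  refine child_spec_of_dist h hadj ?_
  rcases Nat.eq_zero_or_pos w.length with h0 | h0
  · rw [List.length_eq_zero_iff] at h0
    subst h0
    exact S.fst_snd 5 le_rfl
  · rw [target, if_neg h0.ne', (hd _ (6 - w.length) (S.snd_snd _ (by omega))
      (S.snd_fst _ (by omega))).2 (by omega)]
    omega

/-- The neighbours of a vertex of the tree are its parent and its two children. -/
theorem exists_child (S : IsSpine H p l) (h : IsHexagonGraph H col) {w : List Bool}
    (hw : w.length ≤ 4) {x : V} (hx : H.Adj (tree H p l w).1 x) (hne : x ≠ (tree H p l w).2) :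
    ∃ b, (tree H p l (b :: w)).1 = x := by
  obtain ⟨-, -, h1, h2⟩ := S.child_spec h hw
  rcases h.eq_of_adj (S.tree_spec h w (by omega)).1 (h2 false).1 (h2 true).1
    (h2 false).2.symm (h2 true).2.symm h1 hx with e | e | e
  · exact absurd e hne
  · exact ⟨false, e.symm⟩
  · exact ⟨true, e.symm⟩

theorem dist_snd (S : IsSpine H p l) (h : IsHexagonGraph H col) {w : List Bool}
    (hw : w.length ≤ 5) : H.dist (l 0) (tree H p l w).1 = w.length + 1 := by
  rw [((S.tree_spec h w hw).2 (l 0) 0 dist_self (dist_eq_one_iff_adj.2 S.root.symm)).1 (by omega)]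
  ring

theorem dist_snd_parent (S : IsSpine H p l) (h : IsHexagonGraph H col) {w : List Bool}
    (hw : w.length ≤ 5) : H.dist (l 0) (tree H p l w).2 = w.length := by
  rw [((S.tree_spec h w hw).2 (l 0) 0 dist_self (dist_eq_one_iff_adj.2 S.root.symm)).2 (by omega)]
  ring

theorem dist_append_le (S : IsSpine H p l) (h : IsHexagonGraph H col) (u w : List Bool)
    (hw : (u ++ w).length ≤ 5) : H.dist (tree H p l w).1 (tree H p l (u ++ w)).1 ≤ u.length := by
  induction u with
  | nil => simp
  | cons b u ih =>
    rw [List.cons_append, List.length_cons] at hw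
    have h1 := ih (by omega)
    have h2 := ((S.child_spec h (w := u ++ w) (by omega)).2.2.2 b).1
    rw [List.cons_append, List.length_cons]
    rcases h.dist_of_adj (tree H p l w).1 h2 with h3 | h3 <;> omega

theorem dist_fst (S : IsSpine H p l) (h : IsHexagonGraph H col) {w : List Bool}
    (hw : w.length ≤ 5) : H.dist (p 0) (tree H p l w).1 = w.length := by
  have h1 : H.dist (p 0) (tree H p l (w ++ [])).1 ≤ w.length :=
    S.dist_append_le h w [] (by simpa using hw)
  have h2 := h.dist_triangle (l 0) (p 0) (tree H p l w).1
  rw [S.dist_snd h hw, dist_eq_one_iff_adj.2 S.root.symm] at h2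
  rw [List.append_nil] at h1
  omega

theorem tree_injective (S : IsSpine H p l) (h : IsHexagonGraph H col) {w w' : List Bool}
    (hw : w.length ≤ 5) (hw' : w'.length ≤ 5) (he : (tree H p l w).1 = (tree H p l w').1) :
    w = w' := by
  have hl : w.length = w'.length := by rw [← S.dist_fst h hw, he, S.dist_fst h hw']
  induction w generalizing w' with
  | nil => exact (List.length_eq_zero_iff.1 hl.symm).symm
  | cons b w ih =>
    cases w' with
    | nil => simp at hl
    | cons b' w' =>
      have e : (tree H p l w).1 = (tree H p l w').1 := by
        have h2 := (S.tree_spec h _ hw).1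
        have h3 := (S.tree_spec h _ hw').1
        rw [← he] at h3
        simp only [List.length_cons] at hl
        have hw1 : w.length ≤ 4 := Nat.le_of_succ_le_succ hw
        have hw1' : w'.length ≤ 4 := Nat.le_of_succ_le_succ hw'
        have h4 := S.dist_fst h (w := w) (by omega)
        have h5 := S.dist_fst h (w := w') (by omega)
        rw [← Nat.succ.inj hl] at h5
        exact h.gate_unique (S.dist_fst h hw) hw1 h2 h3 h4 h5
      simp only [List.length_cons] at hw hw' hl
      obtain rfl := ih (by omega) (by omega) e (by omega)
      have h6 := (S.child_spec h (w := w) (by omega)).2.2.1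
      cases b <;> cases b' <;> first | rfl | exact absurd he h6 | exact absurd he.symm h6

theorem tree_ne_tree (S : IsSpine H p l) (h : IsHexagonGraph H col) {w w' : List Bool}
    (hw : w.length ≤ 5) (hw' : w'.length ≤ 5) : (tree H p l w).1 ≠ (tree H l p w').1 := by
  intro he
  have h1 := S.dist_fst h hw
  have h2 := S.dist_snd h hw
  have h3 := S.swap.dist_fst h hw'
  have h4 := S.swap.dist_snd h hw'
  rw [← he] at h3 h4
  omega

/-- Stepping from `x` towards `p 0` stays on the side of `p 0`; the path found in this way is
retraced downwards through children. -/
theorem exists_tree_eq (S : IsSpine H p l) (h : IsHexagonGraph H col) {n : ℕ} (hn : n ≤ 5) {x : V}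
    (h1 : H.dist (p 0) x = n) (h2 : H.dist (l 0) x = n + 1) :
    ∃ w : List Bool, w.length = n ∧ (tree H p l w).1 = x := by
  induction n generalizing x with
  | zero => exact ⟨[], rfl, ((h.reachable _ _).dist_eq_zero_iff).1 h1⟩
  | succ n ih =>
    obtain ⟨y, hy, hy'⟩ := h.exists_gate h1
    have h3 := h.dist_of_adj y S.root
    rw [H.dist_comm (u := y), H.dist_comm (u := y), hy'] at h3
    have h4 : H.dist (l 0) y = n + 1 := by
      rcases h.dist_of_adj (l 0) hy with h5 | h5 <;> omega
    obtain ⟨w, hw, rfl⟩ := ih (by omega) hy' h4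
    obtain ⟨b, hb⟩ := S.exists_child h (w := w) (by omega) hy.symm (fun e => by
      have := S.dist_snd_parent h (w := w) (by omega)
      rw [← e] at this
      omega)
    exact ⟨b :: w, by simp [hw], hb⟩

/-- A leaf of the other tree is adjacent to a leaf below each vertex of positive depth that is as
close to it as possible. -/
theorem exists_adj_leaf (S : IsSpine H p l) (h : IsHexagonGraph H col) {x : V}
    (hx : H.dist (p 0) x = 6) (n : ℕ) : ∀ w : List Bool, 1 ≤ w.length → w.length + n = 5 →
    H.dist x (tree H p l w).1 = n + 1 →
      ∃ u : List Bool, u.length = n ∧ H.Adj x (tree H p l (u ++ w)).1 := by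
  induction n with
  | zero => exact fun w _ _ h1 => ⟨[], rfl, dist_eq_one_iff_adj.1 h1⟩
  | succ n ih =>
    intro w hw hn h1
    obtain ⟨y, hy, hy'⟩ := h.exists_gate h1
    -- If the next vertex towards `x` were the parent of the present one, then `x` would be at
    -- distance at most four from `p 0`.
    obtain ⟨b, rfl⟩ := S.exists_child h (w := w) (by omega) hy (fun e => by
      have h2 := h.dist_triangle (p 0) y x
      obtain ⟨c, w', rfl⟩ := List.exists_cons_of_length_pos hw
      rw [List.length_cons] at hn
      rw [tree_cons_snd] at e
      rw [hx, e, S.dist_fst h (by omega), ← e, H.dist_comm, hy'] at h2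
      omega)
    obtain ⟨u, hu, hu'⟩ := ih (b :: w) (by simp) (by simp; omega) hy'
    exact ⟨u ++ [b], by simp [hu], by simpa using hu'⟩

/-- A leaf of the other tree is at distance six from `p 0`. Both children of `p 0` are therefore at
distance five from it, and the descent starts at either of them. -/
theorem exists_adj_leaf_half (S : IsSpine H p l) (h : IsHexagonGraph H col) {w : List Bool}
    (hw : w.length = 5) (b : Bool) :
    ∃ u : List Bool, u.length = 4 ∧ H.Adj (tree H l p w).1 (tree H p l (u ++ [b])).1 := by
  have hx : H.dist (p 0) (tree H l p w).1 = 6 := by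
    rw [S.swap.dist_snd h (by omega), hw]
  refine S.exists_adj_leaf h hx 4 [b] (by simp) (by simp) ?_
  have h1 : H.Adj (p 0) (tree H p l [b]).1 := ((S.child_spec h (w := []) (by simp)).2.2.2 b).1
  have h2 := h.dist_of_adj (tree H l p w).1 h1
  rw [H.dist_comm (v := p 0), hx] at h2
  have := h.dist_le_six (tree H l p w).1 (tree H p l [b]).1
  omega

theorem dist_fst_le (S : IsSpine H p l) (h : IsHexagonGraph H col) {i : ℕ} (j : ℕ)
    (hij : i + j ≤ 5) : H.dist (p i) (p (i + j)) ≤ j := by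
  induction j with
  | zero => simp
  | succ j ih =>
    have h1 := ih (by omega)
    have h2 := S.adj_fst (i + j) (by omega)
    rcases h.dist_of_adj (p i) h2 with h3 | h3
    · rw [← Nat.add_assoc, h3]
      omega
    · rw [← Nat.add_assoc]
      omega

/-- The targets lie on the circuit: along it `p (k + 1)` is at most four steps from `target p l k`,
hence it is the first child of `p k`. -/
theorem tree_replicate (S : IsSpine H p l) (h : IsHexagonGraph H col) {k : ℕ} (hk : k ≤ 5) :
    (tree H p l (List.replicate k false)).1 = p k := by
  induction k with
  | zero => rfl
  | succ k ih =>
    have e := ih (by omega)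
    obtain ⟨h1, h2, -, h3⟩ := S.child_spec h (w := List.replicate k false) (by simp; omega)
    rw [List.length_replicate] at h1 h2
    rw [List.replicate_succ]
    have h3 := (h3 false).1
    rw [e] at h1 h3
    have h4 := S.adj_fst k (by omega)
    have h5 : H.dist (target p l k) (p (k + 1)) ≤ 4 := by
      rcases Nat.eq_zero_or_pos k with rfl | hk0
      · rw [target, if_pos rfl, H.dist_comm]
        exact S.dist_fst_le h 4 (by norm_num)
      · rw [target, if_neg hk0.ne', H.dist_comm]
        have d1 := S.dist_fst_le h (i := k + 1) (4 - k) (by omega)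
        have d2 := S.swap.dist_fst_le h (i := 6 - k) (k - 1) (by omega)
        rw [show k + 1 + (4 - k) = 5 by omega] at d1
        rw [show 6 - k + (k - 1) = 5 by omega] at d2
        have d3 := h.dist_triangle (p (k + 1)) (p 5) (l (6 - k))
        have d4 := h.dist_triangle (p 5) (l 5) (l (6 - k))
        rw [dist_eq_one_iff_adj.2 S.top, H.dist_comm (u := l 5)] at d4
        omega
    refine h.gate_unique (n := 4) h1 le_rfl h3 h4 h2 ?_
    rcases h.dist_of_adj (target p l k) h4 with h6 | h6 <;> omega

/-- Such an edge would bring a second child within `(4 - k) + 1 + (k - 1) = 4` steps of the target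
`l (6 - k)`, but only the first child is that close. -/
theorem not_adj_of_normal (S : IsSpine H p l) (h : IsHexagonGraph H col) {k : ℕ} (hk : 1 ≤ k)
    (hk' : k ≤ 4) {u w u' : List Bool} (hw : w.length = k) (hu : u.length = 4 - k)
    (hu' : u'.length = k - 1) : ¬ H.Adj (tree H p l (u ++ true :: w)).1
      (tree H l p (u' ++ List.replicate (6 - k) false)).1 := by
  intro hadj
  obtain ⟨h1, h2, h3, h4⟩ := S.child_spec h (w := w) (by omega)
  have d1 := S.dist_append_le h u (true :: w) (by simp; omega)
  have d2 := S.swap.dist_append_le h u' (List.replicate (6 - k) false) (by simp; omega)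
  rw [S.swap.tree_replicate h (by omega)] at d2
  have d3 := h.dist_triangle (tree H p l (true :: w)).1 (tree H p l (u ++ true :: w)).1
    (tree H l p (u' ++ List.replicate (6 - k) false)).1
  have d4 := h.dist_triangle (tree H p l (true :: w)).1
    (tree H l p (u' ++ List.replicate (6 - k) false)).1 (l (6 - k))
  rw [dist_eq_one_iff_adj.2 hadj] at d3
  rw [H.dist_comm (v := l (6 - k)), H.dist_comm (v := l (6 - k))] at d4
  have ht : target p l w.length = l (6 - k) := by rw [hw, target, if_neg (by omega)]
  rw [ht] at h1 h2
  refine h3 (h.gate_unique (n := 4) h1 le_rfl (h4 false).1 (h4 true).1 h2 ?_)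
  rcases h.dist_of_adj (l (6 - k)) (h4 true).1 with h5 | h5 <;> omega

end IsSpine

end Tree

/-! ### Numbering of the positions in a binary tree -/

/-- The position of the `n`-th vertex of a binary tree, in the order of increasing depth. -/
def pathAux : ℕ → ℕ → List Bool
  | 0, _ => []
  | _ + 1, 0 => []
  | f + 1, n + 1 => (n % 2 == 1) :: pathAux f (n / 2)

/-- The position of the `n`-th vertex of a binary tree of depth at most five. -/
def path (n : ℕ) : List Bool := pathAux 6 n

/-- The number of the vertex in a given position. -/
def number : List Bool → ℕ
  | [] => 0
  | b :: w => 2 * number w + 1 + b.toNat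

theorem path_succ : ∀ n < 62, path (n + 1) = (n % 2 == 1) :: path (n / 2) := by decide

theorem number_path : ∀ n < 63, number (path n) = n := by decide

theorem length_path_le : ∀ n < 63, (path n).length ≤ 5 := by decide

theorem length_path_leaf : ∀ w < 32, (path (31 + w)).length = 5 := by decide

/-- The binary digits of `number w + 1` are a leading 1 followed by the choices from the root on, so
further choices are appended as lower digits. -/
theorem number_append (u w : List Bool) :
    ∃ r < 2 ^ u.length, number (u ++ w) + 1 = 2 ^ u.length * (number w + 1) + r := by
  induction u with
  | nil => exact ⟨0, by simp, by simp⟩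
  | cons b u ih =>
    obtain ⟨r, hr, h⟩ := ih
    refine ⟨2 * r + b.toNat, ?_, ?_⟩
    · rw [List.length_cons, pow_succ]
      cases b <;> simp <;> omega
    · rw [List.length_cons, pow_succ, List.cons_append, number]
      have : 2 ^ u.length * 2 * (number w + 1) = 2 * (2 ^ u.length * (number w + 1)) := by ring
      rw [this]
      omega

theorem number_lt {w : List Bool} (hw : w.length ≤ 5) : number w < 63 := by
  obtain ⟨r, hr, h⟩ := number_append w []
  have : 2 ^ w.length ≤ 2 ^ 5 := Nat.pow_le_pow_right (by norm_num) hw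
  simp [number] at h
  omega

theorem path_number {w : List Bool} (hw : w.length ≤ 5) : path (number w) = w := by
  induction w with
  | nil => rfl
  | cons b w ih =>
    have h1 := number_lt hw
    rw [List.length_cons] at hw
    rw [number] at h1 ⊢
    rw [show 2 * number w + 1 + b.toNat = 2 * number w + b.toNat + 1 by ring,
      path_succ _ (by omega)]
    cases b
    · simp [ih (by omega)]
    · rw [Bool.toNat_true, show (2 * number w + 1) / 2 = number w by omega, ih (by omega)]
      simp

/-- This and the next statement translate the two conditions in `excluded` into the positions that
occur in `not_adj_of_normal`. -/
theorem path_of_bit : ∀ w < 32, ∀ k < 5, 1 ≤ k → HexagonSearch.bit w (4 - k) = true →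
    path (31 + w) = (path (31 + w)).take (4 - k) ++ true :: (path (31 + w)).drop (5 - k) := by
  decide +kernel

theorem path_of_shiftRight : ∀ v < 32, ∀ k < 5, 1 ≤ k → v >>> (k - 1) = 0 →
    path (31 + v) = (path (31 + v)).take (k - 1) ++ List.replicate (6 - k) false := by
  decide +kernel

/-! ### The normalized labelling of a generalized hexagon -/

section Labelling

variable {V : Type*} {H : SimpleGraph V} {col : V → Bool} {p l : ℕ → V}

/-- The `n`-th vertex of the kind of the vertex `p 0`. -/
noncomputable def label (H : SimpleGraph V) (p l : ℕ → V) (n : ℕ) : V :=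
  -- The kinds alternate with the depth, so vertices of one kind come from even depths of one tree
  -- and odd depths of the other. In particular the leaves come from the tree with root of the other
  -- kind.
  if Even (path n).length then (tree H p l (path n)).1 else (tree H l p (path n)).1

namespace IsSpine

theorem label_injective (S : IsSpine H p l) (h : IsHexagonGraph H col) {i j : ℕ} (hi : i < 63)
    (hj : j < 63) (he : label H p l i = label H p l j) : i = j := by
  have h1 := length_path_le i hi
  have h2 := length_path_le j hj
  unfold label at he
  suffices path i = path j by rw [← number_path i hi, this, number_path j hj]
  split_ifs at he
  · exact S.tree_injective h h1 h2 he
  · exact absurd he (S.tree_ne_tree h h1 h2)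
  · exact absurd he (S.swap.tree_ne_tree h h1 h2)
  · exact S.swap.tree_injective h h1 h2 he

theorem label_ne_label (S : IsSpine H p l) (h : IsHexagonGraph H col) {i j : ℕ} (hi : i < 63)
    (hj : j < 63) : label H p l i ≠ label H l p j := by
  have h1 := length_path_le i hi
  have h2 := length_path_le j hj
  unfold label
  split_ifs with h3 h4 h4
  · exact S.tree_ne_tree h h1 h2
  · intro he
    rw [S.tree_injective h h1 h2 he] at h3
    exact h4 h3
  · intro he
    rw [S.swap.tree_injective h h1 h2 he] at h3
    exact h3 h4
  · exact S.swap.tree_ne_tree h h1 h2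

theorem adj_parent (S : IsSpine H p l) (h : IsHexagonGraph H col) {i : ℕ} (hi : i < 62) :
    H.Adj (label H p l (i + 1)) (label H l p (i / 2)) := by
  have h1 := length_path_le (i + 1) (by omega)
  unfold label
  rw [path_succ i hi] at h1 ⊢
  rw [List.length_cons] at h1
  simp only [List.length_cons, Nat.even_add_one, ite_not]
  split_ifs
  · exact ((S.swap.child_spec h (w := path (i / 2)) (by omega)).2.2.2 _).1.symm
  · exact ((S.child_spec h (w := path (i / 2)) (by omega)).2.2.2 _).1.symm

theorem exists_adj_half (S : IsSpine H p l) (h : IsHexagonGraph H col) {w c : ℕ} (hw : w < 32)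
    (hc : c < 2) : ∃ v < 16, H.Adj (label H p l (31 + w)) (label H l p (31 + (16 * c + v))) := by
  have h5 := length_path_leaf w hw
  have hodd : ¬ Even 5 := by decide
  obtain ⟨u, hu, hadj⟩ := S.exists_adj_leaf_half h h5 (c == 1)
  obtain ⟨r, hr, hn⟩ := number_append u [c == 1]
  have hc' : (c == 1).toNat = c := by interval_cases c <;> rfl
  rw [hu] at hr hn
  simp only [number, hc'] at hn
  -- The first choice at the root is the highest of the five digits of a leaf, which gives the
  -- summand `16 * c`.
  have e : number (u ++ [c == 1]) = 31 + (16 * c + r) := by omega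
  refine ⟨r, hr, ?_⟩
  rw [← e, label, label, path_number (by simp [hu]), h5, if_neg hodd, if_neg (by simp [hu]; decide)]
  exact hadj

theorem labelling (S : IsSpine H p l) (h : IsHexagonGraph H col) :
    HexagonSearch.Labelling H (label H p l) (label H l p) where
  no_short := h.no_short
  inj_fst _ _ hi hj := S.label_injective h hi hj
  inj_snd _ _ hi hj := S.swap.label_injective h hi hj
  ne _ _ hi hj := S.label_ne_label h hi hj
  root := S.root
  parent_fst _ hi := S.adj_parent h hi
  parent_snd _ hi := S.swap.adj_parent h hi
  block_fst _ _ hw hc := S.exists_adj_half h hw hc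
  block_snd _ _ hw hc := S.swap.exists_adj_half h hw hc
  normal w v hw hv hadj := by
    have h1 := length_path_leaf w hw
    have h2 := length_path_leaf v hv
    have hodd : ¬ Even 5 := by decide
    rw [label, label, h1, h2, if_neg hodd, if_neg hodd] at hadj
    rw [← Bool.not_eq_true, HexagonSearch.excluded, List.any_eq_true]
    rintro ⟨k, hk, hk'⟩
    have hk : 1 ≤ k ∧ k < 5 := by simp at hk; omega
    rw [Bool.or_eq_true, Bool.and_eq_true, Bool.and_eq_true, beq_iff_eq, beq_iff_eq] at hk'
    rcases hk' with ⟨h3, h4⟩ | ⟨h3, h4⟩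
    · rw [path_of_bit w hw k hk.2 hk.1 h3, path_of_shiftRight v hv k hk.2 hk.1 h4] at hadj
      refine S.swap.not_adj_of_normal h hk.1 (by omega) ?_ ?_ ?_ hadj <;> simp [h1, h2] <;> omega
    · rw [path_of_bit v hv k hk.2 hk.1 h3, path_of_shiftRight w hw k hk.2 hk.1 h4] at hadj
      refine S.not_adj_of_normal h hk.1 (by omega) ?_ ?_ ?_ hadj.symm <;> simp [h1, h2] <;> omega

/-- Every vertex is closer to one of the two roots, at distance at most five, and belongs to the
tree of that root. -/
theorem exists_label_eq (S : IsSpine H p l) (h : IsHexagonGraph H col) {x : V}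
    (hx : col x = col (p 0)) : ∃ n < 63, label H p l n = x := by
  have h0 := h.dist_of_adj x S.root
  rw [H.dist_comm, H.dist_comm (u := x)] at h0
  have h6 : H.dist (l 0) x ≤ 5 :=
    h.dist_le_five (fun e => h.col_ne _ _ S.root (hx.symm.trans e.symm))
  have hev := (h.even_dist_iff (p 0) x).2 hx.symm
  rcases h0 with h0 | h0
  · obtain ⟨w, hw, rfl⟩ := S.exists_tree_eq h (n := H.dist (p 0) x) (by omega) rfl h0
    refine ⟨number w, number_lt (by omega), ?_⟩
    rw [label, path_number (by omega), if_pos (by rw [hw]; exact hev)]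
  · obtain ⟨w, hw, rfl⟩ := S.swap.exists_tree_eq h (n := H.dist (l 0) x) (by omega) rfl h0
    refine ⟨number w, number_lt (by omega), ?_⟩
    rw [label, path_number (by omega), if_neg]
    rw [h0, ← hw, Nat.even_add_one] at hev
    exact hev

theorem exists_label_eq' (S : IsSpine H p l) (h : IsHexagonGraph H col) {x : V}
    (hx : col x ≠ col (p 0)) : ∃ n < 63, label H l p n = x := by
  refine S.swap.exists_label_eq h ?_
  have := h.col_ne _ _ S.root
  revert hx this
  cases col x <;> cases col (p 0) <;> cases col (l 0) <;> simp

end IsSpine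

end Labelling

/-! ### Isomorphisms and the incidence graph -/

namespace PointLineGeometry

universe u₁ u₂ u₃ u₄

variable {P : Type u₁} {L : Type u₂} {P' : Type u₃} {L' : Type u₄}

/-- A bijection between the points is an isomorphism if it maps point sets of lines to point sets of
lines, and conversely. -/
theorem isIsomorphic_of_bijective {S : PointLineGeometry P L} {S' : PointLineGeometry P' L'}
    {e : P → P'} (he : Function.Bijective e)
    (hS : ∀ l m, (∀ p, S.Inc p l ↔ S.Inc p m) → l = m)
    (hS' : ∀ l m, (∀ p, S'.Inc p l ↔ S'.Inc p m) → l = m)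
    (h : ∀ l, ∃ l', ∀ p, S.Inc p l ↔ S'.Inc (e p) l')
    (h' : ∀ l', ∃ l, ∀ p, S.Inc p l ↔ S'.Inc (e p) l') : S.IsIsomorphic S' := by
  choose f hf using h
  have hf_inj : Function.Injective f := fun l m hlm =>
    hS l m fun p => by rw [hf, hf, hlm]
  have hf_surj : Function.Surjective f := fun l' => by
    obtain ⟨l, hl⟩ := h' l'
    refine ⟨l, hS' _ _ fun q => ?_⟩
    obtain ⟨p, rfl⟩ := he.2 q
    rw [← hf, hl]
  exact ⟨Equiv.ofBijective e he, Equiv.ofBijective f ⟨hf_inj, hf_surj⟩, fun p l => hf l p⟩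

theorem IsIsomorphic.dual {S : PointLineGeometry P L} {S' : PointLineGeometry P' L'}
    (h : S.IsIsomorphic S') : S.dual.IsIsomorphic S'.dual := by
  obtain ⟨e, f, hef⟩ := h
  exact ⟨f, e, fun l p => hef p l⟩

theorem IsPartialLinearSpace.line_ext {S : PointLineGeometry P L} (h : S.IsPartialLinearSpace)
    (l m : L) (hlm : ∀ p, S.Inc p l ↔ S.Inc p m) : l = m := by
  obtain ⟨p, q, hpq, hp, hq⟩ := h.1 l
  exact h.2 p q l m hpq hp hq ((hlm p).1 hp) ((hlm q).1 hq)

/-- The incidence graph. -/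
def incidenceGraph (S : PointLineGeometry P L) : SimpleGraph (P ⊕ L) where
  Adj
    | Sum.inl p, Sum.inr l => S.Inc p l
    | Sum.inr l, Sum.inl p => S.Inc p l
    | _, _ => False
  symm := ⟨fun x y h => by cases x <;> cases y <;> exact h⟩
  loopless := ⟨fun x h => by cases x <;> exact h⟩

end PointLineGeometry

/-! ### Identification of the two solutions by coordinates -/

namespace HexagonSearch

/-- The members of `m` that are less than `63`. -/
def members (m : ℕ) : List ℕ := (List.range 63).filter (bit m)

theorem mem_members {m i : ℕ} : i ∈ members m ↔ i < 63 ∧ m.testBit i = true := by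
  rw [members, List.mem_filter, List.mem_range, bit_eq_testBit]

theorem nodup_members (m : ℕ) : (members m).Nodup := List.nodup_range.filter _

section Regular

variable {V : Type*} {H : SimpleGraph V} {a b : ℕ → V}

/-- If every vertex has three neighbours in a graph of edges of `H` then these are all edges. -/
theorem Realizes.adj_iff {T : Graph} (h : Realizes H a b T) (hab : Labelling H a b)
    (h3 : ∀ u, (H.neighborSet u).ncard = 3)
    (hT : ∀ i < 63, (members (T.fst.get i)).length = 3) {i j : ℕ} (hi : i < 63) (hj : j < 63) :
    H.Adj (a i) (b j) ↔ (T.fst.get i).testBit j := by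
  refine ⟨fun hij => ?_, fun hij => (h.fst i j (by omega) hij).2.2⟩
  set s : Finset ℕ := (members (T.fst.get i)).toFinset with hs
  have hs3 : s.card = 3 := by
    rw [hs, List.toFinset_card_of_nodup (nodup_members _), hT i hi]
  have hmem : ∀ k ∈ s, k < 63 ∧ (T.fst.get i).testBit k = true := fun k hk => by
    rwa [hs, List.mem_toFinset, mem_members] at hk
  have hinj : Set.InjOn b s := fun k hk k' hk' e =>
    hab.inj_snd k k' (hmem k hk).1 (hmem k' hk').1 e
  have hsub : b '' s ⊆ H.neighborSet (a i) := by
    rintro _ ⟨k, hk, rfl⟩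
    exact (h.fst i k (by omega) (hmem k hk).2).2.2
  have hfin : (H.neighborSet (a i)).Finite :=
    Set.finite_of_ncard_ne_zero (by rw [h3]; norm_num)
  have heq := Set.eq_of_subset_of_ncard_le hsub
    (by rw [h3, hinj.ncard_image, Set.ncard_coe_finset, hs3]) hfin
  have hb : b j ∈ b '' s := by rw [heq]; exact hij
  obtain ⟨k, hk, e⟩ := hb
  have := hab.inj_snd k j (hmem k hk).1 hj e
  exact this ▸ (hmem k hk).2

theorem Realizes.adj_iff_snd {T : Graph} (h : Realizes H a b T) (hab : Labelling H a b)
    (h3 : ∀ u, (H.neighborSet u).ncard = 3)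
    (hT : ∀ i < 63, (members (T.snd.get i)).length = 3) {i j : ℕ} (hi : i < 63) (hj : j < 63) :
    H.Adj (a i) (b j) ↔ (T.snd.get j).testBit i :=
  (SimpleGraph.adj_comm _ _ _).trans (h.swap.adj_iff hab.swap h3 hT hj hi)

end Regular

/-- The vector with the binary digits of `n` as coordinates. -/
def vec (n : ℕ) : SplitCayley.Vec := fun k => bif bit n k then 1 else 0

/-- The value of the quadratic form. -/
def formBit (n : ℕ) : Bool :=
  (bit n 0 && bit n 4) ^^ (bit n 1 && bit n 5) ^^ (bit n 2 && bit n 6) ^^ bit n 3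

/-- A Grassmann coordinate. -/
def grassmannBit (n m i j : ℕ) : Bool := (bit n i && bit m j) ^^ (bit n j && bit m i)

/-- Tits' equations. -/
def titsBit (n m : ℕ) : Bool :=
  (grassmannBit n m 1 2 == grassmannBit n m 3 4) && (grassmannBit n m 5 4 == grassmannBit n m 3 2) &&
  (grassmannBit n m 2 0 == grassmannBit n m 3 5) && (grassmannBit n m 6 5 == grassmannBit n m 3 0) &&
  (grassmannBit n m 0 1 == grassmannBit n m 3 6) && (grassmannBit n m 4 6 == grassmannBit n m 3 1)

/-- The following five rules replace arithmetic modulo two by Boolean operations that the kernel can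
evaluate; signs and squares disappear. -/
theorem cond_mul_cond : ∀ x y : Bool,
    (bif x then 1 else 0 : ZMod 2) * (bif y then 1 else 0) = bif x && y then 1 else 0 := by decide

theorem cond_sub_cond : ∀ x y : Bool,
    (bif x then 1 else 0 : ZMod 2) - (bif y then 1 else 0) = bif x ^^ y then 1 else 0 := by decide

theorem cond_add_cond : ∀ x y : Bool,
    (bif x then 1 else 0 : ZMod 2) + (bif y then 1 else 0) = bif x ^^ y then 1 else 0 := by decide

theorem cond_sq : ∀ x : Bool, (bif x then 1 else 0 : ZMod 2) ^ 2 = bif x then 1 else 0 := by decide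

theorem cond_inj : ∀ x y : Bool,
    (bif x then 1 else 0 : ZMod 2) = (bif y then 1 else 0) ↔ x = y := by decide

theorem form_vec (n : ℕ) : SplitCayley.form (vec n) = bif formBit n then 1 else 0 := by
  simp only [SplitCayley.form, vec, cond_mul_cond, cond_add_cond, cond_sub_cond, cond_sq, formBit]
  simp

theorem form_vec_eq_zero (n : ℕ) : SplitCayley.form (vec n) = 0 ↔ formBit n = false := by
  rw [form_vec]
  exact cond_inj _ false

theorem grassmann_vec (n m : ℕ) (i j : Fin 7) : SplitCayley.grassmann (vec n) (vec m) i j =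
    bif grassmannBit n m i j then 1 else 0 := by
  simp only [SplitCayley.grassmann, vec, cond_mul_cond, cond_sub_cond, grassmannBit]

theorem titsEquations_vec (n m : ℕ) :
    SplitCayley.TitsEquations (vec n) (vec m) ↔ titsBit n m = true := by
  simp only [SplitCayley.TitsEquations, grassmann_vec, cond_inj, titsBit, Bool.and_eq_true,
    beq_iff_eq, and_assoc]
  rfl

theorem vec_xor (n m : ℕ) : vec (n ^^^ m) = vec n + vec m := by
  funext k
  rw [Pi.add_apply, vec, vec, vec, cond_add_cond, bit_eq_testBit, bit_eq_testBit, bit_eq_testBit,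
    Nat.testBit_xor]

theorem vec_injective {n m : ℕ} (hn : n < 128) (hm : m < 128) (h : vec n = vec m) : n = m := by
  refine Nat.eq_of_testBit_eq fun i => ?_
  by_cases hi : i < 7
  · have := congrFun h ⟨i, hi⟩
    rwa [vec, vec, cond_inj, bit_eq_testBit, bit_eq_testBit] at this
  · have h7 : 2 ^ 7 ≤ 2 ^ i := Nat.pow_le_pow_right (by norm_num) (by omega)
    rw [Nat.testBit_lt_two_pow (by omega), Nat.testBit_lt_two_pow (by omega)]

theorem exists_vec_eq (x : SplitCayley.Vec) : ∃ n < 128, vec n = x := by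
  have key : ∀ c : Fin 7 → Bool, ∃ n < 128, ∀ k : Fin 7, bit n k = c k := by
    intro c
    refine ⟨(c 0).toNat + 2 * (c 1).toNat + 4 * (c 2).toNat + 8 * (c 3).toNat + 16 * (c 4).toNat +
      32 * (c 5).toNat + 64 * (c 6).toNat, ?_, ?_⟩
    · have := fun i => Bool.toNat_le (c i)
      have h0 := this 0
      have h1 := this 1
      have h2 := this 2
      have h3 := this 3
      have h4 := this 4
      have h5 := this 5
      have h6 := this 6
      omega
    · have : ∀ c0 c1 c2 c3 c4 c5 c6 : Bool, ∀ k : Fin 7,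
          bit (c0.toNat + 2 * c1.toNat + 4 * c2.toNat + 8 * c3.toNat + 16 * c4.toNat +
            32 * c5.toNat + 64 * c6.toNat) k = ![c0, c1, c2, c3, c4, c5, c6] k := by decide +kernel
      intro k
      rw [this]
      fin_cases k <;> rfl
  obtain ⟨n, hn, h⟩ := key fun k => x k == 1
  refine ⟨n, hn, funext fun k => ?_⟩
  rw [vec, h]
  generalize x k = y
  revert y
  decide

theorem vec_ne_zero {n : ℕ} (hn : n < 128) (h0 : n ≠ 0) : vec n ≠ 0 := fun h =>
  h0 (vec_injective hn (by norm_num) (h.trans (by funext k; simp [vec, bit_eq_testBit])))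

/-- The list `c` codes the points of the split Cayley hexagon in such a way that the rows of `T` are
its lines. -/
structure IsCoding (T : Table) (c : List ℕ) : Prop where
  lt : ∀ i < 63, c.getD i 0 < 128
  injective : ∀ i < 63, ∀ j < 63, c.getD i 0 = c.getD j 0 → i = j
  point : ∀ i < 63, c.getD i 0 ≠ 0 ∧ formBit (c.getD i 0) = false
  surjective : ∀ n < 128, n ≠ 0 → formBit n = false → n ∈ c.take 63
  line : ∀ j < 63, ∃ x y z, members (T.get j) = [x, y, z] ∧
    (c.getD x 0) ^^^ (c.getD y 0) = c.getD z 0 ∧ titsBit (c.getD x 0) (c.getD y 0) = true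
  exists_line : ∀ i < 63, ∀ k < 63, titsBit (c.getD i 0) (c.getD k 0) = true →
    formBit ((c.getD i 0) ^^^ (c.getD k 0)) = false → i ≠ k →
    ∃ j < 63, bit (T.get j) i = true ∧ bit (T.get j) k = true

theorem isPoint_of_mem {l : Finset SplitCayley.Vec} (hl : SplitCayley.IsLine l)
    {x : SplitCayley.Vec} (hx : x ∈ l) : SplitCayley.IsPoint x := by
  obtain ⟨y, z, -, hy, hz, hyz, -, rfl⟩ := hl
  simp only [Finset.mem_insert, Finset.mem_singleton] at hx
  rcases hx with rfl | rfl | rfl <;> assumption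

theorem vec_add_add (x y : SplitCayley.Vec) : x + (x + y) = y := by
  funext k
  have : ∀ a b : ZMod 2, a + (a + b) = b := by decide
  exact this _ _

/-- The code is a bijection onto the points of the quadric, and each row of `T` becomes a set `{x,
y, x + y}` that satisfies Tits' equations. Conversely, two points of a line of the hexagon occur in
a common row. That row has at most three points and is closed under sums of distinct points, so it
is the line. -/
theorem IsCoding.isIsomorphic {A B : Type*} {S : PointLineGeometry A B} {T : Table} {c : List ℕ}
    (hc : IsCoding T c) {α : ℕ → A} {β : ℕ → B}
    (hα : ∀ i j, i < 63 → j < 63 → α i = α j → i = j)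
    (hα' : ∀ p, ∃ i < 63, α i = p) (hβ : ∀ l, ∃ j < 63, β j = l)
    (hinc : ∀ i j, i < 63 → j < 63 → (S.Inc (α i) (β j) ↔ (T.get j).testBit i = true))
    (hS : ∀ l m, (∀ p, S.Inc p l ↔ S.Inc p m) → l = m) :
    S.IsIsomorphic splitCayleyHexagon := by
  choose idx hidx using hα'
  have hidx' : ∀ i < 63, idx (α i) = i := fun i hi => hα _ _ (hidx _).1 hi (hidx _).2
  have hpt : ∀ i < 63, SplitCayley.IsPoint (vec (c.getD i 0)) := fun i hi =>
    ⟨vec_ne_zero (hc.lt i hi) (hc.point i hi).1, (form_vec_eq_zero _).2 (hc.point i hi).2⟩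
  have hinj : ∀ i < 63, ∀ j < 63, vec (c.getD i 0) = vec (c.getD j 0) → i = j :=
    fun i hi j hj h => hc.injective i hi j hj (vec_injective (hc.lt i hi) (hc.lt j hj) h)
  have hsurj : ∀ x, SplitCayley.IsPoint x → ∃ i < 63, vec (c.getD i 0) = x := by
    intro x hx
    obtain ⟨n, hn, rfl⟩ := exists_vec_eq x
    have hn0 : n ≠ 0 := by
      rintro rfl
      exact hx.1 (by funext k; simp [vec, bit_eq_testBit])
    have := hc.surjective n hn hn0 ((form_vec_eq_zero _).1 hx.2)
    obtain ⟨i, hi, rfl⟩ := List.mem_iff_getElem.1 this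
    have hi' : i < 63 ∧ i < c.length := by simpa using hi
    exact ⟨i, hi'.1, by simp [List.getD_eq_getElem?_getD, hi'.2]⟩
  have hline : ∀ j < 63, ∃ l : Finset SplitCayley.Vec, SplitCayley.IsLine l ∧ l.card ≤ 3 ∧
      (∀ x ∈ l, ∀ y ∈ l, x ≠ y → x + y ∈ l) ∧
      ∀ i < 63, (T.get j).testBit i = true ↔ vec (c.getD i 0) ∈ l := by
    intro j hj
    obtain ⟨x, y, z, hm, hsum, ht⟩ := hc.line j hj
    have hmem : ∀ i, (i < 63 ∧ (T.get j).testBit i = true) ↔ (i = x ∨ i = y ∨ i = z) := fun i => by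
      rw [← mem_members, hm]
      simp
    have hx := ((hmem x).2 (by simp)).1
    have hy := ((hmem y).2 (by simp)).1
    have hz := ((hmem z).2 (by simp)).1
    have hadd : vec (c.getD x 0) + vec (c.getD y 0) = vec (c.getD z 0) := by rw [← vec_xor, hsum]
    have hxy : x ≠ y := by
      have := nodup_members (T.get j)
      rw [hm] at this
      simp at this
      exact this.1.1
    refine ⟨{vec (c.getD x 0), vec (c.getD y 0), vec (c.getD z 0)}, ?_, Finset.card_le_three, ?_, ?_⟩
    · exact ⟨vec (c.getD x 0), vec (c.getD y 0), fun h => hxy (hinj x hx y hy h), hpt x hx, hpt y hy,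
        hadd ▸ hpt z hz, (titsEquations_vec _ _).2 ht, by rw [hadd]⟩
    · have h1 : vec (c.getD y 0) + vec (c.getD x 0) = vec (c.getD z 0) := by rw [add_comm, hadd]
      have h2 : vec (c.getD x 0) + vec (c.getD z 0) = vec (c.getD y 0) := by rw [← hadd, vec_add_add]
      have h3 : vec (c.getD y 0) + vec (c.getD z 0) = vec (c.getD x 0) := by rw [← h1, vec_add_add]
      have h4 : vec (c.getD z 0) + vec (c.getD x 0) = vec (c.getD y 0) := by rw [add_comm, h2]
      have h5 : vec (c.getD z 0) + vec (c.getD y 0) = vec (c.getD x 0) := by rw [add_comm, h3]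
      simp only [Finset.mem_insert, Finset.mem_singleton]
      rintro u (rfl | rfl | rfl) v (rfl | rfl | rfl) huv
      · exact absurd rfl huv
      · rw [hadd]; simp
      · rw [h2]; simp
      · rw [h1]; simp
      · exact absurd rfl huv
      · rw [h3]; simp
      · rw [h4]; simp
      · rw [h5]; simp
      · exact absurd rfl huv
    · intro i hi
      have h1 := hmem i
      simp only [hi, true_and] at h1
      rw [h1]
      simp only [Finset.mem_insert, Finset.mem_singleton]
      constructor
      · rintro (rfl | rfl | rfl) <;> simp
      · rintro (h | h | h)
        · exact Or.inl (hinj _ hi _ hx h)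
        · exact Or.inr (Or.inl (hinj _ hi _ hy h))
        · exact Or.inr (Or.inr (hinj _ hi _ hz h))
  have hincl : ∀ (l : Finset SplitCayley.Vec) (hl : SplitCayley.IsLine l) (j : ℕ), j < 63 →
      (∀ i < 63, (T.get j).testBit i = true ↔ vec (c.getD i 0) ∈ l) → ∀ p : A,
      S.Inc p (β j) ↔ splitCayleyHexagon.Inc ⟨vec (c.getD (idx p) 0), hpt _ (hidx p).1⟩ ⟨l, hl⟩ := by
    intro l hl j hj h p
    have h1 := h (idx p) (hidx p).1
    rw [← hinc _ _ (hidx p).1 hj, (hidx p).2] at h1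
    exact h1
  refine PointLineGeometry.isIsomorphic_of_bijective
    (e := fun p => ⟨vec (c.getD (idx p) 0), hpt _ (hidx p).1⟩) ⟨fun p q h => ?_, fun x => ?_⟩ hS
    ?_ ?_ ?_
  · have := hinj _ (hidx p).1 _ (hidx q).1 (Subtype.ext_iff.1 h)
    rw [← (hidx p).2, this, (hidx q).2]
  · obtain ⟨i, hi, hx⟩ := hsurj x.1 x.2
    refine ⟨α i, Subtype.ext ?_⟩
    simp only [hidx' i hi, hx]
  · rintro ⟨l, hl⟩ ⟨m, hm⟩ h
    refine Subtype.ext (Finset.ext fun x => ⟨fun hx => ?_, fun hx => ?_⟩)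
    · exact (h ⟨x, isPoint_of_mem hl hx⟩).1 hx
    · exact (h ⟨x, isPoint_of_mem hm hx⟩).2 hx
  · intro l
    obtain ⟨j, hj, rfl⟩ := hβ l
    obtain ⟨l, hl, -, -, h⟩ := hline j hj
    exact ⟨⟨l, hl⟩, hincl l hl j hj h⟩
  · rintro ⟨l', hl'⟩
    have hl'' := hl'
    obtain ⟨x, y, hxy, hx, hy, hxy', ht, rfl⟩ := hl''
    obtain ⟨i, hi, rfl⟩ := hsurj x hx
    obtain ⟨k, hk, rfl⟩ := hsurj y hy
    rw [titsEquations_vec] at ht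
    have hf := hxy'.2
    rw [← vec_xor, form_vec_eq_zero] at hf
    obtain ⟨j, hj, h1, h2⟩ := hc.exists_line i hi k hk ht hf (fun e => hxy (by rw [e]))
    rw [bit_eq_testBit] at h1 h2
    obtain ⟨l, hl, hcard, hadd, h⟩ := hline j hj
    have hsub : {vec (c.getD i 0), vec (c.getD k 0), vec (c.getD i 0) + vec (c.getD k 0)} ⊆ l := by
      intro u hu
      have e1 := (h i hi).1 h1
      have e2 := (h k hk).1 h2
      simp only [Finset.mem_insert, Finset.mem_singleton] at hu
      rcases hu with rfl | rfl | rfl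
      · exact e1
      · exact e2
      · exact hadd _ e1 _ e2 hxy
    have heq := Finset.eq_of_subset_of_card_le hsub (by
      rw [Finset.card_eq_three.2 ⟨_, _, _, hxy, ?_, ?_, rfl⟩]
      · exact hcard
      · intro e
        exact hy.1 (by simpa using e)
      · intro e
        exact hx.1 (by simpa using e))
    refine ⟨β j, hincl _ hl' j hj ?_⟩
    rw [heq]
    exact h

/-- Vectors for the vertices of the second kind of `dualGraph`. -/
def dualCode : List ℕ :=
  [97, 46, 79, 96, 1, 78, 47, 91, 117, 58, 20, 51, 124, 82, 29, 102, 6, 7, 103, 64, 65, 33, 32,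
   61, 115, 92, 18, 27, 52, 122, 85, 25, 66, 55, 108, 112, 5, 94, 43, 121, 67, 87, 109, 16, 4, 62,
   42, 127, 76, 48, 3, 22, 106, 89, 37, 31, 77, 80, 2, 118, 107, 57, 36]

/-- Vectors for the vertices of the first kind of `splitGraph`. -/
def splitCode : List ℕ :=
  [1, 96, 97, 64, 65, 32, 33, 7, 103, 6, 102, 79, 46, 78, 47, 2, 66, 3, 67, 106, 43, 107, 42, 5,
   37, 4, 36, 109, 76, 108, 77, 80, 87, 48, 55, 89, 62, 57, 94, 16, 22, 112, 118, 25, 127, 121,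
   31, 82, 29, 51, 124, 91, 117, 58, 20, 18, 92, 115, 61, 27, 52, 122, 85]

/-- A test for `IsCoding`. -/
def isCoding (T : Table) (c : List ℕ) : Bool :=
  (List.range 63).all (fun i => decide (c.getD i 0 < 128) && !(c.getD i 0 == 0) &&
    !(formBit (c.getD i 0)) && match members (T.get i) with
      | [x, y, z] => (c.getD x 0) ^^^ (c.getD y 0) == c.getD z 0 && titsBit (c.getD x 0) (c.getD y 0)
      | _ => false) &&
  (List.range 63).all (fun i => (List.range 63).all fun k =>
    i == k || (!(Nat.beq (c.getD i 0) (c.getD k 0)) &&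
      (formBit ((c.getD i 0) ^^^ (c.getD k 0)) || !(titsBit (c.getD i 0) (c.getD k 0)) ||
        (List.range 63).any fun j => bit (T.get j) i && bit (T.get j) k))) &&
  (List.range 128).all fun n => n == 0 || formBit n || (c.take 63).contains n

theorem isCoding_of_eq_true {T : Table} {c : List ℕ} (h : isCoding T c = true) : IsCoding T c := by
  simp only [isCoding, Bool.and_eq_true, List.all_eq_true, List.mem_range] at h
  obtain ⟨⟨h1, h2⟩, h3⟩ := h
  refine ⟨fun i hi => ?_, fun i hi j hj e => ?_, fun i hi => ?_, fun n hn h0 hf => ?_,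
    fun j hj => ?_, fun i hi k hk ht hf hik => ?_⟩
  · simpa using (h1 i hi).1.1.1
  · by_contra hij
    have := h2 i hi j hj
    rw [e] at this
    simp [hij] at this
  · have := h1 i hi
    exact ⟨by simpa using this.1.1.2, by simpa using this.1.2⟩
  · have := h3 n hn
    simpa [h0, hf] using this
  · have := (h1 j hj).2
    split at this
    · rename_i x y z hm
      simp only [Bool.and_eq_true, beq_iff_eq] at this
      exact ⟨x, y, z, hm, this⟩
    · exact absurd this Bool.false_ne_true
  · have := h2 i hi k hk
    simp only [Bool.or_eq_true, beq_iff_eq, hik, false_or, Bool.and_eq_true, hf, ht, Bool.not_true,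
      Bool.false_eq_true, List.any_eq_true, List.mem_range] at this
    obtain ⟨-, j, hj, hj'⟩ := this
    exact ⟨j, hj, hj'⟩

-- In `dualGraph` the points of `H(2)` are the vertices of the second kind; in `splitGraph` they are
-- those of the first kind.
set_option maxRecDepth 100000 in
theorem isCoding_dual : IsCoding dualGraph.fst dualCode :=
  isCoding_of_eq_true (by decide +kernel)

set_option maxRecDepth 100000 in
theorem isCoding_split : IsCoding splitGraph.snd splitCode :=
  isCoding_of_eq_true (by decide +kernel)

theorem length_members_dual : ∀ i < 63, (members (dualGraph.fst.get i)).length = 3 := fun i hi => by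
  obtain ⟨x, y, z, h, -⟩ := isCoding_dual.line i hi
  rw [h]
  rfl

theorem length_members_split : ∀ i < 63, (members (splitGraph.snd.get i)).length = 3 :=
  fun i hi => by
  obtain ⟨x, y, z, h, -⟩ := isCoding_split.line i hi
  rw [h]
  rfl

end HexagonSearch

/-! ### Generalized hexagons of order (2,2) -/

/-- A geometry whose incidence graph is that of a generalized hexagon of order `(2, 2)` is the split
Cayley hexagon or its dual. -/
theorem PointLineGeometry.isIsomorphic_of_isHexagonGraph {P L : Type*} {N : PointLineGeometry P L}
    (hN : N.IsPartialLinearSpace) (h : IsHexagonGraph N.incidenceGraph Sum.isLeft)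
    (hext : ∀ p q, (∀ l, N.Inc p l ↔ N.Inc q l) → p = q) [Nonempty P] :
    N.IsIsomorphic splitCayleyHexagon ∨ N.IsIsomorphic splitCayleyHexagon.dual := by
  obtain ⟨p, l, S, hp⟩ := h.exists_spine (Sum.inl (Classical.arbitrary P))
  have hcol : Sum.isLeft (p 0) = true := by rw [hp]; rfl
  have hlab := S.labelling h
  have hleft : ∀ x : P, ∃ n < 63, label N.incidenceGraph p l n = Sum.inl x := fun x =>
    S.exists_label_eq h (by rw [hcol]; rfl)
  have hright : ∀ x : L, ∃ n < 63, label N.incidenceGraph l p n = Sum.inr x := fun x =>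
    S.exists_label_eq' h (by rw [hcol]; simp)
  have hev : ∀ n < 63, ∃ x : P, label N.incidenceGraph p l n = Sum.inl x := by
    intro n hn
    rcases hx : label N.incidenceGraph p l n with x | y
    · exact ⟨x, rfl⟩
    · obtain ⟨m, hm, h'⟩ := hright y
      exact absurd (hx.trans h'.symm) (S.label_ne_label h hn hm)
  have hod : ∀ n < 63, ∃ x : L, label N.incidenceGraph l p n = Sum.inr x := by
    intro n hn
    rcases hx : label N.incidenceGraph l p n with x | y
    · obtain ⟨m, hm, h'⟩ := hleft x
      exact absurd (h'.trans hx.symm) (S.label_ne_label h hm hn)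
    · exact ⟨y, rfl⟩
  obtain ⟨x₀⟩ := ‹Nonempty P›
  obtain ⟨l₀, -⟩ := hod 0 (by norm_num)
  have hα : ∃ α : ℕ → P, ∀ n < 63, label N.incidenceGraph p l n = Sum.inl (α n) := by
    choose! α hα using hev
    exact ⟨α, hα⟩
  have hβ : ∃ β : ℕ → L, ∀ n < 63, label N.incidenceGraph l p n = Sum.inr (β n) := by
    have : Nonempty L := ⟨l₀⟩
    choose! β hβ using hod
    exact ⟨β, hβ⟩
  obtain ⟨α, hα⟩ := hα
  obtain ⟨β, hβ⟩ := hβ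
  have hα_inj : ∀ i j, i < 63 → j < 63 → α i = α j → i = j := fun i j hi hj e =>
    hlab.inj_fst i j hi hj (by rw [hα i hi, hα j hj, e])
  have hβ_inj : ∀ i j, i < 63 → j < 63 → β i = β j → i = j := fun i j hi hj e =>
    hlab.inj_snd i j hi hj (by rw [hβ i hi, hβ j hj, e])
  have hα_surj : ∀ x, ∃ i < 63, α i = x := fun x => by
    obtain ⟨n, hn, hx⟩ := hleft x
    exact ⟨n, hn, Sum.inl_injective ((hα n hn).symm.trans hx)⟩
  have hβ_surj : ∀ x, ∃ i < 63, β i = x := fun x => by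
    obtain ⟨n, hn, hx⟩ := hright x
    exact ⟨n, hn, Sum.inr_injective ((hβ n hn).symm.trans hx)⟩
  have hinc : ∀ i j, i < 63 → j < 63 → (N.Inc (α i) (β j) ↔
      N.incidenceGraph.Adj (label N.incidenceGraph p l i) (label N.incidenceGraph l p j)) :=
    fun i j hi hj => by
      rw [hα i hi, hβ j hj]
      rfl
  rcases hlab.realizes with hr | hr
  · right
    have hadj := fun i j hi hj => hr.adj_iff hlab h.three HexagonSearch.length_members_dual
      (i := i) (j := j) hi hj
    -- Here the lines of `N` receive the coordinates, so the dual of `N` is identified with `H(2)`.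
    have := HexagonSearch.isCoding_dual.isIsomorphic (S := N.dual) hβ_inj hβ_surj hα_surj
      (fun i j hi hj => (hinc j i hj hi).trans (hadj j i hj hi)) hext
    exact this.dual
  · left
    have hadj := fun i j hi hj => hr.adj_iff_snd hlab h.three HexagonSearch.length_members_split
      (i := i) (j := j) hi hj
    exact HexagonSearch.isCoding_split.isIsomorphic (S := N) hα_inj hα_surj hβ_surj
      (fun i j hi hj => (hinc i j hi hj).trans (hadj i j hi hj)) hN.line_ext

/-! ### Near hexagons of order (2,2): lines and distances -/

namespace PointLineGeometry

universe u₅ u₆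

variable {P : Type u₅} {L : Type u₆}

/-- The distance in the collinearity graph. -/
noncomputable abbrev d (N : PointLineGeometry P L) (p q : P) : ℕ := N.collinearityGraph.dist p q

/-- Three distinct points of a line. -/
def Triple (N : PointLineGeometry P L) (p q r : P) : Prop :=
  p ≠ q ∧ p ≠ r ∧ q ≠ r ∧ ∃ l, N.Inc p l ∧ N.Inc q l ∧ N.Inc r l

/-- A near hexagon of order `(2, 2)`. -/
structure IsNearHexagonTwo (N : PointLineGeometry P L) : Prop where
  nearHexagon : N.IsNearHexagon
  order : N.HasOrder 2 2

namespace Triple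

variable {N : PointLineGeometry P L} {p q r : P}

theorem rotate (h : N.Triple p q r) : N.Triple q r p :=
  let ⟨h1, h2, h3, l, hp, hq, hr⟩ := h
  ⟨h3, h1.symm, h2.symm, l, hq, hr, hp⟩

theorem swap (h : N.Triple p q r) : N.Triple q p r :=
  let ⟨h1, h2, h3, l, hp, hq, hr⟩ := h
  ⟨h1.symm, h3, h2, l, hq, hp, hr⟩

theorem swap' (h : N.Triple p q r) : N.Triple p r q := h.rotate.swap.rotate.rotate

theorem adj (h : N.Triple p q r) : N.collinearityGraph.Adj p q :=
  let ⟨h1, _, _, l, hp, hq, _⟩ := h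
  ⟨h1, l, hp, hq⟩

theorem dist_eq_one (h : N.Triple p q r) : N.d p q = 1 := SimpleGraph.dist_eq_one_iff_adj.2 h.adj

end Triple

namespace IsNearHexagonTwo

variable {N : PointLineGeometry P L} (h : N.IsNearHexagonTwo) {p q r x y z : P}
include h

theorem connected : N.collinearityGraph.Connected := h.nearHexagon.connected

theorem d_triangle (x y z : P) : N.d x z ≤ N.d x y + N.d y z := h.connected.dist_triangle

theorem d_eq_zero_iff : N.d x y = 0 ↔ x = y := h.connected.dist_eq_zero_iff

omit h in
theorem d_comm (x y : P) : N.d x y = N.d y x := SimpleGraph.dist_comm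

theorem eq_of_inc {l m : L} (hpq : p ≠ q) (h1 : N.Inc p l) (h2 : N.Inc q l) (h3 : N.Inc p m)
    (h4 : N.Inc q m) : l = m := h.nearHexagon.partialLinear.2 p q l m hpq h1 h2 h3 h4

theorem eq_of_inc_of_triple {l : L} {w : P} (hpq : p ≠ q) (hpr : p ≠ r) (hqr : q ≠ r)
    (hp : N.Inc p l) (hq : N.Inc q l) (hr : N.Inc r l) (hw : N.Inc w l) :
    w = p ∨ w = q ∨ w = r := by
  have h1 : ({p, q, r} : Set P) ⊆ {p | N.Inc p l} := by
    rintro z (rfl | rfl | rfl) <;> assumption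
  have h2 : ({p, q, r} : Set P).ncard = 3 :=
    Set.ncard_eq_three.2 ⟨p, q, r, hpq, hpr, hqr, rfl⟩
  have h3 := h.order.1 l
  have h4 := Set.eq_of_subset_of_ncard_le h1 (by omega) (Set.finite_of_ncard_ne_zero (by omega))
  have : w ∈ ({p, q, r} : Set P) := by
    rw [h4]
    exact hw
  simpa using this

theorem exists_triple_of_inc {l : L} (hpq : p ≠ q) (hp : N.Inc p l) (hq : N.Inc q l) :
    ∃ r, N.Triple p q r ∧ N.Inc r l := by
  have h3 := h.order.1 l
  by_contra! hcon
  have h1 : {p | N.Inc p l} ⊆ ({p, q} : Set P) := fun z hz => by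
    by_contra hz'
    rw [Set.mem_insert_iff, Set.mem_singleton_iff, not_or] at hz'
    exact hcon z ⟨hpq, Ne.symm hz'.1, Ne.symm hz'.2, l, hp, hq, hz⟩ hz
  have h2 := Set.ncard_le_ncard h1 (Set.toFinite _)
  have h4 := Set.ncard_insert_le p {q}
  rw [Set.ncard_singleton] at h4
  omega

theorem exists_triple (hpq : N.d p q = 1) : ∃ r, N.Triple p q r := by
  obtain ⟨h1, l, hp, hq⟩ := SimpleGraph.dist_eq_one_iff_adj.1 hpq
  obtain ⟨r, hr, -⟩ := h.exists_triple_of_inc h1 hp hq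
  exact ⟨r, hr⟩

theorem triple_unique {r' : P} (h1 : N.Triple p q r) (h2 : N.Triple p q r') : r = r' := by
  obtain ⟨hpq, hpr, hqr, l, hp, hq, hr⟩ := h1
  obtain ⟨-, hpr', hqr', l', hp', hq', hr'⟩ := h2
  obtain rfl := h.eq_of_inc hpq hp hq hp' hq'
  rcases h.eq_of_inc_of_triple hpq hpr hqr hp hq hr hr' with e | e | e
  · exact absurd e.symm hpr'
  · exact absurd e.symm hqr'
  · exact e.symm

theorem exists_nearest (x : P) (l : L) :
    ∃ p, N.Inc p l ∧ ∀ q, N.Inc q l → q ≠ p → N.d x q = N.d x p + 1 := by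
  obtain ⟨p, ⟨hp, hmin⟩, huniq⟩ := h.nearHexagon.nearest x l
  refine ⟨p, hp, fun q hq hqp => ?_⟩
  have h1 : N.d p q = 1 := SimpleGraph.dist_eq_one_iff_adj.2 ⟨hqp.symm, l, hp, hq⟩
  have h2 := h.d_triangle x p q
  have h3 : N.d x p ≤ N.d x q := hmin q hq
  by_contra hne
  exact hqp (huniq q ⟨hq, fun z hz => (show N.d x q ≤ N.d x p by omega).trans (hmin z hz)⟩)

/-- The distances from `x` to the points of a line are `k`, `k + 1`, `k + 1` in some order. -/
theorem d_triple (hT : N.Triple p q r) (x : P) :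
    (N.d x q = N.d x p + 1 ∧ N.d x r = N.d x p + 1) ∨
      (N.d x p = N.d x q + 1 ∧ N.d x r = N.d x q + 1) ∨
        (N.d x p = N.d x r + 1 ∧ N.d x q = N.d x r + 1) := by
  obtain ⟨hpq, hpr, hqr, l, hp, hq, hr⟩ := hT
  obtain ⟨z, hz, hz'⟩ := h.exists_nearest x l
  rcases h.eq_of_inc_of_triple hpq hpr hqr hp hq hr hz with rfl | rfl | rfl
  · exact Or.inl ⟨hz' q hq hpq.symm, hz' r hr hpr.symm⟩
  · exact Or.inr (Or.inl ⟨hz' p hp hpq, hz' r hr hqr.symm⟩)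
  · exact Or.inr (Or.inr ⟨hz' p hp hpr, hz' q hq hqr⟩)

theorem d_le_three (x y : P) : N.d x y ≤ 3 := by
  have h1 : N.collinearityGraph.edist x y ≤ 3 := by
    rw [← Nat.cast_ofNat, ← h.nearHexagon.diameter]
    exact SimpleGraph.edist_le_ediam
  rw [← (h.connected x y).coe_dist_eq_edist] at h1
  exact_mod_cast h1

theorem exists_two_lt_d : ∃ x y, 2 < N.d x y := by
  by_contra! hcon
  have h1 : N.collinearityGraph.ediam ≤ 2 := SimpleGraph.ediam_le_of_edist_le fun x y => by
    rw [← (h.connected x y).coe_dist_eq_edist]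
    exact_mod_cast hcon x y
  rw [h.nearHexagon.diameter] at h1
  exact absurd h1 (by decide)

theorem exists_between {n : ℕ} (hxy : N.d x y = n + 1) : ∃ z, N.d x z = n ∧ N.d z y = 1 := by
  obtain ⟨p, hp⟩ := (h.connected y x).exists_walk_length_eq_dist
  have hp : p.length = n + 1 := by rw [hp, SimpleGraph.dist_comm]; exact hxy
  cases p with
  | nil => simp at hp
  | @cons _ v _ ha p =>
    rw [SimpleGraph.Walk.length_cons] at hp
    have h1 : N.d v x ≤ p.length := SimpleGraph.dist_le p
    have h2 : N.d v y = 1 := SimpleGraph.dist_eq_one_iff_adj.2 ha.symm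
    have h3 := h.d_triangle x v y
    rw [d_comm v x] at h1
    exact ⟨v, by omega, h2⟩

theorem d_ne_zero (hxy : x ≠ y) : N.d x y ≠ 0 := fun e => hxy (h.d_eq_zero_iff.1 e)

/-- If `x` is joined to two points of a line then it is the third point. -/
theorem triple_of_d_eq_one (h1 : N.d x p = 1) (h2 : N.d x q = 1)
    (h3 : N.d p q = 1) : N.Triple p q x := by
  obtain ⟨r, hr⟩ := h.exists_triple h3
  have h4 : N.d x r = 0 := by rcases h.d_triple hr x with h5 | h5 | h5 <;> omega
  rwa [h.d_eq_zero_iff.1 h4]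

/-- The three lines of a point. -/
theorem exists_lines (x : P) : ∃ a a' b b' c c', N.Triple x a a' ∧ N.Triple x b b' ∧
    N.Triple x c c' ∧ N.d a b = 2 ∧ N.d a b' = 2 ∧ N.d a' b = 2 ∧ N.d a' b' = 2 ∧ N.d a c = 2 ∧
    N.d a c' = 2 ∧ N.d a' c = 2 ∧ N.d a' c' = 2 ∧ N.d b c = 2 ∧ N.d b c' = 2 ∧ N.d b' c = 2 ∧
    N.d b' c' = 2 ∧
    ∀ z, N.d x z = 1 → z = a ∨ z = a' ∨ z = b ∨ z = b' ∨ z = c ∨ z = c' := by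
  obtain ⟨l, m, n, hlm, hln, hmn, hset⟩ := Set.ncard_eq_three.1 (h.order.2 x)
  have hmem : ∀ k, N.Inc x k ↔ k = l ∨ k = m ∨ k = n := fun k => by
    have : k ∈ {l | N.Inc x l} ↔ k ∈ ({l, m, n} : Set L) := by rw [hset]
    simpa using this
  have key : ∀ k, N.Inc x k → ∃ a a', N.Triple x a a' ∧ N.Inc a k ∧ N.Inc a' k := by
    intro k hk
    obtain ⟨p, q, hpq, hp, hq⟩ := h.nearHexagon.partialLinear.1 k
    obtain ⟨a, hxa, ha⟩ : ∃ a, x ≠ a ∧ N.Inc a k := by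
      by_cases e : x = p
      · exact ⟨q, e ▸ hpq, hq⟩
      · exact ⟨p, e, hp⟩
    obtain ⟨r, hr, hr'⟩ := h.exists_triple_of_inc hxa hk ha
    exact ⟨a, r, hr, ha, hr'⟩
  have hl := (hmem l).2 (by simp)
  have hm := (hmem m).2 (by simp)
  have hn := (hmem n).2 (by simp)
  obtain ⟨a, a', hA, ha, ha'⟩ := key l hl
  obtain ⟨b, b', hB, hb, hb'⟩ := key m hm
  obtain ⟨c, c', hC, hc, hc'⟩ := key n hn
  -- Points on different lines through `x` are not collinear: three mutually collinear points are on
  -- one line.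
  have far : ∀ {k k'} {u v : P}, k ≠ k' → N.Inc x k → N.Inc x k' → N.Inc u k → N.Inc v k' →
      x ≠ u → x ≠ v → N.d u v = 2 := by
    intro k k' u v hkk hk hk' hu hv hxu hxv
    have h1 : N.d x u = 1 := SimpleGraph.dist_eq_one_iff_adj.2 ⟨hxu, k, hk, hu⟩
    have h2 : N.d x v = 1 := SimpleGraph.dist_eq_one_iff_adj.2 ⟨hxv, k', hk', hv⟩
    have h3 := h.d_triangle u x v
    rw [d_comm u x] at h3
    have h4 : N.d u v ≠ 0 := fun e => by
      rw [h.d_eq_zero_iff] at e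
      subst e
      exact hkk (h.eq_of_inc hxu hk hu hk' hv)
    have h5 : N.d u v ≠ 1 := fun e => by
      obtain ⟨-, -, -, j, hxj, hvj, huj⟩ := h.triple_of_d_eq_one (x := u)
        (by rw [d_comm, h1]) e h2
      exact hkk ((h.eq_of_inc hxu hk hu hxj huj).trans (h.eq_of_inc hxv hxj hvj hk' hv))
    omega
  refine ⟨a, a', b, b', c, c', hA, hB, hC, far hlm hl hm ha hb hA.1 hB.1,
    far hlm hl hm ha hb' hA.1 hB.2.1, far hlm hl hm ha' hb hA.2.1 hB.1,
    far hlm hl hm ha' hb' hA.2.1 hB.2.1, far hln hl hn ha hc hA.1 hC.1,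
    far hln hl hn ha hc' hA.1 hC.2.1, far hln hl hn ha' hc hA.2.1 hC.1,
    far hln hl hn ha' hc' hA.2.1 hC.2.1, far hmn hm hn hb hc hB.1 hC.1,
    far hmn hm hn hb hc' hB.1 hC.2.1, far hmn hm hn hb' hc hB.2.1 hC.1,
    far hmn hm hn hb' hc' hB.2.1 hC.2.1, fun z hz => ?_⟩
  obtain ⟨hxz, k, hk, hz⟩ := SimpleGraph.dist_eq_one_iff_adj.1 hz
  rcases (hmem k).1 hk with rfl | rfl | rfl
  · rcases h.eq_of_inc_of_triple hA.1 hA.2.1 hA.2.2.1 hl ha ha' hz with e | e | e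
    · exact absurd e.symm hxz
    · simp [e]
    · simp [e]
  · rcases h.eq_of_inc_of_triple hB.1 hB.2.1 hB.2.2.1 hm hb hb' hz with e | e | e
    · exact absurd e.symm hxz
    · simp [e]
    · simp [e]
  · rcases h.eq_of_inc_of_triple hC.1 hC.2.1 hC.2.2.1 hn hc hc' hz with e | e | e
    · exact absurd e.symm hxz
    · simp [e]
    · simp [e]

/-- Every neighbour of `x` is on one of three given lines. -/
theorem eq_of_d_eq_one {a a' b b' c c' : P} (hA : N.Triple x a a') (hB : N.Triple x b b')
    (hC : N.Triple x c c') (hab : N.d a b = 2) (hac : N.d a c = 2) (hbc : N.d b c = 2)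
    (hz : N.d x z = 1) : z = a ∨ z = a' ∨ z = b ∨ z = b' ∨ z = c ∨ z = c' := by
  obtain ⟨a₁, a₁', b₁, b₁', c₁, c₁', hA₁, hB₁, hC₁, -, -, -, -, -, -, -, -, -, -, -, -, hall⟩ :=
    h.exists_lines x
  have pick : ∀ {u u'}, N.Triple x u u' →
      (∀ v, (v = u ∨ v = u') ↔ (v = a₁ ∨ v = a₁')) ∨ (∀ v, (v = u ∨ v = u') ↔ (v = b₁ ∨ v = b₁')) ∨
        (∀ v, (v = u ∨ v = u') ↔ (v = c₁ ∨ v = c₁')) := by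
    intro u u' hU
    rcases hall u hU.dist_eq_one with rfl | rfl | rfl | rfl | rfl | rfl
    · obtain rfl := h.triple_unique hU hA₁
      exact Or.inl fun v => Iff.rfl
    · obtain rfl := h.triple_unique hU hA₁.swap'
      exact Or.inl fun v => or_comm
    · obtain rfl := h.triple_unique hU hB₁
      exact Or.inr (Or.inl fun v => Iff.rfl)
    · obtain rfl := h.triple_unique hU hB₁.swap'
      exact Or.inr (Or.inl fun v => or_comm)
    · obtain rfl := h.triple_unique hU hC₁
      exact Or.inr (Or.inr fun v => Iff.rfl)
    · obtain rfl := h.triple_unique hU hC₁.swap'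
      exact Or.inr (Or.inr fun v => or_comm)
  have sep : ∀ {u u' v v'} {s s' : P}, N.Triple x u u' → N.Triple x v v' → N.d u v = 2 →
      (∀ w, (w = u ∨ w = u') ↔ (w = s ∨ w = s')) → (∀ w, (w = v ∨ w = v') ↔ (w = s ∨ w = s')) →
      False := by
    intro u u' v v' s s' hU hV huv h1 h2
    have h3 := (h1 v).2 ((h2 v).1 (Or.inl rfl))
    rcases h3 with rfl | rfl
    · rw [h.d_eq_zero_iff.2 rfl] at huv
      omega
    · rw [hU.rotate.dist_eq_one] at huv
      omega
  have hz : (z = a₁ ∨ z = a₁') ∨ (z = b₁ ∨ z = b₁') ∨ (z = c₁ ∨ z = c₁') := by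
    simpa only [or_assoc] using hall z hz
  suffices (z = a ∨ z = a') ∨ (z = b ∨ z = b') ∨ (z = c ∨ z = c') by
    simpa only [or_assoc] using this
  rcases pick hA with h1 | h1 | h1 <;> rcases pick hB with h2 | h2 | h2 <;>
    rcases pick hC with h3 | h3 | h3 <;>
    first
    | exact (sep hA hB hab h1 h2).elim
    | exact (sep hA hC hac h1 h3).elim
    | exact (sep hB hC hbc h2 h3).elim
    | (rw [← h1, ← h2, ← h3] at hz
       rcases hz with e | e | e
       all_goals first
         | exact Or.inl e
         | exact Or.inr (Or.inl e)
         | exact Or.inr (Or.inr e))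

end IsNearHexagonTwo

end PointLineGeometry

/-! ### Grids, and exclusion of three common neighbours -/

namespace PointLineGeometry

universe u₆ v₆

variable {P : Type u₆} {L : Type v₆}

/-- A `3 × 3` grid. -/
structure Grid (N : PointLineGeometry P L) (x a p b y r s q m : P) : Prop where
  row₁ : N.Triple x a p
  row₂ : N.Triple b y r
  row₃ : N.Triple s q m
  col₁ : N.Triple x b s
  col₂ : N.Triple a y q
  col₃ : N.Triple p r m
  xy : N.d x y = 2
  xr : N.d x r = 2
  xq : N.d x q = 2
  xm : N.d x m = 2
  ab : N.d a b = 2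
  ar : N.d a r = 2
  as : N.d a s = 2
  am : N.d a m = 2
  pb : N.d p b = 2
  py : N.d p y = 2
  ps : N.d p s = 2
  pq : N.d p q = 2
  bq : N.d b q = 2
  bm : N.d b m = 2
  ys : N.d y s = 2
  ym : N.d y m = 2
  rs : N.d r s = 2
  rq : N.d r q = 2

/-- `a`, `b`, `c` are three common neighbours of `x` and `y`. -/
structure Full (N : PointLineGeometry P L) (x y a b c : P) : Prop where
  xy : N.d x y = 2
  ab : N.d a b = 2
  ac : N.d a c = 2
  bc : N.d b c = 2
  xa : N.d x a = 1
  xb : N.d x b = 1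
  xc : N.d x c = 1
  ya : N.d y a = 1
  yb : N.d y b = 1
  yc : N.d y c = 1

namespace IsNearHexagonTwo

variable {N : PointLineGeometry P L} (h : N.IsNearHexagonTwo) {a b c p q r s t x y z m w : P}
include h

/-- Two common neighbours of two points at distance two are at distance two. -/
theorem d_eq_two_of_common (hxy : N.d x y = 2) (hab : a ≠ b) (hxa : N.d x a = 1) (hxb : N.d x b = 1)
    (hya : N.d y a = 1) (hyb : N.d y b = 1) : N.d a b = 2 := by
  have h1 := h.d_triangle a x b
  have h2 := h.d_ne_zero hab
  rw [d_comm a x] at h1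
  have h3 : N.d a b ≠ 1 := fun e => by
    rw [h.triple_unique (h.triple_of_d_eq_one hxa hxb e) (h.triple_of_d_eq_one hya hyb e),
      h.d_eq_zero_iff.2 rfl] at hxy
    omega
  omega

theorem d_third (hT : N.Triple p q r) {k : ℕ} (h1 : N.d x p = k) (h2 : N.d x q = k + 1) :
    N.d x r = k + 1 := by
  rcases h.d_triple hT x with h3 | h3 | h3 <;> omega

/-- A point at distance two from two points of a line must be at distance one from the third, by the
pattern k, k+1, k+1. This makes `p` and `r`, then `q` and `s` collinear, and applies again to the
third point `m` of the line on `p` and `r`. -/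
theorem exists_grid (hxy : N.d x y = 2) (hab : a ≠ b) (h1 : N.Triple x a p)
    (h2 : N.Triple a y q) (h3 : N.Triple b y r) (h4 : N.Triple x b s) :
    ∃ m, N.Grid x a p b y r s q m := by
  have xa := h1.dist_eq_one
  have xb := h4.dist_eq_one
  have ya := h2.swap.dist_eq_one
  have yb := h3.swap.dist_eq_one
  have ab := h.d_eq_two_of_common hxy hab xa xb ya yb
  have yx : N.d y x = 2 := by rw [d_comm, hxy]
  have ba : N.d b a = 2 := by rw [d_comm, ab]
  have ax : N.d a x = 1 := by rw [d_comm, xa]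
  have bx : N.d b x = 1 := by rw [d_comm, xb]
  have ay : N.d a y = 1 := by rw [d_comm, ya]
  have by' : N.d b y = 1 := by rw [d_comm, yb]
  have pb : N.d p b = 2 := by rw [d_comm]; exact h.d_third h1 bx ba
  have py : N.d p y = 2 := by rw [d_comm]; exact h.d_third h1.swap ya yx
  have xq : N.d x q = 2 := h.d_third h2 xa hxy
  have bq : N.d b q = 2 := h.d_third h2.swap by' ba
  have xr : N.d x r = 2 := h.d_third h3 xb hxy
  have ar : N.d a r = 2 := h.d_third h3.swap ay ab
  have as' : N.d a s = 2 := h.d_third h4 ax ab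
  have ys : N.d y s = 2 := h.d_third h4.swap yb yx
  have pr : N.d p r = 1 := by
    rcases h.d_triple h3 p with h5 | h5 | h5 <;> omega
  have qs : N.d q s = 1 := by
    have qx : N.d q x = 2 := by rw [d_comm, xq]
    have qb : N.d q b = 2 := by rw [d_comm, bq]
    rcases h.d_triple h4 q with h5 | h5 | h5 <;> omega
  have pq : N.d p q = 2 := h.d_third h2 h1.rotate.rotate.swap'.dist_eq_one py
  have ps : N.d p s = 2 := h.d_third h4 h1.rotate.rotate.dist_eq_one pb
  have qr : N.d q r = 2 := h.d_third h3.swap h2.rotate.rotate.swap'.dist_eq_one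
    (by rw [d_comm, bq])
  have rs : N.d r s = 2 := h.d_third h4.swap h3.rotate.rotate.dist_eq_one (by rw [d_comm, xr])
  obtain ⟨m, hm⟩ := h.exists_triple pr
  have qm : N.d q m = 1 := by
    have qp : N.d q p = 2 := by rw [d_comm, pq]
    rcases h.d_triple hm q with h5 | h5 | h5 <;> omega
  have sm : N.d s m = 1 := by
    have sp : N.d s p = 2 := by rw [d_comm, ps]
    have sr : N.d s r = 2 := by rw [d_comm, rs]
    rcases h.d_triple hm s with h5 | h5 | h5 <;> omega
  have h6 := h.triple_of_d_eq_one (x := m) (by rw [d_comm, sm]) (by rw [d_comm, qm])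
    (by rw [d_comm, qs])
  exact ⟨m, h1, h3, h6, h4, h2, hm, hxy, xr, xq,
    h.d_third hm h1.swap'.dist_eq_one xr, ab, ar, as',
    h.d_third hm h1.swap'.rotate.rotate.swap'.dist_eq_one ar, pb, py, ps, pq, bq,
    h.d_third hm.swap h3.swap'.dist_eq_one (by rw [d_comm, pb]), ys,
    h.d_third hm.swap h3.rotate.dist_eq_one (by rw [d_comm, py]), rs, by rw [d_comm, qr]⟩

theorem full_of_ne (hxy : N.d x y = 2) (hab : a ≠ b) (hac : a ≠ c) (hbc : b ≠ c)
    (hxa : N.d x a = 1) (hxb : N.d x b = 1) (hxc : N.d x c = 1) (hya : N.d y a = 1)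
    (hyb : N.d y b = 1) (hyc : N.d y c = 1) : N.Full x y a b c :=
  ⟨hxy, h.d_eq_two_of_common hxy hab hxa hxb hya hyb, h.d_eq_two_of_common hxy hac hxa hxc hya hyc,
    h.d_eq_two_of_common hxy hbc hxb hxc hyb hyc, hxa, hxb, hxc, hya, hyb, hyc⟩

omit h in
theorem ne_of_d_eq_two (e : N.d x y = 2) : x ≠ y := by
  rintro rfl
  have : N.d x x = 0 := SimpleGraph.dist_self
  omega

end IsNearHexagonTwo

namespace Full

variable {N : PointLineGeometry P L} (h : N.IsNearHexagonTwo) {a b c p q r s t x y z m w : P}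

theorem rotate (hF : N.Full x y a b c) : N.Full x y b c a :=
  ⟨hF.xy, hF.bc, by rw [IsNearHexagonTwo.d_comm, hF.ab], by rw [IsNearHexagonTwo.d_comm, hF.ac],
    hF.xb, hF.xc, hF.xa, hF.yb, hF.yc, hF.ya⟩

theorem symm (hF : N.Full x y a b c) : N.Full y x a b c :=
  ⟨by rw [IsNearHexagonTwo.d_comm, hF.xy], hF.ab, hF.ac, hF.bc, hF.ya, hF.yb, hF.yc, hF.xa, hF.xb,
    hF.xc⟩

include h

/-- The grids generated by `x, a, y, b` and by `x, a, y, c` share the line on `a` and `y`. Its third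
point `q` is collinear with `s` in the first grid and with `t` in the second. -/
theorem step (hF : N.Full x y a b c) (hb : N.Triple x b s) (hc : N.Triple x c t)
    (hq : N.Triple a y q) : N.Full x q a s t := by
  obtain ⟨p, hp⟩ := h.exists_triple hF.xa
  obtain ⟨r, hr⟩ := h.exists_triple hF.rotate.symm.xa
  obtain ⟨r', hr'⟩ := h.exists_triple hF.rotate.rotate.symm.xa
  obtain ⟨m, G⟩ := h.exists_grid hF.xy (IsNearHexagonTwo.ne_of_d_eq_two hF.ab) hp hq hr.swap hb
  obtain ⟨m', G'⟩ := h.exists_grid hF.xy (IsNearHexagonTwo.ne_of_d_eq_two hF.ac) hp hq hr'.swap hc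
  refine h.full_of_ne G.xq (IsNearHexagonTwo.ne_of_d_eq_two G.as)
    (IsNearHexagonTwo.ne_of_d_eq_two G'.as) (fun e => ?_) hF.xa hb.swap'.dist_eq_one
    hc.swap'.dist_eq_one hq.rotate.rotate.dist_eq_one G.row₃.swap.dist_eq_one
    G'.row₃.swap.dist_eq_one
  subst e
  exact IsNearHexagonTwo.ne_of_d_eq_two hF.bc (h.triple_unique hb.swap' hc.swap')

/-- A neighbour of a full point is a neighbour of `x` or full. -/
theorem neighbour (hF : N.Full x y a b c) (hz : N.d y z = 1) :
    N.d x z = 1 ∨ ∃ a b c, N.Full x z a b c := by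
  obtain ⟨p, hp⟩ := h.exists_triple hF.xa
  obtain ⟨s, hs⟩ := h.exists_triple hF.xb
  obtain ⟨t, ht⟩ := h.exists_triple hF.xc
  obtain ⟨q, hq⟩ := h.exists_triple hF.ya
  obtain ⟨r, hr⟩ := h.exists_triple hF.yb
  obtain ⟨f, hf⟩ := h.exists_triple hF.yc
  rcases h.eq_of_d_eq_one hq hr hf hF.ab hF.ac hF.bc hz with rfl | rfl | rfl | rfl | rfl | rfl
  · exact Or.inl hF.xa
  · exact Or.inr ⟨_, _, _, hF.step h hs ht hq.swap⟩
  · exact Or.inl hF.xb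
  · exact Or.inr ⟨_, _, _, hF.rotate.step h ht hp hr.swap⟩
  · exact Or.inl hF.xc
  · exact Or.inr ⟨_, _, _, hF.rotate.rotate.step h hp hs hf.swap⟩

/-- Every neighbour of `y` is a neighbour of `x` or has again three common neighbours with `x`. Two
steps from `y` therefore never lead beyond distance two from `x`. -/
theorem d_eq_three (hF : N.Full x y a b c) (hw : N.d x w = 3) : N.d w y = 3 := by
  have key : ∀ {u v}, (N.d x u = 1 ∨ ∃ a b c, N.Full x u a b c) → N.d u v = 1 → N.d x v ≤ 2 := by
    rintro u v (hu | ⟨a, b, c, hu⟩) huv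
    · have := h.d_triangle x u v
      omega
    · rcases hu.neighbour h huv with e | ⟨_, _, _, e⟩
      · omega
      · exact e.xy.le
  have h3 := h.d_le_three w y
  have h0 : N.d y w ≠ 0 := fun e => by
    rw [h.d_eq_zero_iff] at e
    subst e
    have := hF.xy
    omega
  have h1 : N.d y w ≠ 1 := fun e => by
    have := key (Or.inr ⟨_, _, _, hF⟩) e
    omega
  have h2 : N.d y w ≠ 2 := fun e => by
    obtain ⟨z, hyz, hzw⟩ := h.exists_between e
    have := key (hF.neighbour h hyz) hzw
    omega
  rw [IsNearHexagonTwo.d_comm] at h3 ⊢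
  omega

/-- The other two points `y` and `q` of a line on `a` are both at distance three from `w`. -/
theorem d_eq_two (hF : N.Full x y a b c) (hw : N.d x w = 3) : N.d w a = 2 := by
  obtain ⟨s, hs⟩ := h.exists_triple hF.xb
  obtain ⟨t, ht⟩ := h.exists_triple hF.xc
  obtain ⟨q, hq⟩ := h.exists_triple hF.ya
  have h1 := hF.d_eq_three h hw
  have h2 := (hF.step h hs ht hq.swap).d_eq_three h hw
  rcases h.d_triple hq w with h3 | h3 | h3 <;> omega

/-- The three full points of a grid. -/
theorem exists_full (hF : N.Full x y a b c) : ∃ p s t q m f, N.Triple x a p ∧ N.Triple x b s ∧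
    N.Triple x c t ∧ N.Full x q a s t ∧ N.Full x m s p c ∧ N.Full x f c b a ∧ f ≠ y := by
  obtain ⟨p, hp⟩ := h.exists_triple hF.xa
  obtain ⟨s, hs⟩ := h.exists_triple hF.xb
  obtain ⟨t, ht⟩ := h.exists_triple hF.xc
  obtain ⟨q, hq⟩ := h.exists_triple hF.ya
  obtain ⟨r, hr⟩ := h.exists_triple hF.yb
  obtain ⟨m, G⟩ := h.exists_grid hF.xy (IsNearHexagonTwo.ne_of_d_eq_two hF.ab) hp hq.swap
    hr.swap hs
  have h1 := hF.step h hs ht hq.swap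
  have h2 : N.Full x m s p c := by
    have := h1.rotate.step h ht.swap' hp G.row₃
    exact ⟨this.xy, this.ac, this.ab, by rw [IsNearHexagonTwo.d_comm, this.bc], this.xa, this.xc,
      this.xb, this.ya, this.yc, this.yb⟩
  obtain ⟨f, hf⟩ := h.exists_triple h2.rotate.rotate.ya
  refine ⟨p, s, t, q, m, f, hp, hs, ht, h1, h2,
    h2.rotate.rotate.step h hs.swap' hp.swap' hf.swap, ?_⟩
  rintro rfl
  have := hf.rotate.rotate.dist_eq_one
  have := G.ym
  omega

/-- From a point `w` at distance three from `x`, both other points of the line on `x` and `a` would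
be at distance two, against the pattern k, k+1, k+1. -/
theorem d_le_two (hF : N.Full x y a b c) (w : P) : N.d x w ≤ 2 := by
  by_contra hlt
  have hw : N.d x w = 3 := by
    have := h.d_le_three x w
    omega
  obtain ⟨p, s, t, q, m, f, hp, hs, ht, -, h2, -, -⟩ := hF.exists_full h
  have h3 := hF.d_eq_two h hw
  have h4 := h2.rotate.d_eq_two h hw
  rw [IsNearHexagonTwo.d_comm] at hw
  rcases h.d_triple hp w with h3 | h3 | h3 <;> omega

/-- The points `a` and `b` have the common neighbours `x`, `y` and `f`, so the property passes from
`x` to its neighbour `a`. -/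
theorem exists_full_left (hF : N.Full x y a b c) : ∃ z u v w, N.Full a z u v w := by
  obtain ⟨p, s, t, q, m, f, -, -, -, -, -, h3, hne⟩ := hF.exists_full h
  refine ⟨b, x, y, f, h.full_of_ne hF.ab (IsNearHexagonTwo.ne_of_d_eq_two hF.xy)
    (IsNearHexagonTwo.ne_of_d_eq_two h3.xy) hne.symm ?_ ?_ ?_ ?_ ?_ ?_⟩ <;>
    rw [IsNearHexagonTwo.d_comm]
  exacts [hF.xa, hF.ya, h3.yc, hF.xb, hF.yb, h3.yb]

theorem exists_full_of_adj (hF : N.Full x y a b c) (hz : N.d x z = 1) :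
    ∃ y a b c, N.Full z y a b c := by
  obtain ⟨p, s, t, q, m, f, hp, hs, ht, h1, h2, -, -⟩ := hF.exists_full h
  rcases h.eq_of_d_eq_one hp hs ht hF.ab hF.ac hF.bc hz with rfl | rfl | rfl | rfl | rfl | rfl
  · exact hF.exists_full_left h
  · exact h2.rotate.exists_full_left h
  · exact hF.rotate.exists_full_left h
  · exact h2.exists_full_left h
  · exact hF.rotate.rotate.exists_full_left h
  · exact h1.rotate.rotate.exists_full_left h

/-- No two points at distance two have three common neighbours. -/
theorem false (hF : N.Full x y a b c) : False := by
  -- By connectivity the property spreads from `x` to all points, so that all distances are at most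
  -- two, contrary to the diameter.
  have hall : ∀ (n : ℕ) (z : P), N.d x z = n → ∃ y a b c, N.Full z y a b c := by
    intro n
    induction n with
    | zero =>
      intro z hz
      rw [h.d_eq_zero_iff] at hz
      subst hz
      exact ⟨_, _, _, _, hF⟩
    | succ n ih =>
      intro z hz
      obtain ⟨u, hu, huz⟩ := h.exists_between hz
      obtain ⟨_, _, _, _, hu⟩ := ih u hu
      exact hu.exists_full_of_adj h huz
  obtain ⟨u, v, huv⟩ := h.exists_two_lt_d
  obtain ⟨_, _, _, _, hu⟩ := hall _ u rfl
  have := hu.d_le_two h v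
  omega

end Full

namespace IsNearHexagonTwo

variable {N : PointLineGeometry P L} (h : N.IsNearHexagonTwo) {a b c p q r s t x y z m w : P}
include h

theorem eq_or_eq_of_common (hxy : N.d x y = 2) (hab : a ≠ b) (hxa : N.d x a = 1)
    (hxb : N.d x b = 1) (hxc : N.d x c = 1) (hya : N.d y a = 1) (hyb : N.d y b = 1)
    (hyc : N.d y c = 1) : c = a ∨ c = b := by
  by_contra! hc
  exact (h.full_of_ne hxy hab hc.1.symm hc.2.symm hxa hxb hxc hya hyb hyc).false h

end IsNearHexagonTwo

end PointLineGeometry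

/-! ### Counting points by their distance from a given point -/

namespace PointLineGeometry

universe u₇ v₇

variable {P : Type u₇} {L : Type v₇}

/-- Points at distance two with two common neighbours. -/
def Cross (N : PointLineGeometry P L) (x y : P) : Prop :=
  N.d x y = 2 ∧ ∃ a b, a ≠ b ∧ N.d x a = 1 ∧ N.d x b = 1 ∧ N.d y a = 1 ∧ N.d y b = 1

open Classical in
/-- The points at distance `k` from `x`. -/
noncomputable def sphere [Fintype P] (N : PointLineGeometry P L) (x : P) (k : ℕ) : Finset P :=
  {y | N.d x y = k}

open Classical in
/-- The neighbours of `u` that are at distance `k` from `x`. -/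
noncomputable def nbrs [Fintype P] (N : PointLineGeometry P L) (x u : P) (k : ℕ) : Finset P :=
  {z | N.d u z = 1 ∧ N.d x z = k}

namespace IsNearHexagonTwo

variable {N : PointLineGeometry P L} (h : N.IsNearHexagonTwo) {a b c p q r s t x y z m w : P}
include h

theorem finite : Finite P := by
  obtain ⟨x⟩ := h.connected.nonempty
  have key : ∀ n, {z | N.d x z ≤ n}.Finite := by
    intro n
    induction n with
    | zero =>
      refine (Set.finite_singleton x).subset fun z hz => ?_
      exact (h.d_eq_zero_iff.1 (Nat.le_zero.1 hz)).symm
    | succ n ih =>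
      have h1 : ∀ u, {z | N.d u z = 1}.Finite := fun u => by
        obtain ⟨a, a', b, b', c, c', -, -, -, -, -, -, -, -, -, -, -, -, -, -, -, hall⟩ :=
          h.exists_lines u
        exact (Set.toFinite {a, a', b, b', c, c'}).subset hall
      refine (ih.union (ih.biUnion fun u _ => h1 u)).subset fun z hz => ?_
      rcases Nat.lt_or_eq_of_le hz with hz | hz
      · exact Or.inl (Nat.lt_succ_iff.1 hz)
      · obtain ⟨u, hu, huz⟩ := h.exists_between hz
        exact Or.inr (Set.mem_biUnion (x := u) hu.le huz)
  exact Set.finite_univ_iff.1 ((key 3).subset fun z _ => h.d_le_three x z)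

variable [Fintype P]

omit h in
theorem mem_nbrs {k : ℕ} : z ∈ N.nbrs x w k ↔ N.d w z = 1 ∧ N.d x z = k := by
  simp [nbrs]

omit h in
theorem mem_sphere {k : ℕ} : z ∈ N.sphere x k ↔ N.d x z = k := by
  simp [sphere]

/-- Besides `u`, each of the three lines on `u` has either one nearer point and one at the same
distance as `u`, or two farther points. Each line thus contributes two. -/
theorem two_mul_card_nbrs_add (x u : P) (k : ℕ) (hu : N.d x u = k + 1) :
    2 * (N.nbrs x u k).card + (N.nbrs x u (k + 2)).card = 6 := by
  classical
  obtain ⟨a, a', b, b', c, c', hA, hB, hC, h1, h2, h3, h4, h5, h6, h7, h8, h9, h10, h11, h12,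
    hall⟩ := h.exists_lines u
  have e : ∀ j, (N.nbrs x u j).card = ∑ z ∈ {a, a', b, b', c, c'}, if N.d x z = j then 1 else 0 := by
    intro j
    rw [← Finset.card_filter]
    congr 1
    ext z
    simp only [mem_nbrs, Finset.mem_filter, Finset.mem_insert, Finset.mem_singleton]
    refine and_congr_left fun _ => ⟨hall z, ?_⟩
    rintro (rfl | rfl | rfl | rfl | rfl | rfl)
    exacts [hA.dist_eq_one, hA.swap'.dist_eq_one, hB.dist_eq_one, hB.swap'.dist_eq_one,
      hC.dist_eq_one, hC.swap'.dist_eq_one]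
  have hs : ∀ f : P → ℕ, ∑ z ∈ {a, a', b, b', c, c'}, f z =
      (f a + f a') + ((f b + f b') + (f c + f c')) := by
    intro f
    have ne := fun {x y : P} (e : N.d x y = 2) => ne_of_d_eq_two e
    rw [Finset.sum_insert, Finset.sum_insert, Finset.sum_insert, Finset.sum_insert,
      Finset.sum_insert, Finset.sum_singleton]
    · ring
    all_goals simp only [Finset.mem_insert, Finset.mem_singleton, not_or]
    exacts [hC.2.2.1, ⟨ne h11, ne h12⟩, ⟨hB.2.2.1, ne h9, ne h10⟩, ⟨ne h3, ne h4, ne h7, ne h8⟩,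
      ⟨hA.2.2.1, ne h1, ne h2, ne h5, ne h6⟩]
  have key : ∀ {v v'}, N.Triple u v v' → 2 * ((if N.d x v = k then 1 else 0) +
      (if N.d x v' = k then 1 else 0)) + ((if N.d x v = k + 2 then 1 else 0) +
      (if N.d x v' = k + 2 then 1 else 0)) = 2 := by
    intro v v' hT
    rcases h.d_triple hT x with ⟨e1, e2⟩ | ⟨e1, e2⟩ | ⟨e1, e2⟩
    · have e1 : N.d x v = k + 2 := by omega
      have e2 : N.d x v' = k + 2 := by omega
      simp [e1, e2]
    · have e1 : N.d x v = k := by omega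
      have e2 : N.d x v' = k + 1 := by omega
      simp [e1, e2]
    · have e1 : N.d x v' = k := by omega
      have e2 : N.d x v = k + 1 := by omega
      simp [e1, e2]
  rw [e, e, hs, hs]
  have k1 := key hA
  have k2 := key hB
  have k3 := key hC
  omega

theorem card_nbrs_self (x : P) : (N.nbrs x x 1).card = 6 := by
  classical
  obtain ⟨a, a', b, b', c, c', hA, hB, hC, h1, h2, h3, h4, h5, h6, h7, h8, h9, h10, h11, h12,
    hall⟩ := h.exists_lines x
  have ne := fun {x y : P} (e : N.d x y = 2) => ne_of_d_eq_two e
  have e : N.nbrs x x 1 = {a, a', b, b', c, c'} := by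
    ext z
    simp only [mem_nbrs, and_self, Finset.mem_insert, Finset.mem_singleton]
    refine ⟨hall z, ?_⟩
    rintro (rfl | rfl | rfl | rfl | rfl | rfl)
    exacts [hA.dist_eq_one, hA.swap'.dist_eq_one, hB.dist_eq_one, hB.swap'.dist_eq_one,
      hC.dist_eq_one, hC.swap'.dist_eq_one]
  rw [e, Finset.card_insert_of_notMem, Finset.card_insert_of_notMem, Finset.card_insert_of_notMem,
    Finset.card_insert_of_notMem, Finset.card_insert_of_notMem, Finset.card_singleton]
  all_goals simp only [Finset.mem_insert, Finset.mem_singleton, not_or]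
  exacts [hC.2.2.1, ⟨ne h11, ne h12⟩, ⟨hB.2.2.1, ne h9, ne h10⟩, ⟨ne h3, ne h4, ne h7, ne h8⟩,
      ⟨hA.2.2.1, ne h1, ne h2, ne h5, ne h6⟩]

omit h in
theorem sum_card_nbrs (x : P) (k l : ℕ) :
    ∑ u ∈ N.sphere x k, (N.nbrs x u l).card = ∑ z ∈ N.sphere x l, (N.nbrs x z k).card := by
  classical
  have := Finset.sum_card_bipartiteAbove_eq_sum_card_bipartiteBelow (s := N.sphere x k)
    (t := N.sphere x l) (fun u z => N.d u z = 1)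
  convert this using 3 with u hu u hu
  · ext z
    simp [Finset.bipartiteAbove, mem_nbrs, mem_sphere, and_comm]
  · ext z
    simp [Finset.bipartiteBelow, mem_nbrs, mem_sphere, and_comm, d_comm u z]

theorem card_sphere_one (x : P) : (N.sphere x 1).card = 6 := by
  rw [← h.card_nbrs_self x]
  congr 1
  ext z
  simp [mem_sphere, mem_nbrs]

theorem sphere_zero (x : P) : N.sphere x 0 = {x} := by
  ext z
  simp [mem_sphere, h.d_eq_zero_iff, eq_comm]

theorem card_nbrs_zero (hy : N.d x y = 1) : (N.nbrs x y 0).card = 1 := by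
  refine Finset.card_eq_one.2 ⟨x, ?_⟩
  ext z
  simp only [mem_nbrs, h.d_eq_zero_iff, Finset.mem_singleton]
  refine ⟨fun e => e.2.symm, ?_⟩
  rintro rfl
  exact ⟨by rw [d_comm, hy], rfl⟩

/-- Each of the six neighbours of `x` has four neighbours at distance two from `x`. -/
theorem sum_sphere_two (x : P) : ∑ u ∈ N.sphere x 2, (N.nbrs x u 1).card = 24 := by
  rw [sum_card_nbrs, Finset.sum_congr rfl (g := fun _ => 4) fun u hu => ?_, Finset.sum_const,
    h.card_sphere_one]
  · rfl
  · rw [mem_sphere] at hu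
    have := h.two_mul_card_nbrs_add x u 0 hu
    rw [h.card_nbrs_zero hu] at this
    change 2 * 1 + (N.nbrs x u 2).card = 6 at this
    omega

/-- The local count is summed over the points at distance two. A point at distance three has no
farther neighbours, hence exactly three neighbours at distance two. -/
theorem sum_sphere_two' (x : P) :
    48 + 3 * (N.sphere x 3).card = 6 * (N.sphere x 2).card := by
  have h1 : ∑ u ∈ N.sphere x 2, (2 * (N.nbrs x u 1).card + (N.nbrs x u 3).card) =
      ∑ u ∈ N.sphere x 2, 6 := Finset.sum_congr rfl fun u hu =>
    h.two_mul_card_nbrs_add x u 1 (mem_sphere.1 hu)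
  have h2 : ∑ u ∈ N.sphere x 3, (N.nbrs x u 2).card = ∑ u ∈ N.sphere x 3, 3 :=
    Finset.sum_congr rfl fun u hu => by
      have h3 := h.two_mul_card_nbrs_add x u 2 (mem_sphere.1 hu)
      have h4 : N.nbrs x u 4 = ∅ := Finset.eq_empty_of_forall_notMem fun z hz => by
        have := h.d_le_three x z
        have := (mem_nbrs.1 hz).2
        omega
      have h5 : (N.nbrs x u 4).card = 0 := by rw [h4, Finset.card_empty]
      simp only [Nat.reduceAdd] at h3
      omega
  rw [Finset.sum_add_distrib, ← Finset.mul_sum, h.sum_sphere_two, sum_card_nbrs, h2,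
    Finset.sum_const, Finset.sum_const, smul_eq_mul, smul_eq_mul] at h1
  omega

theorem card_eq_sphere (x : P) :
    Fintype.card P = 7 + (N.sphere x 2).card + (N.sphere x 3).card := by
  classical
  have := Finset.card_eq_sum_card_fiberwise (s := (Finset.univ : Finset P)) (t := Finset.range 4)
    (f := fun z => N.d x z) (fun z _ => by
      have := h.d_le_three x z
      simp only [Finset.coe_range, Set.mem_Iio]
      omega)
  rw [Finset.card_univ, Finset.sum_range_succ, Finset.sum_range_succ, Finset.sum_range_succ,
    Finset.sum_range_one] at this
  have e : ∀ k, (Finset.univ.filter fun z => N.d x z = k).card = (N.sphere x k).card := fun k => by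
    congr 1
  rw [e, e, e, e, h.card_sphere_one, h.sphere_zero, Finset.card_singleton] at this
  exact this

open Classical in
theorem card_nbrs_one (hxy : N.d x y = 2) :
    (N.nbrs x y 1).card = 1 + if N.Cross x y then 1 else 0 := by
  obtain ⟨a, hxa, hay⟩ := h.exists_between hxy
  rw [d_comm] at hay
  split_ifs with hc
  · obtain ⟨-, a, b, hab, h1, h2, h3, h4⟩ := hc
    refine Finset.card_eq_two.2 ⟨a, b, hab, ?_⟩
    ext z
    simp only [mem_nbrs, Finset.mem_insert, Finset.mem_singleton]
    refine ⟨fun hz => h.eq_or_eq_of_common hxy hab h1 h2 hz.2 h3 h4 hz.1, ?_⟩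
    rintro (rfl | rfl)
    exacts [⟨h3, h1⟩, ⟨h4, h2⟩]
  · refine Finset.card_eq_one.2 ⟨a, ?_⟩
    ext z
    simp only [mem_nbrs, Finset.mem_singleton]
    refine ⟨fun hz => ?_, ?_⟩
    · by_contra hne
      exact hc ⟨hxy, z, a, hne, hz.2, hxa, hz.1, hay⟩
    · rintro rfl
      exact ⟨hay, hxa⟩

open Classical in
/-- The number of points of the space, and of those with two common neighbours with `x`. -/
theorem card_cross (x : P) :
    (N.sphere x 2).card + (Finset.univ.filter fun y => N.Cross x y).card = 24 ∧
      Fintype.card P + 3 * (Finset.univ.filter fun y => N.Cross x y).card = 63 ∧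
        (Finset.univ.filter fun y => N.Cross x y).card ≤ (N.sphere x 2).card := by
  -- Let n₂ and n₃ be the sizes of the spheres and c the number of points with two common neighbours
  -- with `x`. Then n₂ + c = 24 and n₃ = 2n₂ - 16, so there are 7 + n₂ + n₃ = 63 - 3c points.
  have h1 := h.sum_sphere_two x
  rw [Finset.sum_congr rfl fun u hu => h.card_nbrs_one (mem_sphere.1 hu), Finset.sum_add_distrib,
    Finset.sum_const, ← Finset.card_filter] at h1
  have e : (N.sphere x 2).filter (fun y => N.Cross x y) = Finset.univ.filter fun y => N.Cross x y := by
    ext y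
    simp only [Finset.mem_filter, mem_sphere, Finset.mem_univ, true_and, and_iff_right_iff_imp]
    exact fun e => e.1
  have h2 := Finset.card_filter_le (N.sphere x 2) (fun y => N.Cross x y)
  rw [e] at h1 h2
  have h3 := h.sum_sphere_two' x
  have h4 := h.card_eq_sphere x
  simp only [smul_eq_mul, mul_one] at h1
  omega

end IsNearHexagonTwo

/-! ### Indexed grids and their uniqueness -/

/-- A `3 × 3` grid, with indices. -/
structure IsGrid (N : PointLineGeometry P L) (g : Fin 3 → Fin 3 → P) : Prop where
  row : ∀ i, N.Triple (g i 0) (g i 1) (g i 2)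
  col : ∀ j, N.Triple (g 0 j) (g 1 j) (g 2 j)
  far : ∀ i i' j j', i ≠ i' → j ≠ j' → N.d (g i j) (g i' j') = 2

namespace IsGrid

variable {N : PointLineGeometry P L} {g g' : Fin 3 → Fin 3 → P} {i i' j j' : Fin 3} {x y : P}

theorem rows (hg : N.IsGrid g) (i : Fin 3) {j k l : Fin 3} (h1 : j ≠ k) (h2 : j ≠ l) (h3 : k ≠ l) :
    N.Triple (g i j) (g i k) (g i l) := by
  have := hg.row i
  fin_cases j <;> fin_cases k <;> fin_cases l <;> first
    | exact absurd rfl h1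
    | exact absurd rfl h2
    | exact absurd rfl h3
    | exact this
    | exact this.rotate
    | exact this.rotate.rotate
    | exact this.swap
    | exact this.swap'
    | exact this.rotate.swap

theorem transpose (hg : N.IsGrid g) : N.IsGrid fun i j => g j i :=
  ⟨hg.col, hg.row, fun i i' j j' h1 h2 => hg.far j j' i i' h2 h1⟩

theorem cols (hg : N.IsGrid g) (j : Fin 3) {i k l : Fin 3} (h1 : i ≠ k) (h2 : i ≠ l) (h3 : k ≠ l) :
    N.Triple (g i j) (g k j) (g l j) := hg.transpose.rows j h1 h2 h3

theorem _root_.Fin.exists_third : ∀ j k : Fin 3, j ≠ k → ∃ l, j ≠ l ∧ k ≠ l := by decide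

theorem _root_.Fin.eq_or_eq_or_eq : ∀ j k l m : Fin 3, j ≠ k → j ≠ l → k ≠ l →
    m = j ∨ m = k ∨ m = l := by decide

theorem d_row (hg : N.IsGrid g) (h1 : j ≠ j') : N.d (g i j) (g i j') = 1 := by
  obtain ⟨l, h2, h3⟩ := Fin.exists_third j j' h1
  exact (hg.rows i h1 h2 h3).dist_eq_one

theorem d_col (hg : N.IsGrid g) (h1 : i ≠ i') : N.d (g i j) (g i' j) = 1 :=
  hg.transpose.d_row h1

theorem d_eq_two_iff (hg : N.IsGrid g) : N.d (g i j) (g i' j') = 2 ↔ i ≠ i' ∧ j ≠ j' := by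
  refine ⟨fun e => ?_, fun e => hg.far _ _ _ _ e.1 e.2⟩
  constructor
  · rintro rfl
    by_cases h1 : j = j'
    · subst h1
      exact IsNearHexagonTwo.ne_of_d_eq_two e rfl
    · rw [hg.d_row h1] at e
      omega
  · rintro rfl
    by_cases h1 : i = i'
    · subst h1
      exact IsNearHexagonTwo.ne_of_d_eq_two e rfl
    · rw [hg.d_col h1] at e
      omega

theorem injective (hg : N.IsGrid g) : Function.Injective fun k : Fin 3 × Fin 3 => g k.1 k.2 := by
  rintro ⟨i, j⟩ ⟨i', j'⟩ (e : g i j = g i' j')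
  have e0 : N.d (g i j) (g i' j') = 0 := by
    rw [e]
    exact SimpleGraph.dist_self
  by_cases h1 : i = i' <;> by_cases h2 : j = j'
  · rw [h1, h2]
  · subst h1
    rw [hg.d_row h2] at e0
    omega
  · subst h2
    rw [hg.d_col h1] at e0
    omega
  · rw [hg.far _ _ _ _ h1 h2] at e0
    omega

/-- Two rows and two columns meet in four points, which generate the grid by passing to third points
of lines. -/
theorem subset_of_closed (hg : N.IsGrid g) {S : P → Prop}
    (hS : ∀ {p q r}, N.Triple p q r → S p → S q → S r) (h1 : i ≠ i') (h2 : j ≠ j')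
    (s1 : S (g i j)) (s2 : S (g i j')) (s3 : S (g i' j)) (s4 : S (g i' j')) (k l : Fin 3) :
    S (g k l) := by
  obtain ⟨i'', hi, hi'⟩ := Fin.exists_third i i' h1
  obtain ⟨j'', hj, hj'⟩ := Fin.exists_third j j' h2
  have key : ∀ k, S (g k j) → S (g k j') → S (g k l) := fun k a b => by
    rcases Fin.eq_or_eq_or_eq j j' j'' l h2 hj hj' with rfl | rfl | rfl
    · exact a
    · exact b
    · exact hS (hg.rows k h2 hj hj') a b
  rcases Fin.eq_or_eq_or_eq i i' i'' k h1 hi hi' with rfl | rfl | rfl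
  · exact key _ s1 s2
  · exact key _ s3 s4
  · exact key _ (hS (hg.cols j h1 hi hi') s1 s3) (hS (hg.cols j' h1 hi hi') s2 s4)

theorem closed (h : N.IsNearHexagonTwo) (hg : N.IsGrid g) {p q r : P} (hT : N.Triple p q r)
    (hp : ∃ i j, g i j = p) (hq : ∃ i j, g i j = q) : ∃ i j, g i j = r := by
  obtain ⟨i, j, rfl⟩ := hp
  obtain ⟨i', j', rfl⟩ := hq
  have h1 := hT.dist_eq_one
  by_cases e1 : i = i'
  · subst e1
    have e2 : j ≠ j' := fun e2 => hT.1 (by rw [e2])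
    obtain ⟨k, h2, h3⟩ := Fin.exists_third j j' e2
    exact ⟨i, k, h.triple_unique (hg.rows i e2 h2 h3) hT⟩
  · by_cases e2 : j = j'
    · subst e2
      obtain ⟨k, h2, h3⟩ := Fin.exists_third i i' e1
      exact ⟨k, j, h.triple_unique (hg.cols j e1 h2 h3) hT⟩
    · rw [hg.far _ _ _ _ e1 e2] at h1
      omega

/-- A grid is determined by two of its points at distance two. -/
theorem subset (h : N.IsNearHexagonTwo) (hg : N.IsGrid g) (hg' : N.IsGrid g') (hxy : N.d x y = 2)
    (hx : ∃ i j, g i j = x) (hy : ∃ i j, g i j = y) (hx' : ∃ i j, g' i j = x)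
    (hy' : ∃ i j, g' i j = y) (k l : Fin 3) : ∃ i j, g i j = g' k l := by
  have hX := hx
  have hY := hy
  obtain ⟨i, j, rfl⟩ := hx
  obtain ⟨i', j', rfl⟩ := hy
  obtain ⟨k, l, e1⟩ := hx'
  obtain ⟨k', l', e2⟩ := hy'
  obtain ⟨h1, h2⟩ := hg.d_eq_two_iff.1 hxy
  rw [← e1, ← e2] at hxy
  obtain ⟨h3, h4⟩ := hg'.d_eq_two_iff.1 hxy
  -- The two points have at most two common neighbours, and `g` already contains two.
  have key : ∀ z, N.d (g' k l) z = 1 → N.d (g' k' l') z = 1 → ∃ i j, g i j = z := by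
    intro z hz hz'
    have h5 := h.eq_or_eq_of_common hxy (a := g i j') (b := g i' j) (c := z)
      (fun e => h1 (congrArg Prod.fst (hg.injective (a₁ := (i, j')) (a₂ := (i', j)) e)))
      (by rw [e1]; exact hg.d_row h2) (by rw [e1]; exact hg.d_col h1) hz
      (by rw [e2]; exact hg.d_col h1.symm) (by rw [e2]; exact hg.d_row h2.symm) hz'
    rcases h5 with rfl | rfl
    exacts [⟨_, _, rfl⟩, ⟨_, _, rfl⟩]
  refine hg'.subset_of_closed (S := fun z => ∃ i j, g i j = z) (fun hT => hg.closed h hT) h3 h4 ?_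
    (key _ (hg'.d_row h4) (hg'.d_col h3.symm)) (key _ (hg'.d_col h3) (hg'.d_row h4.symm)) ?_ _ _
  · rw [e1]
    exact hX
  · rw [e2]
    exact hY

end IsGrid

theorem Grid.isGrid {N : PointLineGeometry P L} {x a p b y r s q m : P}
    (hG : N.Grid x a p b y r s q m) : N.IsGrid ![![x, a, p], ![b, y, r], ![s, q, m]] where
  row i := by
    fin_cases i
    exacts [hG.row₁, hG.row₂, hG.row₃]
  col j := by
    fin_cases j
    exacts [hG.col₁, hG.col₂, hG.col₃]
  far i i' j j' h1 h2 := by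
    obtain ⟨-, -, -, -, -, -, xy, xr, xq, xm, ab, ar, as, am, pb, py, ps, pq, bq, bm, ys, ym, rs,
      rq⟩ := hG
    fin_cases i <;> fin_cases i' <;> first
      | exact absurd rfl h1
      | (fin_cases j <;> fin_cases j' <;> first
          | exact absurd rfl h2
          | assumption
          | (rw [IsNearHexagonTwo.d_comm]; assumption))

end PointLineGeometry

/-! ### Counting grids -/

namespace PointLineGeometry

universe u₈ v₈

variable {P : Type u₈} {L : Type v₈}

/-- The point set of a grid. -/
def IsQuad (N : PointLineGeometry P L) (Q : Finset P) : Prop :=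
  ∃ g, N.IsGrid g ∧ ∀ z, z ∈ Q ↔ ∃ i j, g i j = z

namespace IsNearHexagonTwo

variable {N : PointLineGeometry P L} (h : N.IsNearHexagonTwo) {a b c p q r s t x y z m w : P}
include h

theorem exists_isGrid (hxy : N.Cross x y) : ∃ g, N.IsGrid g ∧ g 0 0 = x ∧ g 1 1 = y := by
  obtain ⟨h1, a, b, hab, h2, h3, h4, h5⟩ := hxy
  obtain ⟨p, hp⟩ := h.exists_triple h2
  obtain ⟨s, hs⟩ := h.exists_triple h3
  obtain ⟨q, hq⟩ := h.exists_triple h4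
  obtain ⟨r, hr⟩ := h.exists_triple h5
  obtain ⟨m, hm⟩ := h.exists_grid h1 hab hp hq.swap hr.swap hs
  exact ⟨_, hm.isGrid, rfl, rfl⟩

omit h in
theorem cross_of_isGrid {g : Fin 3 → Fin 3 → P} (hg : N.IsGrid g) {i j i' j' : Fin 3} :
    N.Cross (g i j) (g i' j') ↔ i ≠ i' ∧ j ≠ j' := by
  refine ⟨fun hc => hg.d_eq_two_iff.1 hc.1, fun ⟨h1, h2⟩ => ⟨hg.far _ _ _ _ h1 h2, g i j', g i' j,
    fun e => h1 ?_, hg.d_row h2, hg.d_col h1, hg.d_col h1.symm, hg.d_row h2.symm⟩⟩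
  exact congrArg Prod.fst (hg.injective (a₁ := (i, j')) (a₂ := (i', j)) e)

theorem quad_unique {Q Q' : Finset P} (hQ : N.IsQuad Q) (hQ' : N.IsQuad Q') (hxy : N.d x y = 2)
    (h1 : x ∈ Q) (h2 : y ∈ Q) (h3 : x ∈ Q') (h4 : y ∈ Q') : Q = Q' := by
  obtain ⟨g, hg, hQ⟩ := hQ
  obtain ⟨g', hg', hQ'⟩ := hQ'
  rw [hQ] at h1 h2
  rw [hQ'] at h3 h4
  ext z
  rw [hQ, hQ']
  constructor
  · rintro ⟨i, j, rfl⟩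
    exact hg'.subset h hg hxy h3 h4 h1 h2 i j
  · rintro ⟨i, j, rfl⟩
    exact hg.subset h hg' hxy h1 h2 h3 h4 i j

theorem exists_quad (hxy : N.Cross x y) : ∃ Q, N.IsQuad Q ∧ x ∈ Q ∧ y ∈ Q := by
  classical
  obtain ⟨g, hg, rfl, rfl⟩ := h.exists_isGrid hxy
  have : ∀ z, z ∈ Finset.univ.image (fun k : Fin 3 × Fin 3 => g k.1 k.2) ↔ ∃ i j, g i j = z := by
    simp
  exact ⟨_, ⟨g, hg, this⟩, (this _).2 ⟨_, _, rfl⟩, (this _).2 ⟨_, _, rfl⟩⟩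

omit h in
theorem card_quad {Q : Finset P} (hQ : N.IsQuad Q) : Q.card = 9 := by
  classical
  obtain ⟨g, hg, hQ⟩ := hQ
  have : Q = Finset.univ.image (fun k : Fin 3 × Fin 3 => g k.1 k.2) := by
    ext z
    simp [hQ]
  rw [this, Finset.card_image_of_injective _ hg.injective]
  rfl

open Classical in
omit h in
theorem card_cross_quad {Q : Finset P} (hQ : N.IsQuad Q) (hx : x ∈ Q) :
    (Q.filter fun y => N.Cross x y).card = 4 := by
  obtain ⟨g, hg, hQ⟩ := hQ
  obtain ⟨i, j, rfl⟩ := (hQ x).1 hx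
  have e : (Q.filter fun y => N.Cross (g i j) y) =
      (Finset.univ.filter fun k : Fin 3 × Fin 3 => i ≠ k.1 ∧ j ≠ k.2).image
        (fun k : Fin 3 × Fin 3 => g k.1 k.2) := by
    ext z
    simp only [Finset.mem_filter, hQ, Finset.mem_image, Finset.mem_univ, true_and, Prod.exists]
    constructor
    · rintro ⟨⟨i', j', rfl⟩, hc⟩
      exact ⟨i', j', (cross_of_isGrid hg).1 hc, rfl⟩
    · rintro ⟨i', j', hc, rfl⟩
      exact ⟨⟨i', j', rfl⟩, (cross_of_isGrid hg).2 hc⟩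
  rw [e, Finset.card_image_of_injective _ hg.injective]
  have : ∀ i j : Fin 3, (Finset.univ.filter fun k : Fin 3 × Fin 3 => i ≠ k.1 ∧ j ≠ k.2).card = 4 := by
    decide
  convert this i j

variable [Fintype P]

-- A point with two common neighbours with `x` determines a unique grid on `x`, and each grid on `x`
-- contains four such points.
open Classical in
theorem card_cross_eq (x : P) : (Finset.univ.filter fun y => N.Cross x y).card =
    4 * (Finset.univ.filter fun Q => N.IsQuad Q ∧ x ∈ Q).card := by
  have := Finset.sum_card_bipartiteAbove_eq_sum_card_bipartiteBelow
    (s := Finset.univ.filter fun Q => N.IsQuad Q ∧ x ∈ Q)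
    (t := Finset.univ.filter fun y => N.Cross x y) (fun Q y => y ∈ Q)
  rw [Finset.sum_congr rfl (g := fun _ => 4) fun Q hQ => ?_,
    Finset.sum_congr rfl (s₁ := Finset.univ.filter fun y => N.Cross x y) (g := fun _ => 1)
      fun y hy => ?_, Finset.sum_const, Finset.sum_const] at this
  · simp only [smul_eq_mul] at this
    omega
  · simp only [Finset.mem_filter, Finset.mem_univ, true_and] at hy
    obtain ⟨Q, hQ, h1, h2⟩ := h.exists_quad hy
    refine Finset.card_eq_one.2 ⟨Q, ?_⟩
    ext Q'
    simp only [Finset.bipartiteBelow, Finset.mem_filter, Finset.mem_univ, true_and,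
      Finset.mem_singleton]
    refine ⟨fun ⟨⟨h3, h4⟩, h5⟩ => h.quad_unique h3 hQ hy.1 h4 h5 h1 h2, ?_⟩
    rintro rfl
    exact ⟨⟨hQ, h1⟩, h2⟩
  · simp only [Finset.mem_filter, Finset.mem_univ, true_and] at hQ
    rw [← card_cross_quad hQ.1 hQ.2]
    congr 1
    ext y
    simp [Finset.bipartiteAbove, and_comm]

open Classical in
omit h in
theorem sum_quads : ∑ x : P, (Finset.univ.filter fun Q => N.IsQuad Q ∧ x ∈ Q).card =
    9 * (Finset.univ.filter fun Q => N.IsQuad Q).card := by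
  have := Finset.sum_card_bipartiteAbove_eq_sum_card_bipartiteBelow
    (s := (Finset.univ : Finset P)) (t := Finset.univ.filter fun Q => N.IsQuad Q) (fun y Q => y ∈ Q)
  rw [Finset.sum_congr rfl (s₁ := Finset.univ.filter fun Q => N.IsQuad Q) (g := fun _ => 9)
    fun Q hQ => ?_, Finset.sum_const, smul_eq_mul, mul_comm] at this
  · rw [← this]
    refine Finset.sum_congr rfl fun x _ => ?_
    rw [Finset.bipartiteAbove, Finset.filter_filter]
  · rw [← card_quad (Finset.mem_filter.1 hQ).2]
    congr 1
    ext y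
    simp [Finset.bipartiteBelow]

omit [Fintype P] in
/-- Either no two points at distance two have two common neighbours, or there are 27 points and
any two points at distance two have two common neighbours. -/
theorem cross_dichotomy : (∀ x y, ¬ N.Cross x y) ∨
    (Nat.card P = 27 ∧ ∀ x y, N.d x y = 2 → N.Cross x y) := by
  classical
  have := h.finite
  have := Fintype.ofFinite P
  obtain ⟨x₀⟩ := h.connected.nonempty
  set q := (Finset.univ.filter fun Q => N.IsQuad Q ∧ x₀ ∈ Q).card with hq
  have h0 := h.card_cross x₀
  have h0' := h.card_cross_eq x₀
  -- The total number of points determines the number of grids on a point, which is therefore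
  -- constant.
  have hall : ∀ x, (Finset.univ.filter fun Q => N.IsQuad Q ∧ x ∈ Q).card = q := fun x => by
    have h1 := h.card_cross x
    have h1' := h.card_cross_eq x
    omega
  have hsum := sum_quads (N := N)
  rw [Finset.sum_congr rfl fun x _ => hall x, Finset.sum_const, Finset.card_univ,
    smul_eq_mul] at hsum
  generalize (Finset.univ.filter fun Q => N.IsQuad Q).card = k at hsum
  generalize hv : Fintype.card P = v at hsum
  have hv' : v + 12 * q = 63 := by omega
  -- With c = 4q and n₂ = 24 - 4q, the inequality c ≤ n₂ gives q ≤ 3.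
  have hq3 : q ≤ 3 := by omega
  -- For q = 1 and q = 2 the number of incident pairs of points and grids would be 51 and 78, which
  -- are not divisible by nine.
  have : q = 0 ∨ q = 3 := by
    interval_cases q
    · exact Or.inl rfl
    · omega
    · omega
    · exact Or.inr rfl
  rcases this with e | e
  · left
    intro x y hc
    have h1 := h.card_cross_eq x
    rw [hall, e, mul_zero, Finset.card_eq_zero, Finset.filter_eq_empty_iff] at h1
    exact h1 (Finset.mem_univ y) hc
  · right
    refine ⟨by rw [Nat.card_eq_fintype_card]; omega, fun x y hxy => ?_⟩
    have h1 := h.card_cross x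
    have h2 := h.card_cross_eq x
    rw [hall, e] at h2
    -- For q = 3 both sets have twelve members.
    have h3 : (Finset.univ.filter fun y => N.Cross x y) = N.sphere x 2 :=
      Finset.eq_of_subset_of_card_le (fun y hy => mem_sphere.2 (Finset.mem_filter.1 hy).2.1)
        (by omega)
    exact (Finset.mem_filter.1 (h3 ▸ mem_sphere.2 hxy : y ∈ Finset.univ.filter fun y => N.Cross x y)).2

end IsNearHexagonTwo

end PointLineGeometry

/-! ### Without grids the near hexagon is a generalized hexagon -/

namespace PointLineGeometry

universe u₉ v₉

variable {P : Type u₉} {L : Type v₉}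

/-- A potential on the points that increases slowly along paths from `p` to the line `l` on `p`
that do not use the flag `(p, l)`. -/
noncomputable def potential (N : PointLineGeometry P L) (p : P) (l : L) (z : P) : ℕ :=
  open Classical in if N.IsNearest z l p then 2 * N.d z p else 12 - 2 * N.d z p

namespace IsNearHexagonTwo

variable {N : PointLineGeometry P L} (h : N.IsNearHexagonTwo) {p q r x y z z' : P} {l m : L}
include h

/-- The other points of the line are one step farther, and no distance exceeds three. -/
theorem exists_nearest_le_two (x : P) (l : L) :
    ∃ p, N.Inc p l ∧ N.d x p ≤ 2 ∧ ∀ q, N.Inc q l → q ≠ p → N.d x q = N.d x p + 1 := by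
  obtain ⟨p, hp, hp'⟩ := h.exists_nearest x l
  refine ⟨p, hp, ?_, hp'⟩
  obtain ⟨q, r, hqr, hq, hr⟩ := h.nearHexagon.partialLinear.1 l
  by_cases e : q = p
  · have h1 := hp' r hr (e ▸ hqr.symm)
    have := h.d_le_three x r
    omega
  · have h1 := hp' q hq e
    have := h.d_le_three x q
    omega

theorem isNearest_or (hp : N.Inc p l) (z : P) :
    (N.IsNearest z l p ∧ N.potential p l z = 2 * N.d z p ∧ N.d z p ≤ 2 ∧
      ∀ q, N.Inc q l → q ≠ p → N.d z q = N.d z p + 1) ∨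
    (N.potential p l z = 12 - 2 * N.d z p ∧ N.d z p ≤ 3 ∧
      ∃ q, q ≠ p ∧ N.Inc q l ∧ N.d z p = N.d z q + 1) := by
  obtain ⟨q, hq, h2, hq'⟩ := h.exists_nearest_le_two z l
  by_cases e : p = q
  · subst e
    have h3 : N.IsNearest z l p := ⟨hp, fun r hr => by
      by_cases e : r = p
      · rw [e]
      · exact (Nat.le_succ _).trans (hq' r hr e).ge⟩
    exact Or.inl ⟨h3, if_pos h3, h2, hq'⟩
  · have h3 := hq' p hp e
    have h4 : ¬ N.IsNearest z l p := fun h4 => by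
      have h5 : N.d z p ≤ N.d z q := h4.2 q hq
      omega
    exact Or.inr ⟨if_neg h4, h.d_le_three z p, q, Ne.symm e, hq, h3⟩

theorem potential_of_inc (hp : N.Inc p l) (hz : N.Inc z l) (hzp : z ≠ p) :
    N.potential p l z = 10 := by
  have h1 : N.d z p = 1 := SimpleGraph.dist_eq_one_iff_adj.2 ⟨hzp, l, hz, hp⟩
  rcases h.isNearest_or hp z with ⟨h2, -, -, h3⟩ | ⟨h2, -⟩
  · have h4 := h3 z hz hzp
    rw [h.d_eq_zero_iff.2 rfl] at h4
    omega
  · rw [h2, h1]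

/-- The critical case is that `p` is the nearest point of `l` for `z'` but not for `z`. Then `d z p
= d z' p + 1`, and `d z' p ≥ 2` is needed. If `d z' p = 0`, then `m = l`; if `d z' p = 1`, then `p`
and `z` are two common neighbours of `z'` and a point of `l`. -/
theorem potential_le (hc : ∀ x y, ¬ N.Cross x y) (hp : N.Inc p l) (hz : N.Inc z m)
    (hz' : N.Inc z' m) (hml : m = l → z ≠ p ∧ z' ≠ p) :
    N.potential p l z ≤ N.potential p l z' + 2 := by
  by_cases hm : m = l
  · subst hm
    rw [h.potential_of_inc hp hz (hml rfl).1, h.potential_of_inc hp hz' (hml rfl).2]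
    omega
  by_cases hzz : z = z'
  · rw [hzz]
    omega
  have h1 : N.d z z' = 1 := SimpleGraph.dist_eq_one_iff_adj.2 ⟨hzz, m, hz, hz'⟩
  have h1' : N.d z' z = 1 := by rw [d_comm, h1]
  have t1 := h.d_triangle z z' p
  have t2 := h.d_triangle z' z p
  rcases h.isNearest_or hp z with ⟨-, e1, b1, n1⟩ | ⟨e1, b1, q, hqp, hq, n1⟩ <;>
    rcases h.isNearest_or hp z' with ⟨-, e2, b2, n2⟩ | ⟨e2, b2, q', hqp', hq', n2⟩
  · omega
  · omega
  · have n3 := n2 q hq hqp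
    have t3 := h.d_triangle z' z q
    have hpq : N.d p q = 1 := SimpleGraph.dist_eq_one_iff_adj.2 ⟨hqp.symm, l, hp, hq⟩
    have hz0 : N.d z' p ≠ 0 := fun e => by
      have e3 : N.d z q = 0 := by omega
      rw [h.d_eq_zero_iff] at e e3
      subst e e3
      exact hm (h.eq_of_inc hzz hz hz' hq hp)
    have hz1 : N.d z' p ≠ 1 := fun e => by
      refine hc z' q ⟨by omega, p, z, fun e4 => ?_, e, h1', by rw [d_comm, hpq], ?_⟩
      · rw [← e4, h.d_eq_zero_iff.2 rfl] at n1
        omega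
      · rw [d_comm]
        omega
    omega
  · omega

/-- The potential is 10 at the points of `l` other than `p`, where a walk avoiding the flag must
arrive, and passing through a line in two steps of the walk changes it by at most two. It vanishes
at `p`, so a walk from `p` to `l` has length at least eleven. -/
theorem length_add_potential (hc : ∀ x y, ¬ N.Cross x y) (hp : N.Inc p l) {u v : P ⊕ L}
    (w : (N.incidenceGraph.deleteEdges {s(Sum.inl p, Sum.inr l)}).Walk u v) (hv : v = Sum.inr l) :
    (∀ z, u = Sum.inl z → 11 ≤ w.length + N.potential p l z) ∧
      ∀ m z, u = Sum.inr m → N.Inc z m → (m = l → z ≠ p) → 10 ≤ w.length + N.potential p l z := by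
  induction w with
  | nil =>
    subst hv
    refine ⟨fun z e => by simp at e, fun m z e hz hzp => ?_⟩
    obtain rfl := Sum.inr.inj e
    rw [h.potential_of_inc hp hz (hzp rfl)]
    omega
  | @cons u v _ ha w ih =>
    obtain ⟨ih1, ih2⟩ := ih hv
    rw [SimpleGraph.deleteEdges_adj] at ha
    obtain ⟨ha, he⟩ := ha
    rw [SimpleGraph.Walk.length_cons]
    constructor
    · rintro z rfl
      cases v with
      | inl y => exact ha.elim
      | inr m =>
        have := ih2 m z rfl ha (by rintro rfl rfl; exact he rfl)
        omega
    · rintro m z rfl hz hzp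
      cases v with
      | inr y => exact ha.elim
      | inl y =>
        have h1 := ih1 y rfl
        have h2 := h.potential_le hc hp (z := y) (z' := z) (m := m) ha hz fun e =>
          ⟨by rintro rfl; subst e; exact he Sym2.eq_swap, hzp e⟩
        omega

omit h in
theorem exists_walk {u v : P} (w : N.collinearityGraph.Walk u v) :
    ∃ w' : N.incidenceGraph.Walk (Sum.inl u) (Sum.inl v), w'.length = 2 * w.length := by
  induction w with
  | nil => exact ⟨.nil, rfl⟩
  | @cons u v _ ha w ih =>
    obtain ⟨w', hw'⟩ := ih
    obtain ⟨l, hu, hv⟩ := ha.2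
    have h1 : N.incidenceGraph.Adj (Sum.inl u) (Sum.inr l) := hu
    have h2 : N.incidenceGraph.Adj (Sum.inr l) (Sum.inl v) := hv
    refine ⟨.cons h1 (.cons h2 w'), ?_⟩
    rw [SimpleGraph.Walk.length_cons, SimpleGraph.Walk.length_cons, SimpleGraph.Walk.length_cons, hw']
    omega

theorem exists_walk_le_five (x : P) (l : L) :
    ∃ w : N.incidenceGraph.Walk (Sum.inl x) (Sum.inr l), w.length ≤ 5 := by
  obtain ⟨q, hq, h2, -⟩ := h.exists_nearest_le_two x l
  obtain ⟨w, hw⟩ := (h.connected x q).exists_walk_length_eq_dist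
  obtain ⟨w', hw'⟩ := exists_walk w
  have h1 : N.incidenceGraph.Adj (Sum.inl q) (Sum.inr l) := hq
  refine ⟨w'.concat h1, ?_⟩
  rw [SimpleGraph.Walk.length_concat, hw', hw]
  have : N.collinearityGraph.dist x q ≤ 2 := h2
  omega

theorem isHexagonGraph (hc : ∀ x y, ¬ N.Cross x y) :
    IsHexagonGraph N.incidenceGraph Sum.isLeft where
  col_ne u v ha := by
    rcases u with u | u <;> rcases v with v | v
    · exact ha.elim
    · simp
    · simp
    · exact ha.elim
  three u := by
    rcases u with p | l
    · refine Eq.trans ?_ ((Set.ncard_image_of_injective {l | N.Inc p l} (Sum.inr_injective (α := P))).trans (h.order.2 p))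
      congr 1
      ext v
      rcases v with v | v
      · simp only [SimpleGraph.mem_neighborSet, Set.mem_image, reduceCtorEq, and_false, exists_false,
          iff_false]
        exact fun ha => ha
      · simp only [SimpleGraph.mem_neighborSet, Set.mem_image, Sum.inr.injEq, exists_eq_right]
        exact Iff.rfl
    · refine Eq.trans ?_ ((Set.ncard_image_of_injective {p | N.Inc p l} (Sum.inl_injective (β := L))).trans (h.order.1 l))
      congr 1
      ext v
      rcases v with v | v
      · simp only [SimpleGraph.mem_neighborSet, Set.mem_image, Sum.inl.injEq, exists_eq_right]
        exact Iff.rfl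
      · simp only [SimpleGraph.mem_neighborSet, Set.mem_image, reduceCtorEq, and_false, exists_false,
          iff_false]
        exact fun ha => ha
  near u v huv := by
    rcases u with u | u <;> rcases v with v | v
    · exact absurd rfl huv
    · exact h.exists_walk_le_five u v
    · obtain ⟨w, hw⟩ := h.exists_walk_le_five v u
      exact ⟨w.reverse, by rwa [SimpleGraph.Walk.length_reverse]⟩
    · exact absurd rfl huv
  no_short u v ha w := by
    have key : ∀ {p l} (hp : N.Inc p l)
        (w : (N.incidenceGraph.deleteEdges {s(Sum.inl p, Sum.inr l)}).Walk (.inl p) (.inr l)),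
        9 < w.length := fun {p l} hp w => by
      have h1 := (h.length_add_potential hc hp w rfl).1 p rfl
      have h2 : N.potential p l p = 0 := by
        rcases h.isNearest_or hp p with ⟨-, h2, -⟩ | ⟨-, -, q, -, -, h2⟩
        · rw [h2, h.d_eq_zero_iff.2 rfl]
        · rw [h.d_eq_zero_iff.2 rfl] at h2
          omega
      omega
    rcases u with u | u <;> rcases v with v | v
    · exact ha.elim
    · exact key ha w
    · have h1 : ∀ e : Sym2 (P ⊕ L), e = s(Sum.inl v, Sum.inr u) →
          ∀ w : (N.incidenceGraph.deleteEdges {e}).Walk (.inr u) (.inl v), 9 < w.length := by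
        rintro _ rfl w
        rw [← SimpleGraph.Walk.length_reverse]
        exact key ha w.reverse
      exact h1 _ Sym2.eq_swap w
    · exact ha.elim

theorem point_ext (hpq : ∀ l, N.Inc p l ↔ N.Inc q l) : p = q := by
  by_contra hne
  obtain ⟨l, m, n, hlm, -, -, hset⟩ := Set.ncard_eq_three.1 (h.order.2 p)
  have hl : N.Inc p l := by
    change l ∈ {l | N.Inc p l}
    simp [hset]
  have hm : N.Inc p m := by
    change m ∈ {l | N.Inc p l}
    simp [hset]
  exact hlm (h.eq_of_inc hne hl ((hpq l).1 hl) hm ((hpq m).1 hm))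

end IsNearHexagonTwo

end PointLineGeometry

/-! ### Coordinates by projection when all grids exist -/

namespace PointLineGeometry

universe u₁₀ v₁₀

variable {P : Type u₁₀} {L : Type v₁₀}

/-- Two lines at constant distance whose points correspond to each other. -/
def Par (N : PointLineGeometry P L) (m l : L) : Prop :=
  ∃ a, (∀ z, N.Inc z m → ∃ u, N.Inc u l ∧ N.d z u = a) ∧
    (∀ u, N.Inc u l → ∃ z, N.Inc z m ∧ N.d u z = a) ∧
      ∀ z u, N.Inc z m → N.Inc u l → a ≤ N.d z u

namespace IsNearHexagonTwo

variable {N : PointLineGeometry P L} (h : N.IsNearHexagonTwo) {p q r x y z z' z'' : P}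
  {l l' m m' : L}

theorem _root_.PointLineGeometry.Par.symm (hP : N.Par m l) : N.Par l m := by
  obtain ⟨a, h1, h2, h3⟩ := hP
  exact ⟨a, h2, h1, fun u z hu hz => by rw [d_comm]; exact h3 z u hz hu⟩

include h

/-- The point of the line `l` nearest to `z`. -/
noncomputable def proj (z : P) (l : L) : P := (h.exists_nearest z l).choose

theorem proj_inc (z : P) (l : L) : N.Inc (h.proj z l) l := (h.exists_nearest z l).choose_spec.1

theorem d_eq_add_one (hq : N.Inc q l) (hne : q ≠ h.proj z l) : N.d z q = N.d z (h.proj z l) + 1 :=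
  (h.exists_nearest z l).choose_spec.2 q hq hne

theorem d_proj_le (z : P) (hq : N.Inc q l) : N.d z (h.proj z l) ≤ N.d z q := by
  by_cases e : q = h.proj z l
  · rw [e]
  · rw [h.d_eq_add_one hq e]
    omega

theorem proj_eq (hq : N.Inc q l) (hmin : ∀ p, N.Inc p l → N.d z q ≤ N.d z p) :
    h.proj z l = q := by
  by_contra e
  have h1 := h.d_eq_add_one hq (Ne.symm e)
  have h2 := hmin _ (h.proj_inc z l)
  omega

theorem proj_of_inc (hz : N.Inc z l) : h.proj z l = z :=
  h.proj_eq hz fun p _ => by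
    rw [h.d_eq_zero_iff.2 rfl]
    omega

theorem d_proj_le_two (z : P) (l : L) : N.d z (h.proj z l) ≤ 2 := by
  obtain ⟨p, hp, h1, -⟩ := h.exists_nearest_le_two z l
  exact (h.d_proj_le z hp).trans h1

theorem d_proj_eq (hz : N.d z z' = 1) (hne : h.proj z l ≠ h.proj z' l) :
    N.d z (h.proj z l) = N.d z' (h.proj z' l) := by
  have h1 := h.d_eq_add_one (h.proj_inc z' l) hne.symm
  have h2 := h.d_eq_add_one (h.proj_inc z l) hne
  have h3 := h.d_triangle z z' (h.proj z' l)
  have h4 := h.d_triangle z' z (h.proj z l)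
  rw [d_comm z' z] at h4
  omega

/-- Otherwise the three points would be at distances k, k, k+1 from the common projection, against
the pattern k, k+1, k+1. -/
theorem proj_third (hT : N.Triple z z' z'') (he : h.proj z l = h.proj z' l) :
    h.proj z'' l = h.proj z l := by
  by_contra hne
  have h1 := h.d_proj_eq hT.rotate.rotate.dist_eq_one hne
  have h2 := h.d_proj_eq hT.rotate.swap.dist_eq_one (by rwa [← he])
  have h3 := h.d_eq_add_one (h.proj_inc z l) (Ne.symm hne)
  have h4 := h.d_triple hT (h.proj z l)
  rw [← he] at h2
  rw [d_comm _ z, d_comm _ z', d_comm _ z''] at h4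
  omega

/-- Projection from one line to another is either constant or injective, by `proj_third`. In the
injective case the distances to the projections agree by `d_proj_eq`. -/
theorem par_of_ne (hz : N.Inc z m) (hz' : N.Inc z' m) (hne : h.proj z l ≠ h.proj z' l) :
    N.Par m l := by
  have hzz : z ≠ z' := fun e => hne (by rw [e])
  obtain ⟨z'', hT, hz''⟩ := h.exists_triple_of_inc hzz hz hz'
  have n1 : h.proj z l ≠ h.proj z'' l := fun e => hne (h.proj_third hT.swap' e).symm
  have n2 : h.proj z' l ≠ h.proj z'' l := fun e => hne (h.proj_third hT.rotate e)
  have d1 := h.d_proj_eq hT.dist_eq_one hne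
  have d2 := h.d_proj_eq hT.swap'.dist_eq_one n1
  have hall : ∀ w, N.Inc w m → N.d w (h.proj w l) = N.d z (h.proj z l) := fun w hw => by
    rcases h.eq_of_inc_of_triple hT.1 hT.2.1 hT.2.2.1 hz hz' hz'' hw with rfl | rfl | rfl
    exacts [rfl, d1.symm, d2.symm]
  refine ⟨N.d z (h.proj z l), fun w hw => ⟨_, h.proj_inc w l, hall w hw⟩, fun u hu => ?_,
    fun w u hw hu => ?_⟩
  · rcases h.eq_of_inc_of_triple hne n1 n2 (h.proj_inc z l) (h.proj_inc z' l) (h.proj_inc z'' l) hu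
      with rfl | rfl | rfl
    · exact ⟨z, hz, d_comm _ _⟩
    · exact ⟨z', hz', by rw [d_comm, hall z' hz']⟩
    · exact ⟨z'', hz'', by rw [d_comm, hall z'' hz'']⟩
  · rw [← hall w hw]
    exact h.d_proj_le w hu

theorem exists_ne_inc (x : P) (l : L) : ∃ y, y ≠ x ∧ N.Inc y l := by
  obtain ⟨p, q, hpq, hp, hq⟩ := h.nearHexagon.partialLinear.1 l
  by_cases e : p = x
  · exact ⟨q, fun e' => hpq (e.trans e'.symm), hq⟩
  · exact ⟨p, e, hp⟩

omit h in
theorem d_eq_one_of_inc (hne : p ≠ q) (hp : N.Inc p l) (hq : N.Inc q l) : N.d p q = 1 :=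
  SimpleGraph.dist_eq_one_iff_adj.2 ⟨hne, l, hp, hq⟩

/-- Among three lines on `x`, at most one has `x` as the point nearest to a point at distance
two. -/
theorem eq_of_proj_eq (hc : ∀ x y, N.d x y = 2 → N.Cross x y) (hxz : N.d x z = 2)
    (hl : N.Inc x l) (hl' : N.Inc x l') (h1 : h.proj z l = x) (h2 : h.proj z l' = x) : l = l' := by
  by_contra hne
  obtain ⟨-, a, b, hab, hxa, hxb, hza, hzb⟩ := hc x z hxz
  have hab' := h.d_eq_two_of_common hxz hab hxa hxb hza hzb
  obtain ⟨-, m, hxm, ham⟩ := SimpleGraph.dist_eq_one_iff_adj.1 hxa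
  obtain ⟨-, n, hxn, hbn⟩ := SimpleGraph.dist_eq_one_iff_adj.1 hxb
  have hmn : m ≠ n := by
    rintro rfl
    rw [d_eq_one_of_inc hab ham hbn] at hab'
    omega
  have key : ∀ {k c}, N.Inc c k → N.d z c = 1 → h.proj z k ≠ x := fun {k c} hck hzc e => by
    have := h.d_proj_le z hck
    rw [e, d_comm, hxz, hzc] at this
    omega
  obtain ⟨a₁, a₂, a₃, -, -, -, hset⟩ := Set.ncard_eq_three.1 (h.order.2 x)
  have hmem : ∀ k, N.Inc x k → k = a₁ ∨ k = a₂ ∨ k = a₃ := fun k hk => by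
    have : k ∈ {l | N.Inc x l} := hk
    rw [hset] at this
    simpa using this
  have e1 : m ≠ l := fun e => key ham hza (e ▸ h1)
  have e2 : m ≠ l' := fun e => key ham hza (e ▸ h2)
  have e3 : n ≠ l := fun e => key hbn hzb (e ▸ h1)
  have e4 : n ≠ l' := fun e => key hbn hzb (e ▸ h2)
  have f1 := hmem l hl
  have f2 := hmem l' hl'
  have f3 := hmem m hxm
  have f4 := hmem n hxn
  grind

/-- Both parallelisms have the same distance `a ≤ 2`, namely that of `x` from `m`. For `a = 0` both
lines are `m`. For `a = 1` a point of `m` at distance two from `x` would have three common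
neighbours with `x`, one on each of the lines `l`, `l'` and `m`. For `a = 2` the claim is
`eq_of_proj_eq`. -/
theorem par_unique (hc : ∀ x y, N.d x y = 2 → N.Cross x y) (hl : N.Inc x l) (hl' : N.Inc x l')
    (h1 : N.Par m l) (h2 : N.Par m l') : l = l' := by
  by_contra hne
  obtain ⟨a, b1, b2, b3⟩ := h1
  obtain ⟨a', c1, c2, c3⟩ := h2
  obtain ⟨z, hz, hxz⟩ := b2 x hl
  obtain ⟨w, hw, hxw⟩ := c2 x hl'
  obtain rfl : a = a' := by
    have e1 := b3 w x hw hl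
    have e2 := c3 z x hz hl'
    rw [d_comm] at e1 e2
    omega
  have hzx : N.d z x = a := by rw [d_comm, hxz]
  have p1 : h.proj z l = x := h.proj_eq hl fun p hp => by rw [hzx]; exact b3 z p hz hp
  have p2 : h.proj z l' = x := h.proj_eq hl' fun p hp => by rw [hzx]; exact c3 z p hz hp
  have p3 : h.proj x m = z := h.proj_eq hz fun p hp => by
    rw [hxz, d_comm]
    exact b3 p x hp hl
  obtain ⟨z', hzz, hz'⟩ := h.exists_ne_inc z m
  have h3 := h.d_eq_add_one (z := x) hz' (by rwa [p3])
  rw [p3, hxz] at h3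
  obtain ⟨u, hu, hzu⟩ := b1 z' hz'
  obtain ⟨v, hv, hzv⟩ := c1 z' hz'
  have h4 := h.d_le_three x z'
  obtain rfl | rfl | rfl : a = 0 ∨ a = 1 ∨ a = 2 := by omega
  · rw [h.d_eq_zero_iff] at hxz hzu hzv
    subst hxz hzu hzv
    exact hne (h.eq_of_inc hzz hu hl hv hl')
  · have hux : N.d x u = 1 := d_eq_one_of_inc (by
      rintro rfl
      rw [d_comm] at hzu
      omega) hl hu
    have hvx : N.d x v = 1 := d_eq_one_of_inc (by
      rintro rfl
      rw [d_comm] at hzv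
      omega) hl' hv
    have huv : u ≠ v := by
      rintro rfl
      refine hne (h.eq_of_inc (p := x) (q := u) ?_ hl hu hl' hv)
      rintro rfl
      rw [h.d_eq_zero_iff.2 rfl] at hux
      omega
    rcases h.eq_or_eq_of_common h3 huv hux hvx hxz hzu hzv (d_eq_one_of_inc hzz hz' hz)
      with rfl | rfl
    · have := b3 z z hz hu
      rw [h.d_eq_zero_iff.2 rfl] at this
      omega
    · have := c3 z z hz hv
      rw [h.d_eq_zero_iff.2 rfl] at this
      omega
  · exact hne (h.eq_of_proj_eq hc hxz hl hl' p1 p2)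

/-- Otherwise `x` and `z` would have a common neighbour on each of the three lines on `x`. -/
theorem exists_proj_eq (hxz : N.d x z = 2) : ∃ l, N.Inc x l ∧ h.proj z l = x := by
  by_contra! hcon
  obtain ⟨l₁, l₂, l₃, h12, h13, h23, hset⟩ := Set.ncard_eq_three.1 (h.order.2 x)
  have hmem : ∀ k, k = l₁ ∨ k = l₂ ∨ k = l₃ → N.Inc x k := fun k hk => by
    change k ∈ {l | N.Inc x l}
    rw [hset]
    simpa using hk
  have key : ∀ k, N.Inc x k → N.d x (h.proj z k) = 1 ∧ N.d z (h.proj z k) = 1 := fun k hk => by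
    have h1 := h.d_eq_add_one hk (hcon k hk).symm
    rw [d_comm z x] at h1
    exact ⟨d_eq_one_of_inc (hcon k hk).symm hk (h.proj_inc z k), by omega⟩
  have sep : ∀ k k', N.Inc x k → N.Inc x k' → k ≠ k' → h.proj z k ≠ h.proj z k' :=
    fun k k' hk hk' hne e => hne (h.eq_of_inc (hcon k hk) (h.proj_inc z k) hk
      (e ▸ h.proj_inc z k') hk')
  have i1 := hmem l₁ (by simp)
  have i2 := hmem l₂ (by simp)
  have i3 := hmem l₃ (by simp)
  rcases h.eq_or_eq_of_common hxz (sep _ _ i1 i2 h12) (key _ i1).1 (key _ i2).1 (key _ i3).1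
    (key _ i1).2 (key _ i2).2 (key _ i3).2 with e | e
  · exact sep _ _ i1 i3 h13 e.symm
  · exact sep _ _ i2 i3 h23 e.symm

/-- Every line is projected bijectively to some line on `x`. -/
theorem exists_proj_ne (hc : ∀ x y, N.d x y = 2 → N.Cross x y) (x : P) (m : L) :
    ∃ l, N.Inc x l ∧ ∃ z z', N.Inc z m ∧ N.Inc z' m ∧ h.proj z l ≠ h.proj z' l := by
  have hz := h.proj_inc x m
  obtain ⟨z', hzz, hz'⟩ := h.exists_ne_inc (h.proj x m) m
  have h1 := h.d_eq_add_one hz' hzz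
  have h2 := h.d_proj_le_two x m
  set z := h.proj x m
  obtain h3 | h3 | h3 : N.d x z = 0 ∨ N.d x z = 1 ∨ N.d x z = 2 := by omega
  · rw [h.d_eq_zero_iff] at h3
    rw [← h3] at hz
    exact ⟨m, hz, z', z, hz', h3 ▸ hz, by
      rwa [h.proj_of_inc hz', h.proj_of_inc (h3 ▸ hz)]⟩
  -- Here `z'` is at distance two from `x`. The line joining `x` to their common neighbour `u ≠ z`
  -- works: `z` projects to `x`, but `z'` is closer to `u` than to `x`.
  · rw [h3] at h1
    obtain ⟨-, a, b, hab, hxa, hxb, hza, hzb⟩ := hc x z' h1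
    have hz'z := d_eq_one_of_inc hzz hz' hz
    obtain ⟨u, huz, hxu, hzu⟩ : ∃ u, u ≠ z ∧ N.d x u = 1 ∧ N.d z' u = 1 := by
      by_cases e : a = z
      · exact ⟨b, fun e' => hab (e.trans e'.symm), hxb, hzb⟩
      · exact ⟨a, e, hxa, hza⟩
    have huz' := h.d_eq_two_of_common h1 huz hxu h3 hzu hz'z
    obtain ⟨-, l, hxl, hul⟩ := SimpleGraph.dist_eq_one_iff_adj.1 hxu
    refine ⟨l, hxl, z, z', hz, hz', fun e => ?_⟩
    have hzl : ¬ N.Inc z l := fun hzl => by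
      rw [d_eq_one_of_inc huz hul hzl] at huz'
      omega
    have e1 : h.proj z l = x := by
      by_contra hne
      have h4 := h.d_eq_add_one hxl (Ne.symm hne)
      rw [d_comm, h3] at h4
      have h5 : N.d z (h.proj z l) = 0 := by omega
      rw [h.d_eq_zero_iff] at h5
      exact hzl (h5 ▸ h.proj_inc z l)
    have h4 := h.d_proj_le z' hul
    rw [← e, e1, d_comm, h1] at h4
    omega
  -- Here `z` projects to `x` on a suitable line, and `z'` cannot, since it is at distance three
  -- from `x`.
  · obtain ⟨l, hl, e⟩ := h.exists_proj_eq h3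
    refine ⟨l, hl, z, z', hz, hz', fun e' => ?_⟩
    have h4 := h.d_proj_le_two z' l
    rw [← e', e, d_comm] at h4
    omega

theorem proj_injective (hz : N.Inc z m) (hz' : N.Inc z' m) (hne : h.proj z l ≠ h.proj z' l)
    (hp : N.Inc p m) (hq : N.Inc q m) (he : h.proj p l = h.proj q l) : p = q := by
  by_contra hpq
  obtain ⟨r, hT, hr⟩ := h.exists_triple_of_inc hpq hp hq
  have hall : ∀ w, N.Inc w m → h.proj w l = h.proj p l := fun w hw => by
    rcases h.eq_of_inc_of_triple hT.1 hT.2.1 hT.2.2.1 hp hq hr hw with rfl | rfl | rfl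
    exacts [rfl, he.symm, h.proj_third hT he]
  exact hne ((hall z hz).trans (hall z' hz').symm)

theorem exists_labels (l : L) :
    ∃ e : P → Fin 3, ∀ p q, N.Inc p l → N.Inc q l → e p = e q → p = q := by
  classical
  obtain ⟨a, b, c, hab, hac, hbc, hset⟩ := Set.ncard_eq_three.1 (h.order.1 l)
  have hmem : ∀ p, N.Inc p l → p = a ∨ p = b ∨ p = c := fun p hp => by
    have : p ∈ {p | N.Inc p l} := hp
    rw [hset] at this
    simpa using this
  refine ⟨fun p => if p = a then 0 else if p = b then 1 else 2, fun p q hp hq e => ?_⟩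
  rcases hmem p hp with rfl | rfl | rfl <;> rcases hmem q hq with rfl | rfl | rfl <;>
    simp_all [Ne.symm]

/-- The line `m` has direction `i` with respect to the coordinates `κ`. -/
def _root_.PointLineGeometry.HasDirection (N : PointLineGeometry P L) (κ : Fin 3 → P → Fin 3)
    (m : L) (i : Fin 3) : Prop :=
  (∀ p q, N.Inc p m → N.Inc q m → κ i p = κ i q → p = q) ∧
    ∀ j, j ≠ i → ∀ p q, N.Inc p m → N.Inc q m → κ j p = κ j q

/-- The coordinates are the projections to the three lines on a fixed point. A line is parallel to
exactly one of them and projects to a single point on the others. -/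
theorem exists_coordinates (hc : ∀ x y, N.d x y = 2 → N.Cross x y) :
    ∃ κ : Fin 3 → P → Fin 3, (∀ m, ∃ i, N.HasDirection κ m i) ∧
      ∀ z i, ∃ m, N.Inc z m ∧ N.HasDirection κ m i := by
  obtain ⟨x⟩ := h.connected.nonempty
  have lines : ∀ z, ∃ l : Fin 3 → L, Function.Injective l ∧ ∀ k, N.Inc z k ↔ ∃ i, l i = k := by
    intro z
    obtain ⟨l₁, l₂, l₃, h12, h13, h23, hset⟩ := Set.ncard_eq_three.1 (h.order.2 z)
    refine ⟨![l₁, l₂, l₃], fun i j e => ?_, fun k => ?_⟩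
    · fin_cases i <;> fin_cases j <;> simp_all
    · have : k ∈ {l | N.Inc z l} ↔ k ∈ ({l₁, l₂, l₃} : Set L) := by rw [hset]
      simp only [Fin.exists_fin_succ, Set.mem_ofPred_eq, Set.mem_insert_iff, Set.mem_singleton_iff] at this ⊢
      simp [this, eq_comm]
  obtain ⟨l, hl, hl'⟩ := lines x
  have hxl : ∀ i, N.Inc x (l i) := fun i => (hl' _).2 ⟨i, rfl⟩
  choose e he using h.exists_labels
  have hdir : ∀ m, ∃ i, N.Par m (l i) ∧
      N.HasDirection (fun i z => e (l i) (h.proj z (l i))) m i := by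
    intro m
    obtain ⟨k, hk, z, z', hz, hz', hne⟩ := h.exists_proj_ne hc x m
    obtain ⟨i, rfl⟩ := (hl' k).1 hk
    have hpar := h.par_of_ne hz hz' hne
    refine ⟨i, hpar, fun p q hp hq e' => ?_, fun j hj p q hp hq => ?_⟩
    · exact h.proj_injective hz hz' hne hp hq
        (he _ _ _ (h.proj_inc p _) (h.proj_inc q _) e')
    · by_contra hcon
      exact hj (hl (h.par_unique hc (hxl j) (hxl i)
        (h.par_of_ne hp hq fun e' => hcon (congrArg _ e')) hpar))
  refine ⟨fun i z => e (l i) (h.proj z (l i)), fun m => (hdir m).imp fun i hi => hi.2,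
    fun z i => ?_⟩
  obtain ⟨k, hk, hk'⟩ := lines z
  choose f hf hf' using hdir
  -- By `par_unique` the three lines on `z` have different directions, so every direction occurs.
  have hinj : Function.Injective fun j => f (k j) := fun j j' e' => by
    have h1 := (hf (k j)).symm
    have h2 := (hf (k j')).symm
    rw [show f (k j) = f (k j') from e'] at h1
    exact hk (h.par_unique hc ((hk' _).2 ⟨j, rfl⟩) ((hk' _).2 ⟨j', rfl⟩) h1 h2)
  obtain ⟨j, hj⟩ := Finite.surjective_of_injective hinj i
  exact ⟨k j, (hk' _).2 ⟨j, rfl⟩, hj ▸ hf' (k j)⟩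

end IsNearHexagonTwo

end PointLineGeometry

/-! ### Recognition of the product of three lines -/

namespace PointLineGeometry

universe u₁₁ v₁₁ u₁₂ v₁₂

theorem IsPartialLinearSpace.prod {P : Type u₁₁} {L : Type v₁₁} {P' : Type u₁₂} {L' : Type v₁₂}
    {S : PointLineGeometry P L} {S' : PointLineGeometry P' L'} (h : S.IsPartialLinearSpace)
    (h' : S'.IsPartialLinearSpace) : (S.prod S').IsPartialLinearSpace := by
  refine ⟨?_, ?_⟩
  · rintro (⟨p, l'⟩ | ⟨l, p'⟩)
    · obtain ⟨a, b, hab, ha, hb⟩ := h'.1 l'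
      exact ⟨(p, a), (p, b), fun e => hab (congrArg Prod.snd e), ⟨rfl, ha⟩, ⟨rfl, hb⟩⟩
    · obtain ⟨a, b, hab, ha, hb⟩ := h.1 l
      exact ⟨(a, p'), (b, p'), fun e => hab (congrArg Prod.fst e), ⟨ha, rfl⟩, ⟨hb, rfl⟩⟩
  · rintro ⟨p, p'⟩ ⟨q, q'⟩ (⟨a, l'⟩ | ⟨l, a'⟩) (⟨b, m'⟩ | ⟨m, b'⟩) hne ⟨h1, h2⟩ ⟨h3, h4⟩ ⟨h5, h6⟩
      ⟨h7, h8⟩ <;> dsimp only at *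
    · subst h1 h3 h5
      rw [h'.2 p' q' l' m' (fun e => hne (by rw [e])) h2 h4 h6 h8]
    · exact absurd (by rw [h1, h3, h6, h8]) hne
    · exact absurd (by rw [h2, h4, h5, h7]) hne
    · subst h2 h4 h6
      rw [h.2 p q l m (fun e => hne (by rw [e])) h1 h3 h5 h7]

theorem isPartialLinearSpace_lineThree : lineThree.IsPartialLinearSpace :=
  ⟨fun _ => ⟨0, 1, by decide, trivial, trivial⟩, fun _ _ _ _ _ _ _ _ _ => rfl⟩

variable {P : Type u₁₁} {L : Type v₁₁} {N : PointLineGeometry P L} {κ : Fin 3 → P → Fin 3}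

namespace HasDirection

theorem exists_eq (hord : N.HasOrder 2 2) {m : L} {i : Fin 3} (hm : N.HasDirection κ m i)
    (v : Fin 3) : ∃ p, N.Inc p m ∧ κ i p = v := by
  have h1 : (κ i '' {p | N.Inc p m}).ncard = 3 :=
    (Set.InjOn.ncard_image (s := {p | N.Inc p m}) fun p hp q hq e => hm.1 p q hp hq e).trans
      (hord.1 m)
  have h2 : κ i '' {p | N.Inc p m} = Set.univ :=
    Set.eq_of_subset_of_ncard_le (Set.subset_univ _) (by rw [h1, Set.ncard_univ]; simp)
  have h3 : v ∈ κ i '' {p | N.Inc p m} := by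
    rw [h2]
    trivial
  exact h3

theorem inc_iff (hord : N.HasOrder 2 2) (hinj : ∀ p q, (∀ i, κ i p = κ i q) → p = q) {m : L}
    {i : Fin 3} (hm : N.HasDirection κ m i) {z : P} (hz : N.Inc z m) (p : P) :
    N.Inc p m ↔ ∀ j, j ≠ i → κ j p = κ j z := by
  refine ⟨fun hp j hj => hm.2 j hj p z hp hz, fun hp => ?_⟩
  obtain ⟨q, hq, e⟩ := hm.exists_eq hord (κ i p)
  have : q = p := hinj q p fun j => by
    by_cases hj : j = i
    · rw [hj, e]
    · rw [hp j hj, hm.2 j hj q z hq hz]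
  exact this ▸ hq

end HasDirection

/-- A geometry with 27 points and three suitable coordinate functions is the product of three
lines. -/
theorem isIsomorphic_prod_of_hasDirection (hN : N.IsPartialLinearSpace) (hord : N.HasOrder 2 2)
    (hcard : Nat.card P = 27) (hdir : ∀ m, ∃ i, N.HasDirection κ m i)
    (hpt : ∀ z i, ∃ m, N.Inc z m ∧ N.HasDirection κ m i) :
    N.IsIsomorphic ((lineThree.prod lineThree).prod lineThree) := by
  have hfin : Finite P := Nat.finite_of_card_ne_zero (by omega)
  have hne : Nonempty P := (Nat.card_pos_iff.1 (by omega)).1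
  -- Along the line of direction `i` one coordinate can be changed at will while the others are
  -- kept. Three such moves reach every triple, and surjectivity gives bijectivity because there are
  -- 27 points.
  have move : ∀ z i v, ∃ z', κ i z' = v ∧ ∀ j, j ≠ i → κ j z' = κ j z := fun z i v => by
    obtain ⟨m, hz, hm⟩ := hpt z i
    obtain ⟨p, hp, e⟩ := hm.exists_eq hord v
    exact ⟨p, e, fun j hj => hm.2 j hj p z hp hz⟩
  have hsurj : ∀ a b c, ∃ z, κ 0 z = a ∧ κ 1 z = b ∧ κ 2 z = c := fun a b c => by
    obtain ⟨z₀, e0, -⟩ := move (Classical.arbitrary P) 0 a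
    obtain ⟨z₁, e1, f1⟩ := move z₀ 1 b
    obtain ⟨z₂, e2, f2⟩ := move z₁ 2 c
    exact ⟨z₂, by rw [f2 0 (by decide), f1 0 (by decide), e0], by rw [f2 1 (by decide), e1], e2⟩
  have hbij : Function.Bijective fun z => ((κ 0 z, κ 1 z), κ 2 z) := by
    refine Function.Surjective.bijective_of_nat_card_le ?_ (by simp [hcard])
    rintro ⟨⟨a, b⟩, c⟩
    obtain ⟨z, rfl, rfl, rfl⟩ := hsurj a b c
    exact ⟨z, rfl⟩
  have hinj : ∀ p q, (∀ i, κ i p = κ i q) → p = q := fun p q e =>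
    hbij.1 (by simp only [e])
  have h0 : ∀ m z, N.Inc z m → N.HasDirection κ m 0 →
      ∀ p, N.Inc p m ↔ κ 1 p = κ 1 z ∧ κ 2 p = κ 2 z := fun m z hz hm p => by
    rw [hm.inc_iff hord hinj hz]
    simp [Fin.forall_fin_succ]
  have h1 : ∀ m z, N.Inc z m → N.HasDirection κ m 1 →
      ∀ p, N.Inc p m ↔ κ 0 p = κ 0 z ∧ κ 2 p = κ 2 z := fun m z hz hm p => by
    rw [hm.inc_iff hord hinj hz]
    simp [Fin.forall_fin_succ]
  have h2 : ∀ m z, N.Inc z m → N.HasDirection κ m 2 →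
      ∀ p, N.Inc p m ↔ κ 0 p = κ 0 z ∧ κ 1 p = κ 1 z := fun m z hz hm p => by
    rw [hm.inc_iff hord hinj hz]
    simp [Fin.forall_fin_succ]
  refine isIsomorphic_of_bijective hbij hN.line_ext
    ((isPartialLinearSpace_lineThree.prod isPartialLinearSpace_lineThree).prod
      isPartialLinearSpace_lineThree).line_ext (fun m => ?_) ?_
  · obtain ⟨z, -, -, hz, -⟩ := hN.1 m
    obtain ⟨i, hi⟩ := hdir m
    fin_cases i
    · exact ⟨.inr (.inr ((), κ 1 z), κ 2 z), fun p => (h0 m z hz hi p).trans (by simp [prod, lineThree])⟩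
    · exact ⟨.inr (.inl (κ 0 z, ()), κ 2 z), fun p => (h1 m z hz hi p).trans (by simp [prod, lineThree])⟩
    · exact ⟨.inl ((κ 0 z, κ 1 z), ()), fun p => (h2 m z hz hi p).trans (by simp [prod, lineThree])⟩
  · rintro (⟨⟨a, b⟩, ⟨⟩⟩ | ⟨⟨a, ⟨⟩⟩ | ⟨⟨⟩, b⟩, c⟩)
    · obtain ⟨z, rfl, rfl, -⟩ := hsurj a b 0
      obtain ⟨m, hz, hm⟩ := hpt z 2
      exact ⟨m, fun p => (h2 m z hz hm p).trans (by simp [prod, lineThree])⟩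
    · obtain ⟨z, rfl, -, rfl⟩ := hsurj a 0 c
      obtain ⟨m, hz, hm⟩ := hpt z 1
      exact ⟨m, fun p => (h1 m z hz hm p).trans (by simp [prod, lineThree])⟩
    · obtain ⟨z, -, rfl, rfl⟩ := hsurj 0 b c
      obtain ⟨m, hz, hm⟩ := hpt z 0
      exact ⟨m, fun p => (h0 m z hz hm p).trans (by simp [prod, lineThree])⟩

end PointLineGeometry

theorem mainTheorem4 {P : Type*} {L : Type*} (N : PointLineGeometry P L)
    (hN : N.IsNearHexagon) (hord : N.HasOrder 2 2) :
    N.IsIsomorphic splitCayleyHexagon ∨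
    N.IsIsomorphic splitCayleyHexagon.dual ∨
    N.IsIsomorphic
      ((PointLineGeometry.lineThree.prod PointLineGeometry.lineThree).prod
        PointLineGeometry.lineThree) := by
  have h : N.IsNearHexagonTwo := ⟨hN, hord⟩
  rcases h.cross_dichotomy with hc | ⟨hcard, hc⟩
  · have := h.connected.nonempty
    rcases PointLineGeometry.isIsomorphic_of_isHexagonGraph hN.partialLinear (h.isHexagonGraph hc)
      (fun p q => h.point_ext) with e | e
    · exact Or.inl e
    · exact Or.inr (Or.inl e)
  · obtain ⟨κ, hdir, hpt⟩ := h.exists_coordinates hc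
    exact Or.inr (Or.inr
      (PointLineGeometry.isIsomorphic_prod_of_hasDirection hN.partialLinear hord hcard hdir hpt))
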